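/- Conventions. A (possibly disconnected) complex torus is $T=\operatorname{Hom}(\Lambda,\mathbb C^*)$ with $\Lambda$ a finitely generated abelian group, its character group; $T\cong(\mathbb C^*)^r$ if $\Lambda\cong\mathbb Z^r$. A toric arrangement $\Delta=\{(a_e,\chi_e)\}_{e\in E}$ in $T$ ($E$ finite, $a_e\in\mathbb C^*$, $\chi_e\in\Lambda$) consists of the hypertori $H_e=\{1-a_e\chi_e=0\}$. Its multiplicity function assigns to $S\subseteq E$ the number $m(S)$ of connected components of $\bigcap_{e\in S}H_e$. It is centred if all $a_e=1$, surjective if the $\chi_e$ generate $\Lambda$, and essential if the subgroup $\Gamma$ generated by the $\chi_e$ has maximal rank in $\Lambda$. **Theorem.** Let $U$ be a connected torus with character lattice $\Gamma$, let $\Delta_U=\{(a_e,\chi_e)\}_{e\in E}$ be a surjective toric arrangement in $U$ with multiplicity function $m_U$, and let $T\to U$ be a covering of connected tori whose Galois group is dual to the finite abelian group $G$. Let $m_T$ be the multiplicity function of the arrangement $\Delta_U$ lifted to $T$. For $S\subseteq E$ let $\Gamma_S=\langle\chi_e\rangle_{e\in S}$, let $F_S=\Gamma/\operatorname{Rad}_\Gamma(\Gamma_S)$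 with $\operatorname{Rad}_\Gamma(\Gamma_S)=\{\gamma\in\Gamma: n\gamma\in\Gamma_S \text{ for some integer } n\ne0\}$, let $\pi_S\colon\operatorname{Ext}^1(G,\Gamma)\to\operatorname{Ext}^1(G,F_S)$ be the induced map, and for $x\in\operatorname{Ext}^1(G,\Gamma)$ let $H_S(x)$ be the largest subgroup $H$ of $G$ such that $\pi_S(x)$ restricts to $0$ in $\operatorname{Ext}^1(H,F_S)$. Call $x$ coherent with $\Delta_U$ and $m_T$ if $|H_S(x)|\,m_U(S)=m_T(S)$ for all $S\subseteq E$, and let $\mathcal C$ be the set of coherent elements. Then there is a bijection $$\mathcal C/\operatorname{Aut}(G)\;\longleftrightarrow\;\{T'\to U \text{ a covering by a possibly disconnected torus}: m_{T'}=m_T\}/\text{isomorphism over }U,$$ where $m_{T'}$ is the multiplicity function of $\Delta_U$ lifted to $T'$. It sends the class of $x$ to the covering $\operatorname{Hom}(X,\mathbb C^*)\to\operatorname{Hom}(\Gamma,\mathbb C^*)=U$, for any extension $0\to\Gamma\to X\to G\to0$ of class $x$. **Corollary.** Let $\Delta=\{(1,\chi_e)\}_{e\in E}$ and $\Delta'=\{(1,\chi'_e)\}_{e\in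 E}$ be centred toric arrangements in a connected torus $T$ with character lattice $\Lambda$. Let $\Gamma,\Gamma'\subseteq\Lambda$ be the sublattices generated by their characters, and let $x(\Delta)\in\operatorname{Ext}^1(\Lambda/\Gamma,\Gamma)$ be the class of $0\to\Gamma\to\Lambda\to\Lambda/\Gamma\to0$; similarly $x(\Delta')$. The layers of an arrangement are the connected components of the intersections of its hypertori, ordered by reverse inclusion. Say that $\Delta,\Delta'$ have the same poset of layers if there is an isomorphism of their posets of layers such that, for all $e\in E$, a layer lies in $H_e$ if and only if its image lies in $H'_e$. For an isomorphism $\varphi\colon\Gamma\to\Gamma'$ say that $\varphi$ matches the classes if $\varphi_*x(\Delta)=\sigma^*x(\Delta')$ for some isomorphism $\sigma\colon\Lambda/\Gamma\to\Lambda/\Gamma'$. Then: 1. If $\Delta$ is essential, $x(\Delta)$ is coherent with the surjective arrangement given by the $\chi_e$ in $\operatorname{Hom}(\Gamma,\mathbb C^*)$ and with the multiplicity function of $\Delta$. 2. If $\Delta,\Delta'$ have the same poset of layers, there are signs $\varepsilon_e=\pm1$ and an isomorphism $\varphi\colon\Gamma\to\Gamma'$ with $\varphi(\chi_e)=\varepsilon_e\chi'_e$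 for all $e$. 3. There is an automorphism $g$ of the torus $T$ with $g(H_e)=H'_e$ for all $e$ if and only if $\Delta,\Delta'$ have the same poset of layers and some $\varphi$ as in 2 (for some choice of signs) matches the classes. 4. Suppose that $\Delta$ and $\Delta'$ are in normal form with respect to the same $B\subseteq E$ and the same forest $F$: the characters indexed by $B$ are a basis of $\Lambda\otimes\mathbb Q$, $F$ is a maximal forest in the bipartite graph with vertex classes $B$ and $E\setminus B$ whose edges are the $\{i,j\}$ with $a_{ij}\neq0$, where $\chi_j=\sum_{i\in B}a_{ij}\chi_i$ for $j\notin B$, and $a_{ij}>0$ for all edges $\{i,j\}$ of $F$ (all this for $\Delta$, and likewise for $\Delta'$). If $\Delta,\Delta'$ have the same poset of layers, there is a unique isomorphism $\varphi\colon\Gamma\to\Gamma'$ with $\varphi(\chi_e)=\chi'_e$ for all $e$. Moreover there is an automorphism $g$ of $T$ with $\chi'_e\circ g=\chi_e$ for all $e$ if and only if $\Delta,\Delta'$ have the same poset of layers and this $\varphi$ matches the classes. -/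

import Mathlib

open CategoryTheory Abelian
open scoped TensorProduct

noncomputable section

/-! ### Tori and their coverings -/

/-- The diagonalizable group `Hom(Λ, ℂ*)` with character group the finitely generated abelian
group `Λ`: a complex torus `(ℂ*)^r` when `Λ` is free of rank `r`, and a possibly disconnected
torus in general. -/
def AlgTorus (Λ : Type) [AddCommGroup Λ] : Type := Multiplicative Λ →* ℂˣ

instance (Λ : Type) [AddCommGroup Λ] : CommGroup (AlgTorus Λ) :=
  inferInstanceAs (CommGroup (Multiplicative Λ →* ℂˣ))

/-- The character of the torus `Hom(Λ, ℂ*)` given by `l : Λ`. -/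
def torusChar {Λ : Type} [AddCommGroup Λ] (l : Λ) : AlgTorus Λ →* ℂˣ where
  toFun t := (show Multiplicative Λ →* ℂˣ from t) (Multiplicative.ofAdd l)
  map_one' := rfl
  map_mul' _ _ := rfl

/-- The complex topology: the topology of pointwise convergence, which for `Λ = ℤ^r` is the usual
topology of `(ℂ*)^r`. -/
instance (Λ : Type) [AddCommGroup Λ] : TopologicalSpace (AlgTorus Λ) :=
  TopologicalSpace.induced (fun t (l : Λ) => torusChar l t) inferInstance

/-- Homomorphisms of algebraic groups: the pullback of every character is a character. -/
def IsAlgHom {Λ₁ Λ₂ : Type} [AddCommGroup Λ₁] [AddCommGroup Λ₂]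
    (f : AlgTorus Λ₁ →* AlgTorus Λ₂) : Prop :=
  ∀ l₂ : Λ₂, ∃ l₁ : Λ₁, ∀ t, torusChar l₂ (f t) = torusChar l₁ t

/-- Isomorphisms of algebraic groups. -/
def IsAlgIso {Λ₁ Λ₂ : Type} [AddCommGroup Λ₁] [AddCommGroup Λ₂]
    (f : AlgTorus Λ₁ ≃* AlgTorus Λ₂) : Prop :=
  IsAlgHom f.toMonoidHom ∧ IsAlgHom f.symm.toMonoidHom

/-- The homomorphism `Hom(X, ℂ*) → Hom(Γ, ℂ*)` given by restriction along `i : Γ → X`. -/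
def dualHom {Γ X : Type} [AddCommGroup Γ] [AddCommGroup X] (i : Γ →ₗ[ℤ] X) :
    AlgTorus X →* AlgTorus Γ where
  toFun t := (show Multiplicative X →* ℂˣ from t).comp
    (AddMonoidHom.toMultiplicative i.toAddMonoidHom)
  map_one' := rfl
  map_mul' _ _ := rfl

theorem dualHom_isAlgHom {Γ X : Type} [AddCommGroup Γ] [AddCommGroup X] (i : Γ →ₗ[ℤ] X) :
    IsAlgHom (dualHom i) := fun l => ⟨i l, fun _ => rfl⟩

/-- A covering `T' → U` of the torus `U = Hom(Γ, ℂ*)` by a possibly disconnected torus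
`T' = Hom(Λ, ℂ*)`. -/
structure TorusCovering (Γ : Type) [AddCommGroup Γ] where
  Λ : Type
  [group : AddCommGroup Λ]
  [fg : Module.Finite ℤ Λ]
  proj : AlgTorus Λ →* AlgTorus Γ
  isAlgHom : IsAlgHom proj
  isCovering : IsCoveringMap proj

attribute [instance] TorusCovering.group TorusCovering.fg

/-- Isomorphism over `U`. -/
def TorusCovering.Iso {Γ : Type} [AddCommGroup Γ] (c d : TorusCovering Γ) : Prop :=
  ∃ f : AlgTorus c.Λ ≃* AlgTorus d.Λ, IsAlgIso f ∧ ∀ t, d.proj (f t) = c.proj t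

instance TorusCovering.setoid (Γ : Type) [AddCommGroup Γ] : Setoid (TorusCovering Γ) where
  r := TorusCovering.Iso
  iseqv :=
    { refl := fun _ => ⟨MulEquiv.refl _, ⟨fun l => ⟨l, fun _ => rfl⟩, fun l => ⟨l, fun _ => rfl⟩⟩,
        fun _ => rfl⟩
      symm := by
        rintro c d ⟨f, hf, h⟩
        exact ⟨f.symm, ⟨hf.2, hf.1⟩, fun t => by rw [← h, f.apply_symm_apply]⟩
      trans := by
        rintro c d e ⟨f, hf, h⟩ ⟨g, hg, h'⟩
        refine ⟨f.trans g, ⟨fun l => ?_, fun l => ?_⟩, fun t => ?_⟩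
        · obtain ⟨l₁, h₁⟩ := hg.1 l
          obtain ⟨l₂, h₂⟩ := hf.1 l₁
          exact ⟨l₂, fun t => (h₁ (f t)).trans (h₂ t)⟩
        · obtain ⟨l₁, h₁⟩ := hf.2 l
          obtain ⟨l₂, h₂⟩ := hg.2 l₁
          exact ⟨l₂, fun t => (h₁ (g.symm t)).trans (h₂ t)⟩
        · exact (h' (f t)).trans (h t) }

/-! ### Toric arrangements -/

/-- The data `(a_e, χ_e)`, `e ∈ E`, of a toric arrangement in the torus `Hom(Λ, ℂ*)`. -/
structure ToricArrangement (Λ : Type) [AddCommGroup Λ] (E : Type) where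
  a : E → ℂˣ
  χ : E → Λ

namespace ToricArrangement

variable {Λ : Type} [AddCommGroup Λ] {E : Type}

def IsCentred (Δ : ToricArrangement Λ E) : Prop := ∀ e, Δ.a e = 1

/-- The sublattice generated by the characters of the arrangement. -/
def charSpan (Δ : ToricArrangement Λ E) : Submodule ℤ Λ := Submodule.span ℤ (Set.range Δ.χ)

/-- The sublattice `Γ_S` generated by the characters `χ_e`, `e ∈ S`. -/
def subSpan (Δ : ToricArrangement Λ E) (S : Set E) : Submodule ℤ Λ :=
  Submodule.span ℤ (Δ.χ '' S)

def IsSurjective (Δ : ToricArrangement Λ E) : Prop := Δ.charSpan = ⊤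

def IsEssential (Δ : ToricArrangement Λ E) : Prop :=
  Module.finrank ℤ Δ.charSpan = Module.finrank ℤ Λ

/-- The hypertorus `H_e`, the zero locus of `1 - a_e χ_e`. -/
def hypertorus (Δ : ToricArrangement Λ E) (e : E) : Set (AlgTorus Λ) :=
  {t | (1 : ℂ) - (Δ.a e : ℂ) * (torusChar (Δ.χ e) t : ℂ) = 0}

/-- The intersection of the hypertori `H_e`, `e ∈ S` (the whole torus for `S = ∅`). -/
def inter (Δ : ToricArrangement Λ E) (S : Set E) : Set (AlgTorus Λ) :=
  {t | ∀ e ∈ S, t ∈ Δ.hypertorus e}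

/-- The multiplicity function: the number of connected components of the intersection. -/
def mult (Δ : ToricArrangement Λ E) (S : Set E) : ℕ :=
  Nat.card (ConnectedComponents (Δ.inter S))

/-- The multiplicity function of the arrangement lifted along a covering `p : T' → U`: the lifted
hypertorus is the zero locus of `1 - a_e (χ_e ∘ p)`. -/
def liftMult (Δ : ToricArrangement Λ E) (c : TorusCovering Λ) (S : Set E) : ℕ :=
  Nat.card (ConnectedComponents
    {t : AlgTorus c.Λ |
      ∀ e ∈ S, (1 : ℂ) - (Δ.a e : ℂ) * (torusChar (Δ.χ e) (c.proj t) : ℂ) = 0})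

/-! ### The poset of layers -/

/-- The layers: the connected components of the intersections of hypertori. -/
def Layer (Δ : ToricArrangement Λ E) : Type :=
  {W : Set (AlgTorus Λ) // ∃ S : Set E, ∃ t ∈ Δ.inter S, W = connectedComponentIn (Δ.inter S) t}

/-- Layers are ordered by reverse inclusion. -/
instance (Δ : ToricArrangement Λ E) : PartialOrder Δ.Layer :=
  PartialOrder.lift (fun W => OrderDual.toDual W.1) (fun _ _ h => Subtype.ext h)

/-- Two arrangements indexed by `E` have the same poset of layers: there is an isomorphism of
posets that respects the hypertori `H_e`, `e ∈ E`. -/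
def SameLayerPoset {Λ' : Type} [AddCommGroup Λ'] (Δ : ToricArrangement Λ E)
    (Δ' : ToricArrangement Λ' E) : Prop :=
  ∃ f : Δ.Layer ≃o Δ'.Layer, ∀ (e : E) (W : Δ.Layer),
    W.1 ⊆ Δ.hypertorus e ↔ (f W).1 ⊆ Δ'.hypertorus e

/-! ### Normal form -/

/-- The bipartite graph of the matrix `A`, where `(id | A)` is the matrix of the characters in the
basis `b` of `Λ ⊗ ℚ` indexed by `B ⊆ E`: its edges join `i ∈ B` and `j ∉ B` with `a_{ij} ≠ 0`. -/
def coordGraph (Δ : ToricArrangement Λ E) {B : Set E}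
    (b : Module.Basis B ℚ (ℚ ⊗[ℤ] Λ)) : SimpleGraph E :=
  SimpleGraph.fromRel fun i j => ∃ hi : i ∈ B, j ∉ B ∧ b.repr (1 ⊗ₜ[ℤ] Δ.χ j) ⟨i, hi⟩ ≠ 0

/-- The characters indexed by `B` are a basis of `Λ ⊗ ℚ`, `F` is a maximal forest of the bipartite
graph, and all entries `a_{ij}` with `{i, j}` an edge of `F` are positive. -/
def IsNormalForm (Δ : ToricArrangement Λ E) (B : Set E) (F : SimpleGraph E) : Prop :=
  ∃ b : Module.Basis B ℚ (ℚ ⊗[ℤ] Λ), (∀ i : B, b i = 1 ⊗ₜ[ℤ] Δ.χ i) ∧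
    Maximal (fun F' : SimpleGraph E => F' ≤ Δ.coordGraph b ∧ F'.IsAcyclic) F ∧
    ∀ (i : B) (j : E), j ∉ B → F.Adj i j → 0 < b.repr (1 ⊗ₜ[ℤ] Δ.χ j) i

end ToricArrangement

/-! ### `Ext¹` and coherent elements -/

/-- The group `Ext¹_ℤ(G, Γ)`. -/
abbrev ExtOne (G Γ : Type) [AddCommGroup G] [AddCommGroup Γ] : Type :=
  Ext (ModuleCat.of ℤ G) (ModuleCat.of ℤ Γ) 1

/-- The pullback `f^* : Ext¹(G, Γ) → Ext¹(H, Γ)` along `f : H → G`. -/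
def extPull {G H Γ : Type} [AddCommGroup G] [AddCommGroup H] [AddCommGroup Γ]
    (f : H →ₗ[ℤ] G) (x : ExtOne G Γ) : ExtOne H Γ :=
  (Ext.mk₀ (ModuleCat.ofHom f)).comp x (zero_add 1)

/-- The pushforward `f_* : Ext¹(G, Γ) → Ext¹(G, F)` along `f : Γ → F`. -/
def extPush {G Γ F : Type} [AddCommGroup G] [AddCommGroup Γ] [AddCommGroup F]
    (f : Γ →ₗ[ℤ] F) (x : ExtOne G Γ) : ExtOne G F :=
  x.comp (Ext.mk₀ (ModuleCat.ofHom f)) (add_zero 1)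

/-- The class in `Ext¹(G, Γ)` of an extension `0 → Γ → X → G → 0`. -/
def extensionClass {Γ X G : Type} [AddCommGroup Γ] [AddCommGroup X] [AddCommGroup G]
    (i : Γ →ₗ[ℤ] X) (q : X →ₗ[ℤ] G) (hi : Function.Injective i) (hiq : Function.Exact i q)
    (hq : Function.Surjective q) : ExtOne G Γ :=
  (ModuleCat.shortComplex_shortExact
    (ShortComplex.mk (ModuleCat.ofHom i) (ModuleCat.ofHom q)
      (ModuleCat.hom_ext hiq.linearMap_comp_eq_zero)) hiq hi hq).extClass

/-- The radical `{γ | n γ ∈ N for some integer n ≠ 0}` of a sublattice. -/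
def radical {Γ : Type} [AddCommGroup Γ] (N : Submodule ℤ Γ) : Submodule ℤ Γ :=
  (Submodule.torsion ℤ (Γ ⧸ N)).comap N.mkQ

/-- The largest subgroup `H` of `G` with `i_H^*(y) = 0` (for `G` finite and `F` free, the supremum
is itself such a subgroup). -/
def maxSplit {G F : Type} [AddCommGroup G] [AddCommGroup F] (y : ExtOne G F) : Submodule ℤ G :=
  sSup {H : Submodule ℤ G | extPull H.subtype y = 0}

/-- `x ∈ Ext¹(G, Γ)` is coherent with `Δ_U` and `m_T`: `|H_S(x)| · m_U(S) = m_T(S)` for all `S`,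
where `H_S(x)` belongs to the image of `x` in `Ext¹(G, Γ / Rad Γ_S)`. -/
def IsCoherent {G Γ E : Type} [AddCommGroup G] [AddCommGroup Γ] (ΔU : ToricArrangement Γ E)
    (mT : Set E → ℕ) (x : ExtOne G Γ) : Prop :=
  ∀ S : Set E,
    Nat.card (maxSplit (extPush (radical (ΔU.subSpan S)).mkQ x)) * ΔU.mult S = mT S

/-- `Ext¹(G, Γ)` up to the action of `Aut(G)`. -/
def extAutSetoid (G Γ : Type) [AddCommGroup G] [AddCommGroup Γ] : Setoid (ExtOne G Γ) where
  r x y := ∃ σ : G ≃ₗ[ℤ] G, extPull σ.toLinearMap x = y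
  iseqv :=
    { refl := fun x => ⟨LinearEquiv.refl ℤ G, by
        change (Ext.mk₀ (𝟙 _)).comp x _ = x
        simp⟩
      symm := by
        rintro x y ⟨σ, rfl⟩
        refine ⟨σ.symm, ?_⟩
        simp only [extPull, Ext.mk₀_comp_mk₀_assoc, ← ModuleCat.ofHom_comp]
        simp
      trans := by
        rintro x y z ⟨σ, rfl⟩ ⟨τ, rfl⟩
        refine ⟨τ.trans σ, ?_⟩
        simp only [extPull, Ext.mk₀_comp_mk₀_assoc, ← ModuleCat.ofHom_comp]
        rfl }

/-- The set `𝒞 / Aut(G)` of coherent elements up to automorphisms of `G`. -/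
abbrev CoherentClasses (G : Type) {Γ E : Type} [AddCommGroup G] [AddCommGroup Γ]
    (ΔU : ToricArrangement Γ E) (mT : Set E → ℕ) : Type :=
  Quotient ((extAutSetoid G Γ).comap
    (Subtype.val : {x : ExtOne G Γ // IsCoherent ΔU mT x} → ExtOne G Γ))

/-- The set `{T' → U | m_{T'} = m_T}` of coverings up to isomorphism over `U`. -/
abbrev CoveringClasses {Γ E : Type} [AddCommGroup Γ]
    (ΔU : ToricArrangement Γ E) (mT : Set E → ℕ) : Type 1 :=
  Quotient ((TorusCovering.setoid Γ).comap
    (Subtype.val : {c : TorusCovering Γ // ΔU.liftMult c = mT} → TorusCovering Γ))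

/-! ### The invariant of an arrangement -/

namespace ToricArrangement

variable {Λ : Type} [AddCommGroup Λ] {E : Type}

/-- The surjective arrangement with the same data `(a_e, χ_e)` in the torus with character group
the sublattice `Γ` generated by the characters. -/
def toU (Δ : ToricArrangement Λ E) : ToricArrangement Δ.charSpan E where
  a := Δ.a
  χ e := ⟨Δ.χ e, Submodule.subset_span ⟨e, rfl⟩⟩

/-- The class in `Ext¹(Λ/Γ, Γ)` of the extension `0 → Γ → Λ → Λ/Γ → 0`. -/
def invClass (Δ : ToricArrangement Λ E) : ExtOne (Λ ⧸ Δ.charSpan) Δ.charSpan :=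
  extensionClass Δ.charSpan.subtype Δ.charSpan.mkQ Δ.charSpan.injective_subtype
    (LinearMap.exact_subtype_mkQ _) (Submodule.mkQ_surjective _)

/-- The classes of `Δ` and `Δ'` agree modulo automorphisms of `G`, after the lattices `Γ` and `Γ'`
are identified by `φ`. -/
def SameClass {Λ' : Type} [AddCommGroup Λ'] (Δ : ToricArrangement Λ E)
    (Δ' : ToricArrangement Λ' E) (φ : Δ.charSpan ≃ₗ[ℤ] Δ'.charSpan) : Prop :=
  ∃ σ : (Λ ⧸ Δ.charSpan) ≃ₗ[ℤ] (Λ' ⧸ Δ'.charSpan),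
    extPush φ.toLinearMap Δ.invClass = extPull σ.toLinearMap Δ'.invClass

end ToricArrangement

end

/-! Duality turns every assertion into one about character groups. A covering of `Hom(Γ, ℂ*)` is
dual to an injection `Γ → X` with finite cokernel (`isCoveringMap_dualHom`,
`injective_of_isCoveringMap`, `finite_of_isCoveringMap`), that is, to an extension of a finite group
by `Γ`. Two such coverings with cokernel `G` are isomorphic over the base exactly when their classes
agree up to `Aut(G)` (`extensionCovering_iso_iff`).

A nonempty intersection of hypertori is a coset of the annihilator of a sublattice `N`, and it has
`[Rad N : N]` components (`card_connectedComponents`). Pushing a class forward to `Γ / Rad Γ_S`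
amounts to dividing `X` by the image of `Rad Γ_S`, and `H_S(x)` is the image of the torsion of that
quotient. Multiplicativity of indices then gives `|H_S(x)| m_U(S) = m_{T'}(S)`
(`card_maxSplit_mul_mult`), so coherence says precisely that the covering has the prescribed
multiplicities.

What remains for surjectivity is that the multiplicities determine the cokernel
(`nonempty_cokernel_equiv`). This is done prime by prime: some independent set `B` of characters
spans a sublattice of index prime to `p`; the coordinates with respect to `B` have common kernels on
the cokernel whose orders are multiplicities; and a coordinate with largest image on the `p`-part
splits off a cyclic summand, so induction applies (`nonempty_addEquiv_of_card_coord_ker`).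

For the corollary, the poset of layers knows the multiplicities and which characters depend
rationally on which others, hence all maximal minors of the coordinate matrix up to sign
(`SameLayerPoset.sq_det_eq`). After normalisation the entries agree up to signs, which live on the
edges of the bipartite support graph. If these do not come from signs of rows and columns, some
induced cycle has negative product. The minor along that cycle is `P ± Q`, and its square determines
`PQ`, which the signs would negate: a contradiction (`exists_signs_of_sq_det_eq`). Thus the
relations agree up to column signs, and in normal form the forest removes these signs. Finally, an
isomorphism `φ` of the sublattices extends to the character groups exactly when it matches the
extension classes (`exists_sameClass_iff`). -/

noncomputable section

/-! ### Points and characters of diagonalizable groups -/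

namespace AlgTorus

variable {Λ Λ' Λ₁ Λ₂ Γ X : Type} [AddCommGroup Λ] [AddCommGroup Λ'] [AddCommGroup Λ₁]
  [AddCommGroup Λ₂] [AddCommGroup Γ] [AddCommGroup X]

/-- The point of the torus given by a homomorphism to the additive version of `ℂ*`. -/
def ofHom (f : Λ →+ Additive ℂˣ) : AlgTorus Λ := AddMonoidHom.toMultiplicativeLeft f

theorem ext {t u : AlgTorus Λ} (h : ∀ l, torusChar l t = torusChar l u) : t = u :=
  MonoidHom.ext fun l => h l.toAdd

@[simp] theorem torusChar_add (a b : Λ) (t : AlgTorus Λ) :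
    torusChar (a + b) t = torusChar a t * torusChar b t :=
  map_mul (show Multiplicative Λ →* ℂˣ from t) (.ofAdd a) (.ofAdd b)

@[simp] theorem torusChar_zero (t : AlgTorus Λ) : torusChar (0 : Λ) t = 1 :=
  map_one (show Multiplicative Λ →* ℂˣ from t)

@[simp] theorem torusChar_neg (a : Λ) (t : AlgTorus Λ) :
    torusChar (-a) t = (torusChar a t)⁻¹ :=
  map_inv (show Multiplicative Λ →* ℂˣ from t) (.ofAdd a)

@[simp] theorem torusChar_sub (a b : Λ) (t : AlgTorus Λ) :
    torusChar (a - b) t = torusChar a t / torusChar b t := by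
  rw [sub_eq_add_neg, torusChar_add, torusChar_neg, div_eq_mul_inv]

@[simp] theorem torusChar_zsmul (n : ℤ) (a : Λ) (t : AlgTorus Λ) :
    torusChar (n • a) t = torusChar a t ^ n :=
  map_zpow (show Multiplicative Λ →* ℂˣ from t) (.ofAdd a) n

@[simp] theorem torusChar_nsmul (n : ℕ) (a : Λ) (t : AlgTorus Λ) :
    torusChar (n • a) t = torusChar a t ^ n :=
  map_pow (show Multiplicative Λ →* ℂˣ from t) (.ofAdd a) n

@[simp] theorem torusChar_dualHom (i : Γ →ₗ[ℤ] X) (γ : Γ) (t : AlgTorus X) :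
    torusChar γ (dualHom i t) = torusChar (i γ) t := rfl

theorem isInducing_eval :
    Topology.IsInducing (fun (t : AlgTorus Λ) (l : Λ) => torusChar l t) := ⟨rfl⟩

theorem continuous_torusChar (l : Λ) : Continuous (fun t : AlgTorus Λ => torusChar l t) :=
  (continuous_apply l).comp isInducing_eval.continuous

theorem continuous_iff {Z : Type*} [TopologicalSpace Z] {f : Z → AlgTorus Λ} :
    Continuous f ↔ ∀ l, Continuous fun z => torusChar l (f z) := by
  rw [isInducing_eval.continuous_iff, continuous_pi_iff]
  rfl

theorem continuousAt_iff {Z : Type*} [TopologicalSpace Z] {f : Z → AlgTorus Λ} {z : Z} :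
    ContinuousAt f z ↔ ∀ l, ContinuousAt (fun z => torusChar l (f z)) z := by
  rw [isInducing_eval.continuousAt_iff, continuousAt_pi]
  rfl

instance : IsTopologicalGroup (AlgTorus Λ) where
  continuous_mul := continuous_iff.2 fun l => by
    simp only [map_mul]
    exact ((continuous_torusChar l).comp continuous_fst).mul
      ((continuous_torusChar l).comp continuous_snd)
  continuous_inv := continuous_iff.2 fun l => by
    simp only [map_inv]
    exact (continuous_torusChar l).inv

instance : T2Space (AlgTorus Λ) :=
  T2Space.of_injective_continuous (f := fun (t : AlgTorus Λ) (l : Λ) => torusChar l t)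
    (fun _ _ h => ext fun l => congrFun h l) isInducing_eval.continuous

theorem continuous_of_isAlgHom {f : AlgTorus Λ₁ →* AlgTorus Λ₂} (hf : IsAlgHom f) :
    Continuous f :=
  continuous_iff.2 fun l => by
    obtain ⟨m, hm⟩ := hf l
    simpa only [hm] using continuous_torusChar m

/-- Characters of `Hom(Λ, ℂ*)` separate the elements of `Λ`. -/
theorem exists_torusChar_ne_one {l : Λ} (hl : l ≠ 0) : ∃ t : AlgTorus Λ, torusChar l t ≠ 1 := by
  obtain ⟨c, hc⟩ := CharacterModule.exists_character_apply_ne_zero_of_ne_zero hl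
  -- The map `q ↦ exp(2πiq)` has kernel `ℤ`, so it embeds `ℚ/ℤ` in `ℂ*` and turns a `ℚ/ℤ`-valued
  -- character into a point of the torus.
  let e : ℚ →+ Additive ℂˣ := AddMonoidHom.mk'
    (fun q => Additive.ofMul (Units.mk0 (Complex.exp (2 * Real.pi * Complex.I * q))
      (Complex.exp_ne_zero _))) fun a b => by
        rw [← ofMul_mul]
        congr 1
        ext
        simp [mul_add, Complex.exp_add]
  have he : ∀ q, e q = 0 ↔ q ∈ AddSubgroup.zmultiples (1 : ℚ) := by
    intro q
    have h1 : e q = 0 ↔ Complex.exp (2 * Real.pi * Complex.I * q) = 1 := by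
      rw [← Additive.toMul.injective.eq_iff, ← Units.val_inj]
      rfl
    rw [h1, Complex.exp_eq_one_iff, AddSubgroup.mem_zmultiples_iff]
    refine exists_congr fun n => ?_
    have h2 : (2 * Real.pi * Complex.I : ℂ) ≠ 0 := Complex.two_pi_I_ne_zero
    rw [mul_comm (n : ℂ), mul_right_inj' h2, zsmul_one]
    constructor
    · intro h; exact_mod_cast h.symm
    · intro h; exact_mod_cast h.symm
  let ē : AddCircle (1 : ℚ) →+ Additive ℂˣ := QuotientAddGroup.lift _ e fun q hq => (he q).2 hq
  have hē : ∀ z, ē z = 0 → z = 0 := by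
    intro z
    induction z using QuotientAddGroup.induction_on with
    | H q =>
      intro hq
      exact (QuotientAddGroup.eq_zero_iff q).2 ((he q).1 hq)
  refine ⟨ofHom (ē.comp c), fun h => hc (hē _ ?_)⟩
  exact h

theorem torusChar_injective {a b : Λ} (h : ∀ t, torusChar a t = torusChar b t) : a = b := by
  by_contra hab
  obtain ⟨t, ht⟩ := exists_torusChar_ne_one (sub_ne_zero.2 hab)
  exact ht (by rw [torusChar_sub, h, div_self'])

/-- A character that is trivial on the annihilator of `N` belongs to `N`. -/
theorem mem_of_forall_torusChar_eq_one {N : Submodule ℤ Λ} {l : Λ}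
    (h : ∀ t : AlgTorus Λ, (∀ n ∈ N, torusChar n t = 1) → torusChar l t = 1) : l ∈ N := by
  rw [← Submodule.Quotient.mk_eq_zero]
  by_contra hl
  obtain ⟨t, ht⟩ := exists_torusChar_ne_one hl
  refine ht (h (dualHom N.mkQ t) fun n hn => ?_)
  rw [torusChar_dualHom, Submodule.mkQ_apply, (Submodule.Quotient.mk_eq_zero N).2 hn,
    torusChar_zero]

/-- Homomorphisms of algebraic groups are dual to homomorphisms of the character groups. -/
theorem exists_eq_dualHom {f : AlgTorus Λ₁ →* AlgTorus Λ₂} (hf : IsAlgHom f) :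
    ∃ i : Λ₂ →ₗ[ℤ] Λ₁, f = dualHom i := by
  choose i hi using hf
  refine ⟨(AddMonoidHom.mk' i fun a b => torusChar_injective fun t => ?_).toIntLinearMap, ?_⟩
  · rw [← hi, torusChar_add, torusChar_add, hi, hi]
  · exact MonoidHom.ext fun t => ext fun l => hi l t

theorem dualHom_injective {i j : Γ →ₗ[ℤ] X} (h : ∀ t, dualHom i t = dualHom j t) : i = j :=
  LinearMap.ext fun γ => torusChar_injective fun t => by
    rw [← torusChar_dualHom, h, torusChar_dualHom]

/-- The isomorphism of algebraic groups dual to an isomorphism of the character groups. -/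
def dualEquiv (e : Γ ≃ₗ[ℤ] X) : AlgTorus X ≃* AlgTorus Γ where
  toFun := dualHom e.toLinearMap
  invFun := dualHom e.symm.toLinearMap
  left_inv t := ext fun l => by simp
  right_inv t := ext fun l => by simp
  map_mul' := map_mul _

@[simp] theorem torusChar_dualEquiv (e : Γ ≃ₗ[ℤ] X) (γ : Γ) (t : AlgTorus X) :
    torusChar γ (dualEquiv e t) = torusChar (e γ) t := rfl

theorem isAlgIso_dualEquiv (e : Γ ≃ₗ[ℤ] X) : IsAlgIso (dualEquiv e) :=
  ⟨dualHom_isAlgHom _, dualHom_isAlgHom _⟩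

/-- Isomorphisms of algebraic groups are dual to isomorphisms of the character groups. -/
theorem exists_eq_dualEquiv {f : AlgTorus Λ₁ ≃* AlgTorus Λ₂} (hf : IsAlgIso f) :
    ∃ e : Λ₂ ≃ₗ[ℤ] Λ₁, f = dualEquiv e := by
  obtain ⟨i, hi⟩ := exists_eq_dualHom hf.1
  obtain ⟨j, hj⟩ := exists_eq_dualHom hf.2
  have hi' : ∀ t, f t = dualHom i t := fun t => DFunLike.congr_fun hi t
  have hj' : ∀ t, f.symm t = dualHom j t := fun t => DFunLike.congr_fun hj t
  refine ⟨LinearEquiv.ofLinearMap i j ?_ ?_, MulEquiv.ext hi'⟩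
  · refine dualHom_injective fun t => ?_
    change dualHom j (dualHom i t) = t
    rw [← hi', ← hj', f.symm_apply_apply]
  · refine dualHom_injective fun t => ?_
    change dualHom i (dualHom j t) = t
    rw [← hi', ← hj', f.apply_symm_apply]

/-! ### Logarithms -/

/-- The point `exp ∘ ℓ` of the torus. -/
def exp (ℓ : Λ →ₗ[ℤ] ℂ) : AlgTorus Λ := ofHom <| AddMonoidHom.mk'
  (fun l => Additive.ofMul (Units.mk0 (Complex.exp (ℓ l)) (Complex.exp_ne_zero _))) fun a b => by
    rw [← ofMul_mul]
    congr 1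
    ext
    simp [Complex.exp_add]

@[simp] theorem val_torusChar_exp (ℓ : Λ →ₗ[ℤ] ℂ) (l : Λ) :
    (torusChar l (exp ℓ) : ℂ) = Complex.exp (ℓ l) := rfl

theorem continuous_iff_val {Z : Type*} [TopologicalSpace Z] {f : Z → AlgTorus Λ} :
    Continuous f ↔ ∀ l, Continuous fun z => (torusChar l (f z) : ℂ) := by
  simp only [continuous_iff, Units.isEmbedding_val₀.continuous_iff]
  rfl

theorem continuousAt_iff_val {Z : Type*} [TopologicalSpace Z] {f : Z → AlgTorus Λ} {z : Z} :
    ContinuousAt f z ↔ ∀ l, ContinuousAt (fun z => (torusChar l (f z) : ℂ)) z := by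
  simp only [continuousAt_iff, Units.isEmbedding_val₀.continuousAt_iff]
  rfl

/-- A point of the torus as a linear map to the additive version of `ℂ*`. -/
def toLin (t : AlgTorus Λ) : Λ →ₗ[ℤ] Additive ℂˣ :=
  (AddMonoidHom.mk' (fun l => Additive.ofMul (torusChar l t)) fun a b => by
    rw [torusChar_add, ofMul_mul]).toIntLinearMap

/-- The logarithm of a point of a torus with free character group. -/
def log [Module.Free ℤ Λ] (t : AlgTorus Λ) : Λ →ₗ[ℤ] ℂ :=
  (Module.Free.chooseBasis ℤ Λ).constr ℤ fun b =>
    Complex.log (torusChar (Module.Free.chooseBasis ℤ Λ b) t)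

theorem exp_log [Module.Free ℤ Λ] (t : AlgTorus Λ) : exp (log t) = t := by
  have key : toLin (exp (log t)) = toLin t := by
    refine (Module.Free.chooseBasis ℤ Λ).ext fun b => ?_
    refine Additive.toMul.injective (Units.ext ?_)
    change ((torusChar _ (exp (log t)) : ℂˣ) : ℂ) = (torusChar _ t : ℂˣ)
    rw [val_torusChar_exp, log, Module.Basis.constr_basis, Complex.exp_log (Units.ne_zero _)]
  exact ext fun l => congrArg Additive.toMul (LinearMap.congr_fun key l)

theorem log_one [Module.Free ℤ Λ] : log (1 : AlgTorus Λ) = 0 :=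
  (Module.Free.chooseBasis ℤ Λ).ext fun b => by simp [log]

/-- The principal branch is used on the basis characters, so continuity holds near the identity but
not everywhere. Continuity at `1` is enough, because sections are later translated. -/
theorem continuousAt_log [Module.Free ℤ Λ] [Module.Finite ℤ Λ] (l : Λ) :
    ContinuousAt (fun t : AlgTorus Λ => log t l) 1 := by
  simp only [log, Module.Basis.constr_apply_fintype]
  refine tendsto_finsetSum _ fun b _ => ?_
  have h : ContinuousAt (fun t : AlgTorus Λ => Complex.log
      (torusChar (Module.Free.chooseBasis ℤ Λ b) t)) 1 :=
    (Units.continuous_val.comp (continuous_torusChar _)).continuousAt.clog (by simp)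
  simp only [zsmul_eq_mul]
  exact (h.const_mul _).tendsto

end AlgTorus
end

noncomputable section

/-! ### Radicals -/

section Radical

variable {Λ Γ X : Type} [AddCommGroup Λ] [AddCommGroup Γ] [AddCommGroup X]

theorem mem_radical {N : Submodule ℤ Λ} {x : Λ} :
    x ∈ radical N ↔ ∃ n : ℤ, n ≠ 0 ∧ n • x ∈ N := by
  rw [radical, Submodule.mem_comap, Submodule.mem_torsion_iff]
  constructor
  · rintro ⟨n, hn⟩
    refine ⟨n, nonZeroDivisors.coe_ne_zero n, ?_⟩
    rw [← Submodule.Quotient.mk_eq_zero]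
    exact hn
  · rintro ⟨n, hn, h⟩
    refine ⟨⟨n, mem_nonZeroDivisors_of_ne_zero hn⟩, ?_⟩
    exact (Submodule.Quotient.mk_eq_zero N).2 h

theorem le_radical (N : Submodule ℤ Λ) : N ≤ radical N := fun x hx =>
  mem_radical.2 ⟨1, one_ne_zero, by rwa [one_smul]⟩

theorem radical_mono {N M : Submodule ℤ Λ} (h : N ≤ M) : radical N ≤ radical M := fun _ hx =>
  let ⟨n, hn, hx⟩ := mem_radical.1 hx
  mem_radical.2 ⟨n, hn, h hx⟩

theorem radical_radical (N : Submodule ℤ Λ) : radical (radical N) = radical N := by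
  refine le_antisymm (fun x hx => ?_) (le_radical _)
  obtain ⟨n, hn, hx⟩ := mem_radical.1 hx
  obtain ⟨m, hm, hx⟩ := mem_radical.1 hx
  exact mem_radical.2 ⟨m * n, mul_ne_zero hm hn, by rwa [mul_smul]⟩

instance (N : Submodule ℤ Λ) : Module.IsTorsionFree ℤ (Λ ⧸ radical N) := by
  rw [Module.isTorsionFree_iff_smul_eq_zero]
  intro n z hz
  obtain ⟨x, rfl⟩ := Submodule.Quotient.mk_surjective _ z
  refine or_iff_not_imp_left.2 fun hn => ?_
  rw [← Submodule.Quotient.mk_smul, Submodule.Quotient.mk_eq_zero] at hz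
  rw [Submodule.Quotient.mk_eq_zero, ← radical_radical]
  exact mem_radical.2 ⟨n, hn, hz⟩

/-- The index of a sublattice in its radical. -/
def radIndex (N : Submodule ℤ Λ) : ℕ := N.toAddSubgroup.relIndex (radical N).toAddSubgroup

/-- The radical is the preimage of the torsion, so the torsion of the quotient is `radical N / N`.
-/
theorem card_torsion_quotient (N : Submodule ℤ Λ) :
    Nat.card (Submodule.torsion ℤ (Λ ⧸ N)) = radIndex N := by
  have h : (radical N).toAddSubgroup =
      AddSubgroup.comap N.mkQ.toAddMonoidHom (Submodule.torsion ℤ (Λ ⧸ N)).toAddSubgroup := rfl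
  have h0 : N.toAddSubgroup = AddSubgroup.comap N.mkQ.toAddMonoidHom ⊥ := by
    ext x
    simp
  rw [radIndex, h, h0, AddSubgroup.relIndex_comap, AddSubgroup.map_comap_eq_self_of_surjective
    (Submodule.mkQ_surjective N), AddSubgroup.relIndex_bot_left]
  rfl

instance finite_torsion [Module.Finite ℤ Λ] : Finite (Submodule.torsion ℤ Λ) :=
  Module.finite_of_fg_torsion _ (Submodule.torsion_isTorsion)

theorem radIndex_ne_zero [Module.Finite ℤ Λ] (N : Submodule ℤ Λ) : radIndex N ≠ 0 := by
  rw [← card_torsion_quotient]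
  exact Nat.card_pos.ne'

/-- A homomorphism with finite cokernel is invertible up to a positive integer. -/
theorem exists_quasi_inverse {i : Γ →ₗ[ℤ] X} (hi : Function.Injective i)
    [Finite (X ⧸ LinearMap.range i)] : ∃ (n : ℕ) (ρ : X →ₗ[ℤ] Γ), n ≠ 0 ∧
      (∀ x, i (ρ x) = n • x) ∧ ∀ γ, ρ (i γ) = n • γ := by
  -- The order of the cokernel kills it, so `n • x` always has a preimage; injectivity of `i` makes
  -- the preimage unique, hence additive in `x`.
  let n := Nat.card (X ⧸ LinearMap.range i)
  have hn : n ≠ 0 := Nat.card_pos.ne'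
  have h : ∀ x : X, ∃ γ, i γ = n • x := fun x => by
    have : Submodule.Quotient.mk (p := LinearMap.range i) (n • x) = 0 := by
      rw [Submodule.Quotient.mk_smul]
      exact card_nsmul_eq_zero'
    exact (Submodule.Quotient.mk_eq_zero _).1 this
  choose ρ hρ using h
  refine ⟨n, (AddMonoidHom.mk' ρ fun a b => hi ?_).toIntLinearMap, hn, hρ, fun γ => hi ?_⟩
  · rw [map_add, hρ, hρ, hρ, smul_add]
  · rw [map_nsmul]
    exact hρ _

end Radical

namespace AlgTorus

variable {Λ Γ X : Type} [AddCommGroup Λ] [AddCommGroup Γ] [AddCommGroup X]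

/-! ### Connected components of cosets -/

theorem exists_eq_dualHom_mkQ {N : Submodule ℤ Λ} {t : AlgTorus Λ}
    (h : ∀ n ∈ N, torusChar n t = 1) : ∃ v : AlgTorus (Λ ⧸ N), dualHom N.mkQ v = t :=
  ⟨ofHom (N.liftQ (toLin t) fun n hn => congrArg Additive.ofMul (h n hn)).toAddMonoidHom,
    ext fun _ => rfl⟩

/-- A positive power of the character is constant on `A`, so the character takes only finitely many
values there, all of them roots of one number; a preconnected finite set of values has at most one
element. -/
theorem torusChar_eq_of_isPreconnected {A : Set (AlgTorus Λ)} (hA : IsPreconnected A)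
    {N : Submodule ℤ Λ}
    (hN : ∀ t ∈ A, ∀ u ∈ A, ∀ n ∈ N, torusChar n t = torusChar n u) {t u : AlgTorus Λ}
    (ht : t ∈ A) (hu : u ∈ A) {x : Λ} (hx : x ∈ radical N) : torusChar x t = torusChar x u := by
  obtain ⟨n, hn, hx⟩ := mem_radical.1 hx
  replace hx : n.natAbs • x ∈ N := by
    rcases Int.natAbs_eq n with h | h
    · rwa [h, natCast_zsmul] at hx
    · rwa [h, neg_smul, natCast_zsmul, Submodule.neg_mem_iff] at hx
  let f : AlgTorus Λ → ℂ := fun v => torusChar x v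
  have hf : Continuous f := Units.continuous_val.comp (continuous_torusChar x)
  have hfin : (f '' A).Finite := by
    refine ((Polynomial.nthRoots n.natAbs (f t ^ n.natAbs)).toFinset.finite_toSet).subset ?_
    rintro _ ⟨v, hv, rfl⟩
    rw [Finset.mem_coe, Multiset.mem_toFinset, Polynomial.mem_nthRoots (Int.natAbs_pos.2 hn)]
    have := hN v hv t ht _ hx
    rw [torusChar_nsmul, torusChar_nsmul] at this
    simpa only [Units.val_pow_eq_pow_val] using congrArg Units.val this
  have hsub : (f '' A).Subsingleton := by
    by_contra h
    exact (hA.image f hf.continuousOn).infinite_of_nontrivial (Set.not_subsingleton_iff.1 h) hfin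
  exact Units.ext (hsub ⟨t, ht, rfl⟩ ⟨u, hu, rfl⟩)

/-- The quotient by the radical is free, so its points have logarithms; scaling a logarithm from `0`
to `1` joins any point of the coset to `t`. -/
theorem isPreconnected_coset [Module.Finite ℤ Λ] (N : Submodule ℤ Λ) (t : AlgTorus Λ) :
    IsPreconnected {u : AlgTorus Λ | ∀ x ∈ radical N, torusChar x u = torusChar x t} := by
  refine isPreconnected_of_forall t fun u hu => ?_
  obtain ⟨v, hv⟩ := exists_eq_dualHom_mkQ (N := radical N) (t := u / t) fun x hx => by
    rw [map_div, hu x hx, div_self']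
  let p : ℝ → AlgTorus Λ := fun s => t * dualHom (radical N).mkQ (exp ((s : ℂ) • log v))
  have hp : Continuous p := by
    refine continuous_const.mul (continuous_iff_val.2 fun l => ?_)
    simp only [torusChar_dualHom, val_torusChar_exp, LinearMap.smul_apply]
    fun_prop
  refine ⟨Set.range p, ?_, ⟨0, ?_⟩, ⟨1, ?_⟩, isPreconnected_range hp⟩
  · rintro _ ⟨s, rfl⟩ x hx
    have : (radical N).mkQ x = 0 := (Submodule.Quotient.mk_eq_zero _).2 hx
    simp only [p]
    rw [map_mul, torusChar_dualHom, this, torusChar_zero, mul_one]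
  · have : exp (0 : (Λ ⧸ radical N) →ₗ[ℤ] ℂ) = 1 :=
      ext fun l => Units.ext (by rw [val_torusChar_exp]; simp)
    simp [p, this]
  · simp only [p, Complex.ofReal_one, one_smul, exp_log, hv]
    exact mul_div_cancel t u

theorem connectedComponentIn_eq [Module.Finite ℤ Λ] {N : Submodule ℤ Λ} {Z : Set (AlgTorus Λ)}
    {t : AlgTorus Λ} (hZ : ∀ u, u ∈ Z ↔ ∀ n ∈ N, torusChar n u = torusChar n t) :
    connectedComponentIn Z t = {u | ∀ x ∈ radical N, torusChar x u = torusChar x t} := by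
  have ht : t ∈ Z := (hZ t).2 fun _ _ => rfl
  refine subset_antisymm (fun u hu x hx => ?_) ?_
  · refine torusChar_eq_of_isPreconnected isPreconnected_connectedComponentIn
      (fun v hv w hw n hn => ?_) hu (mem_connectedComponentIn ht) hx
    rw [(hZ v).1 (connectedComponentIn_subset Z t hv) n hn,
      (hZ w).1 (connectedComponentIn_subset Z t hw) n hn]
  · exact (isPreconnected_coset N t).subset_connectedComponentIn (fun _ _ => rfl)
      fun u hu => (hZ u).2 fun n hn => hu n (le_radical N hn)

theorem connectedComponents_coe_eq [Module.Finite ℤ Λ] {N : Submodule ℤ Λ} {Z : Set (AlgTorus Λ)}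
    {t : AlgTorus Λ} (hZ : ∀ u, u ∈ Z ↔ ∀ n ∈ N, torusChar n u = torusChar n t) (u v : Z) :
    (u : ConnectedComponents Z) = v ↔
      ∀ x ∈ radical N, torusChar x u.1 = torusChar x v.1 := by
  have hZv : ∀ w, w ∈ Z ↔ ∀ n ∈ N, torusChar n w = torusChar n v.1 := fun w => by
    rw [hZ]
    exact forall₂_congr fun n hn => by rw [(hZ v).1 v.2 n hn]
  rw [ConnectedComponents.coe_eq_coe']
  have h := connectedComponentIn_eq hZv
  rw [connectedComponentIn_eq_image v.2] at h
  rw [← Subtype.val_injective.mem_set_image, h]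
  rfl

theorem card_of_finite (T : Type) [AddCommGroup T] [Finite T] :
    Nat.card (AlgTorus T) = Nat.card T :=
  Nat.card_congr (CommGroup.monoidHom_mulEquiv_of_hasEnoughRootsOfUnity
    (Multiplicative T) ℂ).some.toEquiv

/-- The quotient by the torsion is projective, so the torsion is a direct summand, and a character
extends by composing it with a retraction. -/
theorem exists_restrict_torsion_eq [Module.Finite ℤ Λ] (w : AlgTorus (Submodule.torsion ℤ Λ)) :
    ∃ v : AlgTorus Λ, dualHom (Submodule.torsion ℤ Λ).subtype v = w := by
  let T := Submodule.torsion ℤ Λ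
  obtain ⟨σ, hσ⟩ := Module.projective_lifting_property T.mkQ LinearMap.id T.mkQ_surjective
  have hr : ∀ x, (LinearMap.id - σ ∘ₗ T.mkQ : Λ →ₗ[ℤ] Λ) x ∈ T := fun x => by
    rw [← Submodule.Quotient.mk_eq_zero, ← Submodule.mkQ_apply, LinearMap.sub_apply, map_sub,
      LinearMap.id_apply, LinearMap.comp_apply, sub_eq_zero]
    exact (LinearMap.congr_fun hσ (T.mkQ x)).symm
  refine ⟨dualHom (LinearMap.codRestrict T _ hr) w, ext fun x => ?_⟩
  rw [torusChar_dualHom, torusChar_dualHom]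
  congr 1
  refine congrArg torusChar (Subtype.ext ?_)
  have : T.mkQ x.1 = 0 := (Submodule.Quotient.mk_eq_zero _).2 x.2
  simp only [LinearMap.codRestrict_apply, Submodule.subtype_apply, LinearMap.sub_apply,
    LinearMap.id_apply, LinearMap.comp_apply]
  rw [this, map_zero, sub_zero]

/-- The number of connected components of a coset of the annihilator of `N`. -/
theorem card_connectedComponents [Module.Finite ℤ Λ] {N : Submodule ℤ Λ} {Z : Set (AlgTorus Λ)}
    {t : AlgTorus Λ} (hZ : ∀ u, u ∈ Z ↔ ∀ n ∈ N, torusChar n u = torusChar n t) :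
    Nat.card (ConnectedComponents Z) = radIndex N := by
  have hv : ∀ u : Z, ∃ v : AlgTorus (Λ ⧸ N), dualHom N.mkQ v = u / t := fun u =>
    exists_eq_dualHom_mkQ fun n hn => by rw [map_div, (hZ u).1 u.2 n hn, div_self']
  choose v hv using hv
  have hv' : ∀ (u : Z) (x : Λ), torusChar (Submodule.Quotient.mk x) (v u) =
      torusChar x u.1 / torusChar x t := fun u x => by
    rw [← map_div, ← hv]
    rfl
  let T := Submodule.torsion ℤ (Λ ⧸ N)
  -- After division by `t`, a point of `Z` is a character of `Λ ⧸ N`. Its restriction to the torsion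
  -- `T` separates exactly the components, so these are in bijection with the dual of `T`.
  let F : Z → AlgTorus T := fun u => dualHom T.subtype (v u)
  have hF : ∀ u u' : Z, F u = F u' ↔ (u : ConnectedComponents Z) = u' := by
    intro u u'
    rw [connectedComponents_coe_eq hZ]
    constructor
    · intro h x hx
      have := congrArg (torusChar (⟨Submodule.Quotient.mk x, hx⟩ : T)) h
      simp only [F, torusChar_dualHom] at this
      change torusChar (Submodule.Quotient.mk x) (v u) =
        torusChar (Submodule.Quotient.mk x) (v u') at this
      rwa [hv', hv', div_left_inj] at this
    · intro h
      refine ext fun y => ?_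
      obtain ⟨y, hy⟩ := y
      obtain ⟨x, rfl⟩ := Submodule.Quotient.mk_surjective _ y
      change torusChar (Submodule.Quotient.mk x) (v u) =
        torusChar (Submodule.Quotient.mk x) (v u')
      rw [hv', hv', h x hy]
  rw [← card_torsion_quotient, ← card_of_finite T]
  refine Nat.card_eq_of_bijective
    (Quotient.lift F fun u u' h => (hF u u').2 (Quotient.sound h)) ⟨?_, ?_⟩
  · intro a b
    induction a using Quotient.inductionOn
    induction b using Quotient.inductionOn
    exact fun h => (hF _ _).1 h
  · intro w
    obtain ⟨w', hw'⟩ := exists_restrict_torsion_eq w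
    have hm : t * dualHom N.mkQ w' ∈ Z := (hZ _).2 fun n hn => by
      rw [map_mul, torusChar_dualHom, Submodule.mkQ_apply, (Submodule.Quotient.mk_eq_zero _).2 hn,
        torusChar_zero, mul_one]
    refine ⟨Quotient.mk _ ⟨_, hm⟩, ?_⟩
    rw [← hw']
    refine ext fun y => ?_
    obtain ⟨y, hy⟩ := y
    obtain ⟨x, rfl⟩ := Submodule.Quotient.mk_surjective _ y
    change torusChar (Submodule.Quotient.mk x) (v _) = torusChar (Submodule.Quotient.mk x) w'
    rw [hv', map_mul]
    simp

/-! ### Coverings -/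

/-- A section of `Hom(X, ℂ*) → Hom(Γ, ℂ*)` that is continuous at the identity. -/
theorem exists_section [Module.Free ℤ Γ] [Module.Finite ℤ Γ] {i : Γ →ₗ[ℤ] X}
    (hi : Function.Injective i) [Finite (X ⧸ LinearMap.range i)] :
    ∃ s : AlgTorus Γ → AlgTorus X, s 1 = 1 ∧ ContinuousAt s 1 ∧ ∀ t, dualHom i (s t) = t := by
  obtain ⟨n, ρ, hn, -, hρ⟩ := exists_quasi_inverse hi
  -- Since `ρ ∘ i = n`, the functional `n⁻¹ (log t ∘ ρ)` extends `log t` from `Γ` to `X`.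
  refine ⟨fun t => exp ((n : ℂ)⁻¹ • (log t ∘ₗ ρ)), ?_, ?_, fun t => ?_⟩
  · exact ext fun l => Units.ext (by simp [log_one])
  · refine continuousAt_iff_val.2 fun l => ?_
    simp only [val_torusChar_exp, LinearMap.smul_apply, LinearMap.comp_apply]
    exact ((continuousAt_log (ρ l)).const_smul ((n : ℂ)⁻¹)).cexp
  · conv_rhs => rw [← exp_log t]
    refine ext fun l => Units.ext ?_
    rw [torusChar_dualHom, val_torusChar_exp, val_torusChar_exp, LinearMap.smul_apply,
      LinearMap.comp_apply, hρ, map_nsmul, ← Nat.cast_smul_eq_nsmul ℂ, smul_smul,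
      inv_mul_cancel₀ (Nat.cast_ne_zero.2 hn), one_smul]

theorem dualHom_surjective [Module.Free ℤ Γ] [Module.Finite ℤ Γ] {i : Γ →ₗ[ℤ] X}
    (hi : Function.Injective i) [Finite (X ⧸ LinearMap.range i)] :
    Function.Surjective (dualHom i) := fun t =>
  let ⟨s, _, _, h⟩ := exists_section hi
  ⟨s t, h t⟩

theorem mem_ker_dualHom {i : Γ →ₗ[ℤ] X} {t : AlgTorus X} :
    t ∈ (dualHom i).ker ↔ ∀ x ∈ LinearMap.range i, torusChar x t = 1 := by
  rw [MonoidHom.mem_ker]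
  constructor
  · rintro h _ ⟨γ, rfl⟩
    rw [← torusChar_dualHom, h, map_one]
  · exact fun h => ext fun γ => by rw [torusChar_dualHom, h _ ⟨γ, rfl⟩, map_one]

/-- The kernel of the dual homomorphism is dual to the cokernel. -/
def kerDualHom (i : Γ →ₗ[ℤ] X) : (dualHom i).ker ≃* AlgTorus (X ⧸ LinearMap.range i) :=
  MulEquiv.symm <| MulEquiv.ofBijective
    ((dualHom (LinearMap.range i).mkQ).codRestrict (dualHom i).ker fun t =>
      mem_ker_dualHom.2 fun x hx => by
        rw [torusChar_dualHom, Submodule.mkQ_apply, (Submodule.Quotient.mk_eq_zero _).2 hx,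
          torusChar_zero])
    ⟨fun t u h => ext fun z => by
        obtain ⟨x, rfl⟩ := Submodule.Quotient.mk_surjective _ z
        exact congrArg (fun w : (dualHom i).ker => torusChar x w.1) h,
      fun t => (exists_eq_dualHom_mkQ (mem_ker_dualHom.1 t.2)).imp fun _ h => Subtype.ext h⟩

theorem isCoveringMap_dualHom [Module.Free ℤ Γ] [Module.Finite ℤ Γ] {i : Γ →ₗ[ℤ] X}
    (hi : Function.Injective i) [Finite (X ⧸ LinearMap.range i)] : IsCoveringMap (dualHom i) := by
  have hc : Continuous (dualHom i) := continuous_of_isAlgHom (dualHom_isAlgHom i)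
  obtain ⟨s, hs1, hs, hsec⟩ := exists_section hi
  have ho : IsOpenMap (dualHom i) := by
    refine isOpenMap_iff_nhds_le.2 fun x => ?_
    -- The section near `1` is translated to one through `x`. It is continuous at the image of `x`,
    -- which makes the homomorphism open at `x`.
    let σ : AlgTorus Γ → AlgTorus X := fun y => x * s (y / dualHom i x)
    have hσ : ContinuousAt σ (dualHom i x) := by
      refine continuousAt_const.mul (ContinuousAt.comp (g := s) ?_ ?_)
      · rwa [div_self']
      · exact (continuous_id.div' continuous_const).continuousAt
    have hσx : σ (dualHom i x) = x := by simp only [σ, div_self', hs1, mul_one]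
    have hσs : dualHom i ∘ σ = id := funext fun y => by
      simp only [σ, Function.comp_apply, map_mul, hsec, mul_div_cancel, id]
    calc nhds (dualHom i x) = Filter.map (dualHom i) (Filter.map σ (nhds (dualHom i x))) := by
          rw [Filter.map_map, hσs, Filter.map_id]
      _ ≤ _ := by
        rw [ContinuousAt, hσx] at hσ
        exact Filter.map_mono hσ
  have hq := ho.isQuotientMap hc (dualHom_surjective hi)
  have hfin : Finite (dualHom i).ker := by
    refine Nat.finite_of_card_ne_zero ?_
    rw [Nat.card_congr (kerDualHom i).toEquiv, card_of_finite]
    exact Nat.card_pos.ne'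
  -- The kernel is finite, being dual to the cokernel, hence discrete; a quotient by a discrete
  -- subgroup is a covering.
  refine (hq.isQuotientCoveringMap_of_isDiscrete_ker_monoidHom ⟨?_⟩).isCoveringMap
  have : Finite ((dualHom i).ker : Set (AlgTorus X)) := hfin
  infer_instance

/-- If `i γ = 0`, then `γ` is trivial on the image of the dual homomorphism. A covering map is open,
so the image contains a neighbourhood of `1`, on which a nonzero `γ` cannot be trivial. -/
theorem injective_of_isCoveringMap [Module.Free ℤ Γ] [Module.Finite ℤ Γ] {i : Γ →ₗ[ℤ] X}
    (h : IsCoveringMap (dualHom i)) : Function.Injective i := by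
  refine (injective_iff_map_eq_zero i).2 fun γ hγ => ?_
  by_contra hne
  obtain ⟨b, hb⟩ : ∃ b, (Module.Free.chooseBasis ℤ Γ).coord b γ ≠ 0 := by
    by_contra! hb
    exact hne ((Module.Free.chooseBasis ℤ Γ).forall_coord_eq_zero_iff.1 hb)
  set c := (Module.Free.chooseBasis ℤ Γ).coord b γ with hc
  -- On the one-parameter subgroup `p`, the character `γ` has the value `exp (s * c)` with `c ≠ 0`
  -- and `s` real, so it equals `1` only at `s = 0`.
  let ℓ : Γ →ₗ[ℤ] ℂ :=
    (Int.castAddHom ℂ).toIntLinearMap ∘ₗ (Module.Free.chooseBasis ℤ Γ).coord b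
  let p : ℝ → AlgTorus Γ := fun s => exp ((s : ℂ) • ℓ)
  have hp : Continuous p := continuous_iff_val.2 fun l => by
    simp only [p, val_torusChar_exp, LinearMap.smul_apply]
    fun_prop
  have hp0 : p 0 = 1 := ext fun l => Units.ext (by simp [p])
  have hmem : Set.range (dualHom i) ∈ nhds (p 0) := by
    rw [hp0]
    exact h.isOpenMap.isOpen_range.mem_nhds ⟨1, map_one _⟩
  have hev : ∀ᶠ s : ℝ in nhds 0, s = 0 := by
    filter_upwards [hp.continuousAt hmem] with s hs
    obtain ⟨t, ht⟩ := hs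
    have h1 : torusChar γ (p s) = 1 := by rw [← ht, torusChar_dualHom, hγ, torusChar_zero]
    have h2 : Complex.exp ((s * c : ℝ) : ℂ) = 1 := by
      have := congrArg Units.val h1
      simp only [p, val_torusChar_exp] at this
      simpa [ℓ, hc] using this
    rw [← Complex.ofReal_exp, Complex.ofReal_eq_one, Real.exp_eq_one_iff] at h2
    exact (mul_eq_zero.1 h2).resolve_right (Int.cast_ne_zero.2 hb)
  obtain ⟨s, hs, hs0⟩ := ((hev.filter_mono nhdsWithin_le_nhds).and
    (self_mem_nhdsWithin : {(0 : ℝ)}ᶜ ∈ nhdsWithin 0 {(0 : ℝ)}ᶜ)).exists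
  exact hs0 hs

/-- The annihilator of the radical of the image of `i` is connected and lies in one fibre, so unique
lifting shrinks it to a point. Hence every character lies in that radical, and the cokernel is
finitely generated and torsion. -/
theorem finite_of_isCoveringMap [Module.Finite ℤ X] {i : Γ →ₗ[ℤ] X}
    (h : IsCoveringMap (dualHom i)) : Finite (X ⧸ LinearMap.range i) := by
  have hA : ∀ u : AlgTorus X, (∀ x ∈ radical (LinearMap.range i), torusChar x u = 1) → u = 1 := by
    intro u hu
    have hpre := isPreconnected_coset (LinearMap.range i) 1
    refine h.constOn_of_comp hpre continuousOn_id ?_ (a := u) (a' := 1) (fun x hx => ?_)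
      fun _ _ => rfl
    · intro v hv w hw
      refine ext fun γ => ?_
      have hγ := le_radical (LinearMap.range i) ⟨γ, rfl⟩
      rw [torusChar_dualHom, torusChar_dualHom]
      exact (hv _ hγ).trans (hw _ hγ).symm
    · rw [hu x hx, map_one]
  refine Module.finite_of_fg_torsion _ ?_
  intro z
  obtain ⟨x, rfl⟩ := Submodule.Quotient.mk_surjective _ z
  have hx : x ∈ radical (LinearMap.range i) :=
    mem_of_forall_torusChar_eq_one fun t ht => by rw [hA t ht, map_one]
  exact (Submodule.mem_torsion_iff _).1 hx

end AlgTorus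
end

noncomputable section

/-! ### Extensions and their classes -/

section Extensions

variable {G G' H K Γ Γ' Γ'' X X' : Type} [AddCommGroup G] [AddCommGroup G'] [AddCommGroup H]
  [AddCommGroup K] [AddCommGroup Γ] [AddCommGroup Γ'] [AddCommGroup Γ''] [AddCommGroup X]
  [AddCommGroup X']

theorem extPull_comp (f : H →ₗ[ℤ] G) (g : K →ₗ[ℤ] H) (x : ExtOne G Γ) :
    extPull g (extPull f x) = extPull (f ∘ₗ g) x := by
  rw [extPull, extPull, Ext.mk₀_comp_mk₀_assoc]
  rfl

theorem extPull_extPush (f : H →ₗ[ℤ] G) (g : Γ →ₗ[ℤ] Γ') (x : ExtOne G Γ) :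
    extPull f (extPush g x) = extPush g (extPull f x) :=
  (Ext.comp_assoc_of_third_deg_zero ..).symm

@[simp] theorem extPull_id (x : ExtOne G Γ) : extPull LinearMap.id x = x :=
  Ext.mk₀_id_comp x

@[simp] theorem extPush_id (x : ExtOne G Γ) : extPush LinearMap.id x = x :=
  Ext.comp_mk₀_id x

theorem extPush_sub (f g : Γ →ₗ[ℤ] Γ') (x : ExtOne G Γ) :
    extPush (f - g) x = extPush f x - extPush g x := by
  rw [eq_sub_iff_add_eq, extPush, extPush, ← Ext.comp_add, ← Ext.mk₀_add, ← ModuleCat.ofHom_add,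
    sub_add_cancel]
  rfl

@[simp] theorem extPush_zero (f : Γ →ₗ[ℤ] Γ') : extPush f (0 : ExtOne G Γ) = 0 :=
  Ext.zero_comp ..

@[simp] theorem extPull_zero (f : H →ₗ[ℤ] G) : extPull f (0 : ExtOne G Γ) = 0 :=
  Ext.comp_zero ..

variable {i : Γ →ₗ[ℤ] X} {q : X →ₗ[ℤ] G} {i' : Γ' →ₗ[ℤ] X'} {q' : X' →ₗ[ℤ] G'}

/-- A morphism of extensions relates their classes. -/
theorem extensionClass_naturality (hi : Function.Injective i) (hiq : Function.Exact i q)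
    (hq : Function.Surjective q) (hi' : Function.Injective i') (hiq' : Function.Exact i' q')
    (hq' : Function.Surjective q') {a : Γ →ₗ[ℤ] Γ'} {h : X →ₗ[ℤ] X'} {c : G →ₗ[ℤ] G'}
    (h₁ : h ∘ₗ i = i' ∘ₗ a) (h₂ : q' ∘ₗ h = c ∘ₗ q) :
    extPush a (extensionClass i q hi hiq hq) = extPull c (extensionClass i' q' hi' hiq' hq') :=
  ShortComplex.ShortExact.extClass_naturality _ _
    (ShortComplex.Hom.mk
      (S₁ := ShortComplex.mk (ModuleCat.ofHom i) (ModuleCat.ofHom q)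
        (ModuleCat.hom_ext hiq.linearMap_comp_eq_zero))
      (S₂ := ShortComplex.mk (ModuleCat.ofHom i') (ModuleCat.ofHom q')
        (ModuleCat.hom_ext hiq'.linearMap_comp_eq_zero))
      (ModuleCat.ofHom a) (ModuleCat.ofHom h) (ModuleCat.ofHom c)
      (ModuleCat.hom_ext h₁.symm) (ModuleCat.hom_ext h₂))

/-- The pullback of an extension along `f` splits if and only if `f` lifts. -/
theorem extPull_extensionClass_eq_zero_iff (hi : Function.Injective i) (hiq : Function.Exact i q)
    (hq : Function.Surjective q) (f : H →ₗ[ℤ] G) :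
    extPull f (extensionClass i q hi hiq hq) = 0 ↔ ∃ s : H →ₗ[ℤ] X, q ∘ₗ s = f := by
  constructor
  · intro h
    -- In the covariant long exact sequence, the connecting map sends `f` to the pullback of the
    -- class along `f`; its kernel consists of the maps that lift to the middle term.
    have key : ∀ (S : ShortComplex (ModuleCat ℤ)) (hS : S.ShortExact) (Y : ModuleCat ℤ)
        (f : Y ⟶ S.X₃), (Ext.mk₀ f).comp hS.extClass (zero_add 1) = 0 → ∃ s, s ≫ S.g = f := by
      intro S hS Y f h
      obtain ⟨s, hs⟩ := Ext.covariant_sequence_exact₃ Y hS (Ext.mk₀ f) (zero_add 1) h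
      obtain ⟨s, rfl⟩ := (Ext.mk₀_bijective _ _).2 s
      rw [Ext.mk₀_comp_mk₀] at hs
      exact ⟨s, (Ext.mk₀_bijective _ _).1 hs⟩
    let S := ShortComplex.mk (ModuleCat.ofHom i) (ModuleCat.ofHom q)
      (ModuleCat.hom_ext hiq.linearMap_comp_eq_zero)
    have hS : S.ShortExact := ModuleCat.shortComplex_shortExact S hiq hi hq
    have h' : (Ext.mk₀ (ModuleCat.ofHom f)).comp hS.extClass (zero_add 1) = 0 := h
    obtain ⟨s, hs⟩ := key S hS (ModuleCat.of ℤ H) (ModuleCat.ofHom f) h'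
    exact ⟨s.hom, congrArg ModuleCat.Hom.hom hs⟩
  · rintro ⟨s, rfl⟩
    rw [← extPull_comp]
    have : extPull q (extensionClass i q hi hiq hq) = 0 := by
      have hS := ModuleCat.shortComplex_shortExact (ShortComplex.mk (ModuleCat.ofHom i)
        (ModuleCat.ofHom q) (ModuleCat.hom_ext hiq.linearMap_comp_eq_zero)) hiq hi hq
      exact hS.comp_extClass
    rw [this, extPull_zero]

/-- The contravariant long exact sequence: a map out of `Γ` that kills the class extends to the
middle term. -/
theorem exists_of_extPush_extensionClass_eq_zero (hi : Function.Injective i)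
    (hiq : Function.Exact i q) (hq : Function.Surjective q) {f : Γ →ₗ[ℤ] Γ'}
    (h : extPush f (extensionClass i q hi hiq hq) = 0) : ∃ s : X →ₗ[ℤ] Γ', s ∘ₗ i = f := by
  have key : ∀ (S : ShortComplex (ModuleCat ℤ)) (hS : S.ShortExact) (Y : ModuleCat ℤ)
      (f : S.X₁ ⟶ Y), hS.extClass.comp (Ext.mk₀ f) (add_zero 1) = 0 → ∃ s, S.f ≫ s = f := by
    intro S hS Y f h
    obtain ⟨s, hs⟩ := Ext.contravariant_sequence_exact₁ hS Y (Ext.mk₀ f) (add_zero 1) h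
    obtain ⟨s, rfl⟩ := (Ext.mk₀_bijective _ _).2 s
    rw [Ext.mk₀_comp_mk₀] at hs
    exact ⟨s, (Ext.mk₀_bijective _ _).1 hs⟩
  obtain ⟨s, hs⟩ := key _ _ _ _ h
  exact ⟨s.hom, congrArg ModuleCat.Hom.hom hs⟩

/-- Maps of the ends that match the classes extend to a morphism of extensions. -/
theorem exists_hom_of_extPush_eq_extPull (hi : Function.Injective i) (hiq : Function.Exact i q)
    (hq : Function.Surjective q) (hi' : Function.Injective i') (hiq' : Function.Exact i' q')
    (hq' : Function.Surjective q') {a : Γ →ₗ[ℤ] Γ'} {c : G →ₗ[ℤ] G'}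
    (hac : extPush a (extensionClass i q hi hiq hq) =
      extPull c (extensionClass i' q' hi' hiq' hq')) :
    ∃ h : X →ₗ[ℤ] X', h ∘ₗ i = i' ∘ₗ a ∧ q' ∘ₗ h = c ∘ₗ q := by
  have hqx : extPull q (extensionClass i q hi hiq hq) = 0 :=
    (extPull_extensionClass_eq_zero_iff hi hiq hq q).2 ⟨LinearMap.id, rfl⟩
  -- Pulled back along `q`, the first class vanishes, hence so does the second one along `c ∘ q`;
  -- this gives a lift of `c ∘ q`, not yet compatible with `a`.
  obtain ⟨h, hh⟩ := (extPull_extensionClass_eq_zero_iff hi' hiq' hq' (c ∘ₗ q)).1 (by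
    rw [← extPull_comp, ← hac, extPull_extPush, hqx, extPush_zero])
  have hr : ∀ γ, ∃ γ', i' γ' = h (i γ) := fun γ => (hiq' _).1 <| by
    have := LinearMap.congr_fun hh (i γ)
    rw [LinearMap.comp_apply, LinearMap.comp_apply, hiq.apply_apply_eq_zero, map_zero] at this
    exact this
  choose b hb using hr
  let b' : Γ →ₗ[ℤ] Γ' := (AddMonoidHom.mk' b fun x y => hi' (by
    rw [map_add, hb, hb, hb, map_add, map_add])).toIntLinearMap
  have hb' : h ∘ₗ i = i' ∘ₗ b' := LinearMap.ext fun γ => (hb γ).symm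
  -- The lift induces `b'` on `Γ`. Both `b'` and `a` push the class to the same element, so their
  -- difference extends over `X` and can be subtracted from the lift.
  obtain ⟨s, hs⟩ := exists_of_extPush_extensionClass_eq_zero hi hiq hq (f := b' - a) (by
    rw [extPush_sub, hac, extensionClass_naturality hi hiq hq hi' hiq' hq' hb' hh, sub_self])
  refine ⟨h - i' ∘ₗ s, ?_, ?_⟩
  · rw [LinearMap.sub_comp, LinearMap.comp_assoc, hs, hb', LinearMap.comp_sub, sub_sub_cancel]
  · rw [LinearMap.comp_sub, ← LinearMap.comp_assoc, hiq'.linearMap_comp_eq_zero,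
      LinearMap.zero_comp, sub_zero, hh]

/-- Isomorphisms of the ends that match the classes extend to an isomorphism of extensions. -/
theorem exists_equiv_of_extPush_eq_extPull (hi : Function.Injective i) (hiq : Function.Exact i q)
    (hq : Function.Surjective q) (hi' : Function.Injective i') (hiq' : Function.Exact i' q')
    (hq' : Function.Surjective q') {a : Γ ≃ₗ[ℤ] Γ'} {c : G ≃ₗ[ℤ] G'}
    (hac : extPush a.toLinearMap (extensionClass i q hi hiq hq) =
      extPull c.toLinearMap (extensionClass i' q' hi' hiq' hq')) :
    ∃ h : X ≃ₗ[ℤ] X', (∀ γ, h (i γ) = i' (a γ)) ∧ ∀ x, q' (h x) = c (q x) := by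
  obtain ⟨h, h₁, h₂⟩ := exists_hom_of_extPush_eq_extPull hi hiq hq hi' hiq' hq' hac
  have h₁' : ∀ γ, h (i γ) = i' (a γ) := LinearMap.congr_fun h₁
  have h₂' : ∀ x, q' (h x) = c (q x) := LinearMap.congr_fun h₂
  -- Bijectivity is the five lemma, by diagram chase.
  refine ⟨LinearEquiv.ofBijective h ⟨?_, fun y => ?_⟩, h₁', h₂'⟩
  · refine (injective_iff_map_eq_zero h).2 fun x hx => ?_
    have hqx : q x = 0 := c.injective (by rw [← h₂', hx, map_zero, map_zero])
    obtain ⟨γ, rfl⟩ := (hiq x).1 hqx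
    rw [h₁'] at hx
    rw [a.injective (hi' (by rw [hx, map_zero, map_zero]) : a γ = a 0), map_zero]
  · obtain ⟨x, hx⟩ := hq (c.symm (q' y))
    obtain ⟨γ', hγ'⟩ := (hiq' (y - h x)).1 (by rw [map_sub, h₂', hx, c.apply_symm_apply, sub_self])
    refine ⟨x + i (a.symm γ'), ?_⟩
    rw [map_add, h₁', a.apply_symm_apply, hγ', add_sub_cancel]

/-- Every element of `Ext¹` is the class of an extension. -/
theorem exists_extensionClass_eq (x : ExtOne G Γ) :
    ∃ (X : Type) (_ : AddCommGroup X) (i : Γ →ₗ[ℤ] X) (q : X →ₗ[ℤ] G) (hi : Function.Injective i)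
      (hiq : Function.Exact i q) (hq : Function.Surjective q), extensionClass i q hi hiq hq = x := by
  let p : (G →₀ ℤ) →ₗ[ℤ] G := Finsupp.linearCombination ℤ id
  have hp : Function.Surjective p := Finsupp.linearCombination_id_surjective ℤ G
  let K := LinearMap.ker p
  have hK : Function.Exact K.subtype p := LinearMap.exact_subtype_ker_map p
  have hP : Projective (ModuleCat.of ℤ (G →₀ ℤ)) :=
    ModuleCat.projective_of_free (Finsupp.basisSingleOne (R := ℤ) (ι := G))
  -- `Ext¹` out of the free module vanishes, so every class is a pushforward of the class of the
  -- presentation `0 → K → (G →₀ ℤ) → G → 0`.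
  obtain ⟨k, hk⟩ : ∃ k : K →ₗ[ℤ] Γ,
      extPush k (extensionClass K.subtype p K.injective_subtype hK hp) = x := by
    obtain ⟨k, hk⟩ := Ext.contravariant_sequence_exact₃
      (ModuleCat.shortComplex_shortExact (ShortComplex.mk (ModuleCat.ofHom K.subtype)
        (ModuleCat.ofHom p) (ModuleCat.hom_ext hK.linearMap_comp_eq_zero)) hK
        K.injective_subtype hp) _ x (Ext.eq_zero_of_projective _) (add_zero 1)
    obtain ⟨k, rfl⟩ := (Ext.mk₀_bijective _ _).2 k
    exact ⟨k.hom, hk⟩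
  -- The quotient by these relations `(k z, -z)` is the pushout of `Γ` and the free module over `K`.
  let N : Submodule ℤ (Γ × (G →₀ ℤ)) := LinearMap.range (k.prod (-K.subtype))
  let i : Γ →ₗ[ℤ] (Γ × (G →₀ ℤ)) ⧸ N := N.mkQ ∘ₗ LinearMap.inl ℤ _ _
  let q : (Γ × (G →₀ ℤ)) ⧸ N →ₗ[ℤ] G := N.liftQ (p ∘ₗ LinearMap.snd ℤ _ _) (by
    rintro _ ⟨z, rfl⟩
    simp [K])
  have hi : Function.Injective i := by
    refine (injective_iff_map_eq_zero i).2 fun γ hγ => ?_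
    obtain ⟨z, hz⟩ := (Submodule.Quotient.mk_eq_zero N).1 hγ
    have h2 : z = 0 := by simpa using congrArg Prod.snd hz
    have h1 := congrArg Prod.fst hz
    rw [h2, map_zero] at h1
    exact h1.symm
  have hiq : Function.Exact i q := by
    intro y
    obtain ⟨⟨γ, w⟩, rfl⟩ := Submodule.Quotient.mk_surjective _ y
    constructor
    · intro h
      have hw : w ∈ K := h
      refine ⟨γ + k ⟨w, hw⟩, (Submodule.Quotient.eq N).2 ⟨⟨w, hw⟩, ?_⟩⟩
      simp
    · rintro ⟨γ', h⟩
      rw [← h]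
      simp [i, q]
  have hq : Function.Surjective q := fun g => by
    obtain ⟨w, rfl⟩ := hp g
    exact ⟨Submodule.Quotient.mk (0, w), rfl⟩
  refine ⟨_, _, i, q, hi, hiq, hq, ?_⟩
  rw [← hk, extensionClass_naturality K.injective_subtype hK hp hi hiq hq
    (a := k) (h := N.mkQ ∘ₗ LinearMap.inr ℤ _ _) (c := LinearMap.id) ?_ ?_, extPull_id]
  · refine LinearMap.ext fun z => ((Submodule.Quotient.eq N).2 ⟨-z, ?_⟩)
    simp
  · exact LinearMap.ext fun w => rfl

end Extensions
end

noncomputable section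

/-! ### Multiplicities and coherence -/

section Split

variable {G Γ X : Type} [AddCommGroup G] [AddCommGroup Γ] [AddCommGroup X]
  {i : Γ →ₗ[ℤ] X} {q : X →ₗ[ℤ] G}

theorem radical_map_radical (N : Submodule ℤ Γ) (i : Γ →ₗ[ℤ] X) :
    radical ((radical N).map i) = radical (N.map i) := by
  refine le_antisymm ?_ (radical_mono (Submodule.map_mono (le_radical N)))
  rw [← radical_radical (N.map i)]
  refine radical_mono ?_
  rintro _ ⟨γ, hγ, rfl⟩
  obtain ⟨n, hn, h⟩ := mem_radical.1 hγ
  exact mem_radical.2 ⟨n, hn, n • γ, h, map_smul _ _ _⟩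

/-- Multiplicativity of the index in the chain `N.map i ≤ (radical N).map i ≤ radical (N.map i)`,
whose first step has the same index as `N ≤ radical N`. -/
theorem radIndex_map_radical_mul_radIndex (N : Submodule ℤ Γ) (hi : Function.Injective i) :
    radIndex ((radical N).map i) * radIndex N = radIndex (N.map i) := by
  have h : radIndex N =
      (N.map i).toAddSubgroup.relIndex ((radical N).map i).toAddSubgroup :=
    (AddSubgroup.relIndex_map_map_of_injective N.toAddSubgroup (radical N).toAddSubgroup
      (f := i.toAddMonoidHom) hi).symm
  rw [mul_comm, h, radIndex, radIndex, radical_map_radical]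
  refine AddSubgroup.relIndex_mul_relIndex _ _ _ (Submodule.map_mono (le_radical N)) ?_
  rw [← radical_map_radical]
  exact le_radical ((radical N).map i)

/-- In an extension of a finite group by a torsion-free group, the largest subgroup over which the
extension splits is the image of the torsion. -/
theorem maxSplit_extensionClass [Finite G] [Module.IsTorsionFree ℤ Γ]
    (hi : Function.Injective i) (hiq : Function.Exact i q) (hq : Function.Surjective q) :
    maxSplit (extensionClass i q hi hiq hq) = (Submodule.torsion ℤ X).map q := by
  have hinj : ∀ x ∈ Submodule.torsion ℤ X, q x = 0 → x = 0 := by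
    intro x hx h
    obtain ⟨γ, rfl⟩ := (hiq x).1 h
    obtain ⟨n, hn⟩ := (Submodule.mem_torsion_iff _).1 hx
    have h0 : i ((n : ℤ) • γ) = i 0 := by
      rw [map_zero, map_smul]
      exact hn
    rw [(smul_eq_zero.1 (hi h0)).resolve_left (nonZeroDivisors.coe_ne_zero n), map_zero]
  -- A section over `H` has torsion values because `G` is finite. Conversely `q` is injective on
  -- torsion because `Γ` is torsion-free, and its inverse is a section over the image of the
  -- torsion.
  refine le_antisymm (sSup_le fun H hH => ?_) (le_sSup ?_)
  · obtain ⟨s, hs⟩ := (extPull_extensionClass_eq_zero_iff hi hiq hq _).1 hH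
    intro g hg
    refine ⟨s ⟨g, hg⟩, (Submodule.mem_torsion_iff _).2 ?_, LinearMap.congr_fun hs ⟨g, hg⟩⟩
    refine ⟨⟨Nat.card G, mem_nonZeroDivisors_of_ne_zero
      (Nat.cast_ne_zero.2 Nat.card_pos.ne')⟩, ?_⟩
    have h0 : ((Nat.card G : ℕ) : ℤ) • (⟨g, hg⟩ : H) = 0 := by
      refine Subtype.ext ?_
      rw [natCast_zsmul]
      exact card_nsmul_eq_zero'
    change ((Nat.card G : ℕ) : ℤ) • s ⟨g, hg⟩ = 0
    rw [← map_smul, h0, map_zero]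
  · refine (extPull_extensionClass_eq_zero_iff hi hiq hq _).2 ?_
    have hlift : ∀ h : (Submodule.torsion ℤ X).map q, ∃ x ∈ Submodule.torsion ℤ X, q x = h.1 :=
      fun h => h.2
    choose s hs hqs using hlift
    refine ⟨(AddMonoidHom.mk' s fun a b => sub_eq_zero.1 (hinj _ ?_ ?_)).toIntLinearMap,
      LinearMap.ext hqs⟩
    · exact Submodule.sub_mem _ (hs _) (Submodule.add_mem _ (hs _) (hs _))
    · rw [map_sub, map_add, hqs, hqs, hqs]
      exact sub_self _

theorem card_maxSplit_extensionClass [Finite G] [Module.IsTorsionFree ℤ Γ]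
    (hi : Function.Injective i) (hiq : Function.Exact i q) (hq : Function.Surjective q) :
    Nat.card (maxSplit (extensionClass i q hi hiq hq)) = Nat.card (Submodule.torsion ℤ X) := by
  rw [maxSplit_extensionClass hi hiq hq]
  refine (Nat.card_image_of_injOn (f := q) (s := Submodule.torsion ℤ X) fun x hx y hy h => ?_)
  have hz : q (x - y) = 0 := by rw [map_sub, h, sub_self]
  obtain ⟨γ, hγ⟩ := (hiq _).1 hz
  obtain ⟨n, hn⟩ := (Submodule.mem_torsion_iff _).1 (Submodule.sub_mem _ hx hy)
  have h0 : i ((n : ℤ) • γ) = i 0 := by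
    rw [map_zero, map_smul, hγ]
    exact hn
  rw [(smul_eq_zero.1 (hi h0)).resolve_left (nonZeroDivisors.coe_ne_zero n), map_zero] at hγ
  exact sub_eq_zero.1 hγ.symm

/-- The pushed-forward class is that of the extension `X ⧸ (radical N).map i`. Its kernel is
torsion-free, so the maximal split subgroup is counted by the torsion of this quotient. -/
theorem card_maxSplit_mul_radIndex [Finite G] (hi : Function.Injective i)
    (hiq : Function.Exact i q) (hq : Function.Surjective q) (N : Submodule ℤ Γ) :
    Nat.card (maxSplit (extPush (radical N).mkQ (extensionClass i q hi hiq hq))) * radIndex N =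
      radIndex (N.map i) := by
  let R := radical N
  let j : Γ ⧸ R →ₗ[ℤ] X ⧸ R.map i := R.mapQ (R.map i) i (Submodule.le_comap_map _ _)
  let p : X ⧸ R.map i →ₗ[ℤ] G := (R.map i).liftQ q (by
    rintro _ ⟨γ, -, rfl⟩
    exact hiq.apply_apply_eq_zero γ)
  have hj : Function.Injective j := by
    refine (injective_iff_map_eq_zero j).2 fun z hz => ?_
    obtain ⟨γ, rfl⟩ := Submodule.Quotient.mk_surjective _ z
    obtain ⟨γ', h', h⟩ := (Submodule.Quotient.mk_eq_zero _).1 hz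
    exact (Submodule.Quotient.mk_eq_zero _).2 (hi h ▸ h')
  have hjp : Function.Exact j p := by
    intro z
    obtain ⟨x, rfl⟩ := Submodule.Quotient.mk_surjective _ z
    constructor
    · intro h
      obtain ⟨γ, rfl⟩ := (hiq x).1 h
      exact ⟨Submodule.Quotient.mk γ, rfl⟩
    · rintro ⟨w, h⟩
      obtain ⟨γ, rfl⟩ := Submodule.Quotient.mk_surjective _ w
      rw [← h]
      exact hiq.apply_apply_eq_zero γ
  have hp : Function.Surjective p := fun g => by
    obtain ⟨x, rfl⟩ := hq g
    exact ⟨Submodule.Quotient.mk x, rfl⟩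
  have hcl : extPush (radical N).mkQ (extensionClass i q hi hiq hq) =
      extensionClass j p hj hjp hp := by
    rw [extensionClass_naturality hi hiq hq hj hjp hp (a := (radical N).mkQ)
      (h := (R.map i).mkQ) (c := LinearMap.id) rfl rfl, extPull_id]
  rw [hcl, card_maxSplit_extensionClass, card_torsion_quotient,
    radIndex_map_radical_mul_radIndex N hi]

end Split

/-! ### Multiplicities of arrangements and of their lifts -/

namespace ToricArrangement

variable {Γ X E : Type} [AddCommGroup Γ] [AddCommGroup X]

/-- The arrangement with the characters `i (χ_e)`. -/
def map (Δ : ToricArrangement Γ E) (i : Γ →ₗ[ℤ] X) : ToricArrangement X E where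
  a := Δ.a
  χ e := i (Δ.χ e)

theorem subSpan_map (Δ : ToricArrangement Γ E) (i : Γ →ₗ[ℤ] X) (S : Set E) :
    (Δ.map i).subSpan S = (Δ.subSpan S).map i := by
  rw [subSpan, subSpan, Submodule.map_span, Set.image_image]
  rfl

theorem liftMult_eq (Δ : ToricArrangement Γ E) {c : TorusCovering Γ} {i : Γ →ₗ[ℤ] c.Λ}
    (h : c.proj = dualHom i) : Δ.liftMult c = (Δ.map i).mult := by
  funext S
  unfold liftMult
  rw [h]
  rfl

theorem mem_hypertorus {Δ : ToricArrangement Γ E} {e : E} {t : AlgTorus Γ} :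
    t ∈ Δ.hypertorus e ↔ torusChar (Δ.χ e) t = (Δ.a e)⁻¹ := by
  rw [eq_inv_iff_mul_eq_one, mul_comm, ← Units.val_inj]
  exact sub_eq_zero.trans eq_comm

/-- Through any of its points, the intersection is a coset of the annihilator of `Γ_S`, whatever the
constants `a_e` are. -/
theorem mem_inter_iff {Δ : ToricArrangement Γ E} {S : Set E} {t : AlgTorus Γ}
    (ht : t ∈ Δ.inter S) (u : AlgTorus Γ) :
    u ∈ Δ.inter S ↔ ∀ n ∈ Δ.subSpan S, torusChar n u = torusChar n t := by
  constructor
  · intro hu n hn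
    refine Submodule.span_induction (p := fun n _ => torusChar n u = torusChar n t) ?_ ?_ ?_ ?_ hn
    · rintro _ ⟨e, he, rfl⟩
      rw [mem_hypertorus.1 (hu e he), mem_hypertorus.1 (ht e he)]
    · rw [AlgTorus.torusChar_zero, AlgTorus.torusChar_zero]
    · intro a b _ _ ha hb
      rw [AlgTorus.torusChar_add, AlgTorus.torusChar_add, ha, hb]
    · intro m a _ ha
      rw [AlgTorus.torusChar_zsmul, AlgTorus.torusChar_zsmul, ha]
  · intro h e he
    rw [mem_hypertorus, h _ (Submodule.subset_span ⟨e, he, rfl⟩)]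
    exact mem_hypertorus.1 (ht e he)

theorem mult_eq_radIndex [Module.Finite ℤ Γ] {Δ : ToricArrangement Γ E} {S : Set E}
    (h : (Δ.inter S).Nonempty) : Δ.mult S = radIndex (Δ.subSpan S) :=
  let ⟨_, ht⟩ := h
  AlgTorus.card_connectedComponents (mem_inter_iff ht)

theorem mult_eq_zero {Δ : ToricArrangement Γ E} {S : Set E} (h : ¬ (Δ.inter S).Nonempty) :
    Δ.mult S = 0 := by
  have : IsEmpty (Δ.inter S) := Set.isEmpty_coe_sort.2 (Set.not_nonempty_iff_eq_empty.1 h)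
  have : IsEmpty (ConnectedComponents (Δ.inter S)) :=
    Function.Surjective.isEmpty (f := ((↑) : Δ.inter S → ConnectedComponents (Δ.inter S)))
      ConnectedComponents.surjective_coe
  exact Nat.card_of_isEmpty

/-- The covering is surjective, so lifting neither creates nor destroys an empty intersection. This
matters because an empty intersection has multiplicity `0` rather than an index. -/
theorem inter_map_nonempty_iff [Module.Free ℤ Γ] [Module.Finite ℤ Γ] (Δ : ToricArrangement Γ E)
    {i : Γ →ₗ[ℤ] X} (hi : Function.Injective i) [Finite (X ⧸ LinearMap.range i)] (S : Set E) :
    ((Δ.map i).inter S).Nonempty ↔ (Δ.inter S).Nonempty := by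
  constructor
  · rintro ⟨t, ht⟩
    exact ⟨dualHom i t, ht⟩
  · rintro ⟨t, ht⟩
    obtain ⟨u, rfl⟩ := AlgTorus.dualHom_surjective hi t
    exact ⟨u, ht⟩

theorem finite_of_exact [Module.Finite ℤ Γ] {G : Type} [AddCommGroup G] [Finite G]
    {i : Γ →ₗ[ℤ] X} {q : X →ₗ[ℤ] G} (hiq : Function.Exact i q) : Module.Finite ℤ X := by
  refine ⟨Submodule.fg_of_fg_map_of_fg_inf_ker q (IsNoetherian.noetherian _) ?_⟩
  rw [top_inf_eq, hiq.linearMap_ker_eq, LinearMap.range_eq_map]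
  exact Submodule.FG.map i Module.Finite.fg_top

theorem finite_quotient_of_exact {G : Type} [AddCommGroup G] [Finite G]
    {i : Γ →ₗ[ℤ] X} {q : X →ₗ[ℤ] G} (hiq : Function.Exact i q) (hq : Function.Surjective q) :
    Finite (X ⧸ LinearMap.range i) :=
  Finite.of_equiv G (Function.Exact.linearEquivOfSurjective hiq hq).symm.toEquiv

/-- The multiplicity function of the lift of an arrangement along the covering given by an
extension. -/
theorem card_maxSplit_mul_mult [Module.Free ℤ Γ] [Module.Finite ℤ Γ] (Δ : ToricArrangement Γ E)
    {G : Type} [AddCommGroup G] [Finite G] {i : Γ →ₗ[ℤ] X} {q : X →ₗ[ℤ] G}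
    (hi : Function.Injective i) (hiq : Function.Exact i q) (hq : Function.Surjective q)
    (S : Set E) :
    Nat.card (maxSplit (extPush (radical (Δ.subSpan S)).mkQ (extensionClass i q hi hiq hq))) *
      Δ.mult S = (Δ.map i).mult S := by
  have := finite_of_exact hiq
  have := finite_quotient_of_exact hiq hq
  by_cases h : (Δ.inter S).Nonempty
  · rw [mult_eq_radIndex h, mult_eq_radIndex ((Δ.inter_map_nonempty_iff hi S).2 h), subSpan_map,
      card_maxSplit_mul_radIndex]
  · rw [mult_eq_zero h, mult_eq_zero (mt (Δ.inter_map_nonempty_iff hi S).1 h), mul_zero]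

end ToricArrangement
end

noncomputable section

/-! ### Finite abelian groups with the same coordinate kernels -/

section FiniteGroups

theorem exists_card_eq_prime_pow {p : ℕ} (hp : p.Prime) {A : Type*} [AddCommGroup A] [Finite A]
    (h : ∀ x : A, ∃ n : ℕ, p ^ n • x = 0) : ∃ k, Nat.card A = p ^ k := by
  refine ⟨_, Nat.eq_prime_pow_of_unique_prime_dvd Nat.card_pos.ne' fun {d} hd hdA => ?_⟩
  have := Fact.mk hd
  obtain ⟨x, hx⟩ := exists_prime_addOrderOf_dvd_card' d hdA
  obtain ⟨n, hn⟩ := h x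
  have h1 : d ∣ p ^ n := hx ▸ addOrderOf_dvd_of_nsmul_eq_zero hn
  exact (Nat.prime_dvd_prime_iff_eq hd hp).1 (hd.dvd_of_dvd_pow h1)

/-- A coordinate with largest image splits: an element over a generator of the image has the same
order as that generator, so it generates a complement of the kernel. -/
theorem exists_equiv_zmod_prod_ker {p : ℕ} (hp : p.Prime) {K C ι : Type*} [AddCommGroup K] [Finite K]
    [AddCommGroup C] [IsAddCyclic C] (hK : ∀ x : K, ∃ n : ℕ, p ^ n • x = 0) {s : Finset ι}
    {f : ι → K →+ C} (hinj : ∀ x, (∀ b ∈ s, f b x = 0) → x = 0) {b : ι}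
    (hmax : ∀ b' ∈ s, Nat.card (f b').range ≤ Nat.card (f b).range) :
    Nonempty (ZMod (Nat.card (f b).range) × (f b).ker ≃+ K) := by
  have hpow : ∀ b', ∃ k, Nat.card (f b').range = p ^ k := fun b' => by
    have : Finite (f b').range := Set.finite_range (f b')
    refine exists_card_eq_prime_pow hp ?_
    rintro ⟨_, x, rfl⟩
    obtain ⟨n, hn⟩ := hK x
    exact ⟨n, Subtype.ext (by simp [← map_nsmul, hn])⟩
  set m := Nat.card (f b).range with hm
  have hdvd : ∀ b' ∈ s, Nat.card (f b').range ∣ m := fun b' hb' => by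
    obtain ⟨k, hk⟩ := hpow b
    obtain ⟨k', hk'⟩ := hpow b'
    have := hmax b' hb'
    rw [hm, hk, hk'] at *
    exact pow_dvd_pow p ((Nat.pow_le_pow_iff_right hp.one_lt).1 this)
  obtain ⟨⟨_, x₀, rfl⟩, hx₀⟩ := IsAddCyclic.exists_generator (α := (f b).range)
  have hgen : ∀ x, ∃ k : ℤ, f b x = k • f b x₀ := fun x => by
    obtain ⟨k, hk⟩ := AddSubgroup.mem_zmultiples_iff.1 (hx₀ ⟨f b x, x, rfl⟩)
    exact ⟨k, (congrArg Subtype.val hk).symm⟩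
  have hord : addOrderOf (f b x₀) = m := by
    rw [hm, ← Nat.card_zmultiples]
    refine congrArg (fun H : AddSubgroup C => Nat.card H) (le_antisymm ?_ ?_)
    · rw [AddSubgroup.zmultiples_le]
      exact ⟨x₀, rfl⟩
    · rintro _ ⟨x, rfl⟩
      obtain ⟨k, hk⟩ := hgen x
      exact AddSubgroup.mem_zmultiples_iff.2 ⟨k, hk.symm⟩
  -- All images have `p`-power order, so the largest order `m` is a multiple of the others and kills
  -- every coordinate of `x₀`.
  have hmx : m • x₀ = 0 := hinj _ fun b' hb' => by
    obtain ⟨c, hc⟩ := hdvd b' hb'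
    have : Nat.card (f b').range • (⟨f b' x₀, x₀, rfl⟩ : (f b').range) = 0 :=
      card_nsmul_eq_zero'
    have h0 : Nat.card (f b').range • f b' x₀ = 0 := congrArg Subtype.val this
    rw [map_nsmul, hc, mul_comm, mul_smul, h0, smul_zero]
  let g : ZMod m →+ K := ZMod.lift m ⟨zmultiplesHom K x₀, by
    rw [zmultiplesHom_apply, natCast_zsmul, hmx]⟩
  have hg : ∀ k : ℤ, g k = k • x₀ := fun k => ZMod.lift_coe _ _ _
  refine ⟨AddEquiv.ofBijective (g.coprod (f b).ker.subtype) ⟨?_, fun x => ?_⟩⟩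
  · rw [injective_iff_map_eq_zero]
    rintro ⟨z, y⟩ h
    obtain ⟨k, rfl⟩ := ZMod.intCast_surjective z
    rw [AddMonoidHom.coprod_apply, hg] at h
    have hy : f b y.1 = 0 := y.2
    have h1 : k • f b x₀ = 0 := by
      have := congrArg (f b) h
      rwa [map_add, map_zsmul, AddSubgroup.subtype_apply, hy, add_zero, map_zero] at this
    have hk : (k : ZMod m) = 0 := by
      rw [ZMod.intCast_zmod_eq_zero_iff_dvd, ← hord]
      exact addOrderOf_dvd_iff_zsmul_eq_zero.2 h1
    have h2 : g k = 0 := by rw [hk, map_zero]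
    rw [← hg, h2, zero_add] at h
    exact Prod.ext hk (Subtype.ext h)
  · obtain ⟨k, hk⟩ := hgen x
    refine ⟨(k, ⟨x - k • x₀, ?_⟩), ?_⟩
    · rw [AddMonoidHom.mem_ker, map_sub, map_zsmul, hk, sub_self]
    · rw [AddMonoidHom.coprod_apply, hg, AddSubgroup.subtype_apply, add_sub_cancel]

/-- Two finite abelian `p`-groups with jointly injective cyclic coordinates are isomorphic if the
corresponding intersections of coordinate kernels have the same orders. -/
theorem nonempty_addEquiv_of_card_coord_ker {p : ℕ} (hp : p.Prime) {ι : Type*} (s : Finset ι)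
    {C C' : Type} [AddCommGroup C] [IsAddCyclic C] [AddCommGroup C'] [IsAddCyclic C'] :
    ∀ (K K' : Type) [AddCommGroup K] [AddCommGroup K'] [Finite K] [Finite K']
      (_ : ∀ x : K, ∃ n : ℕ, p ^ n • x = 0) (_ : ∀ x : K', ∃ n : ℕ, p ^ n • x = 0)
      (f : ι → K →+ C) (f' : ι → K' →+ C')
      (_ : ∀ x, (∀ b ∈ s, f b x = 0) → x = 0) (_ : ∀ x, (∀ b ∈ s, f' b x = 0) → x = 0)
      (_ : ∀ S ⊆ s, Nat.card {x // ∀ b ∈ S, f b x = 0} = Nat.card {x // ∀ b ∈ S, f' b x = 0}),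
      Nonempty (K ≃+ K') := by
  classical
  induction s using Finset.strongInduction with
  | H s ih =>
    intro K K' _ _ _ _ hK hK' f f' hf hf' hcard
    rcases s.eq_empty_or_nonempty with rfl | hs
    · have h1 : Subsingleton K := subsingleton_of_forall_eq 0 fun x => hf x (by simp)
      have h2 : Subsingleton K' := subsingleton_of_forall_eq 0 fun x => hf' x (by simp)
      exact ⟨⟨⟨fun _ => 0, fun _ => 0, fun _ => Subsingleton.elim _ _,
        fun _ => Subsingleton.elim _ _⟩, fun _ _ => Subsingleton.elim _ _⟩⟩
    have hKK : Nat.card K = Nat.card K' := by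
      simpa [Nat.card_congr (Equiv.subtypeUnivEquiv (p := fun _ => True) (fun _ => trivial))]
        using hcard ∅ (Finset.empty_subset s)
    -- The order of an image is the order of the group divided by that of the kernel, so it is the
    -- same on both sides, and one `b` is maximal for both groups.
    have hrange : ∀ b ∈ s, Nat.card (f b).range = Nat.card (f' b).range := fun b hb => by
      have h1 : Nat.card (f b).ker * Nat.card (f b).range = Nat.card K := by
        rw [← AddSubgroup.index_ker, AddSubgroup.card_mul_index]
      have h2 : Nat.card (f' b).ker * Nat.card (f' b).range = Nat.card K' := by
        rw [← AddSubgroup.index_ker, AddSubgroup.card_mul_index]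
      have h3 : Nat.card (f b).ker = Nat.card (f' b).ker := by
        simpa [AddMonoidHom.mem_ker, AddSubgroup.mem_carrier] using!
          hcard {b} (Finset.singleton_subset_iff.2 hb)
      rw [hKK, h3, ← h2] at h1
      exact Nat.eq_of_mul_eq_mul_left Nat.card_pos h1
    obtain ⟨b, hb, hmax⟩ := s.exists_max_image (fun b => Nat.card (f b).range) hs
    obtain ⟨e⟩ := exists_equiv_zmod_prod_ker hp hK hf hmax
    obtain ⟨e'⟩ := exists_equiv_zmod_prod_ker hp hK' hf' (b := b) fun b' hb' => by
      rw [← hrange b' hb', ← hrange b hb]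
      exact hmax b' hb'
    -- Induction on the two kernels of `f b` and `f' b`: the condition for `S` there is the original
    -- one for `insert b S`.
    obtain ⟨k⟩ := ih (s.erase b) (Finset.erase_ssubset hb) (f b).ker (f' b).ker
      (fun x => (hK x).imp fun n h => Subtype.ext h)
      (fun x => (hK' x).imp fun n h => Subtype.ext h)
      (fun b' => (f b').comp (f b).ker.subtype) (fun b' => (f' b').comp (f' b).ker.subtype)
      (fun x hx => Subtype.ext <| hf _ fun b' hb' => by
        by_cases h : b' = b
        · rw [h]; exact x.2
        · exact hx b' (Finset.mem_erase.2 ⟨h, hb'⟩))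
      (fun x hx => Subtype.ext <| hf' _ fun b' hb' => by
        by_cases h : b' = b
        · rw [h]; exact x.2
        · exact hx b' (Finset.mem_erase.2 ⟨h, hb'⟩))
      (fun S hS => by
        have key : ∀ {A D : Type} [AddCommGroup A] [AddCommGroup D] (g : ι → A →+ D),
            Nat.card {x : (g b).ker // ∀ b' ∈ S, ((g b').comp (g b).ker.subtype) x = 0} =
              Nat.card {x : A // ∀ b' ∈ insert b S, g b' x = 0} := fun g =>
          Nat.card_congr
            { toFun := fun x => ⟨x.1.1, Finset.forall_mem_insert _ _ _ |>.2 ⟨x.1.2, x.2⟩⟩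
              invFun := fun x => ⟨⟨x.1, (Finset.forall_mem_insert _ _ _ |>.1 x.2).1⟩,
                (Finset.forall_mem_insert _ _ _ |>.1 x.2).2⟩
              left_inv := fun _ => rfl
              right_inv := fun _ => rfl }
        rw [key f, key f']
        exact hcard _ (Finset.insert_subset hb (hS.trans (Finset.erase_subset b s))))
    rw [hrange b hb] at e
    exact ⟨e.symm.trans (((AddEquiv.refl _).prodCongr k).trans e')⟩

/-- The order of the `p`-primary part of a finite abelian group. -/
theorem card_torsionBy_prime_pow {p : ℕ} (hp : p.Prime) (A : Type*) [AddCommGroup A] [Finite A]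
    {n : ℕ} (hn : (Nat.card A).factorization p ≤ n) :
    Nat.card (Submodule.torsionBy ℤ A ((p : ℤ) ^ n)) = p ^ (Nat.card A).factorization p := by
  have := Fact.mk hp
  set T := Submodule.torsionBy ℤ A ((p : ℤ) ^ n)
  have hmem : ∀ x, x ∈ T ↔ p ^ n • x = 0 := fun x => by
    rw [Submodule.mem_torsionBy_iff, ← natCast_zsmul, Nat.cast_pow]
  obtain ⟨k, hk⟩ := exists_card_eq_prime_pow hp (A := T)
    fun x => ⟨n, Subtype.ext ((hmem x.1).1 x.2)⟩
  have : Finite (A ⧸ T) := Finite.of_surjective _ T.mkQ_surjective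
  -- An element of order `p` in `A ⧸ T` would lift to one of `p`-power order. That order divides
  -- `|A|`, hence `p ^ n`, so the lift would lie in `T`.
  have hndvd : ¬ p ∣ Nat.card (A ⧸ T) := fun hd => by
    obtain ⟨z, hz⟩ := exists_prime_addOrderOf_dvd_card' p hd
    obtain ⟨x, rfl⟩ := Submodule.Quotient.mk_surjective _ z
    have h1 : p • x ∈ T := by
      rw [← Submodule.Quotient.mk_eq_zero, Submodule.Quotient.mk_smul, ← hz]
      exact addOrderOf_nsmul_eq_zero _
    rw [hmem, ← mul_smul, ← pow_succ] at h1
    have h2 : addOrderOf x ∣ p ^ n := by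
      obtain ⟨j, hj, hj'⟩ := (Nat.dvd_prime_pow hp).1 (addOrderOf_dvd_of_nsmul_eq_zero h1)
      have h3 : p ^ j ∣ Nat.card A := hj' ▸ addOrderOf_dvd_natCard x
      rw [hj']
      exact pow_dvd_pow p (((hp.pow_dvd_iff_le_factorization Nat.card_pos.ne').1 h3).trans hn)
    have h3 : x ∈ T := (hmem x).2 (addOrderOf_dvd_iff_nsmul_eq_zero.1 h2)
    rw [(Submodule.Quotient.mk_eq_zero _).2 h3, addOrderOf_zero] at hz
    exact hp.one_lt.ne hz
  have hmul : Nat.card A = p ^ k * Nat.card (A ⧸ T) := by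
    rw [← hk, Submodule.card_eq_card_quotient_mul_card T, mul_comm]
  rw [hk, hmul, Nat.factorization_mul (pow_ne_zero _ hp.ne_zero) Nat.card_pos.ne',
    Finsupp.add_apply, Nat.factorization_eq_zero_of_not_dvd hndvd, hp.factorization_pow,
    Finsupp.single_eq_same, add_zero]

/-- Finite abelian groups with isomorphic primary parts are isomorphic. -/
theorem nonempty_linearEquiv_of_torsionBy {A A' : Type} [AddCommGroup A] [AddCommGroup A'] {N : ℕ}
    (hN : N ≠ 0) (hA : ∀ x : A, N • x = 0) (hA' : ∀ x : A', N • x = 0)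
    (h : ∀ p : ℕ, p.Prime → ∃ n ≥ N.factorization p,
      Nonempty (Submodule.torsionBy ℤ A ((p : ℤ) ^ n) ≃ₗ[ℤ] Submodule.torsionBy ℤ A' ((p : ℤ) ^ n))) :
    Nonempty (A ≃ₗ[ℤ] A') := by
  classical

  choose! n hn e using h
  let q : ℕ → ℤ := fun p => (p : ℤ) ^ n p
  have hq : (N.primeFactors : Set ℕ).Pairwise (Function.onFun IsCoprime q) := by
    intro p hp p' hp' hne
    refine IsCoprime.pow ?_
    exact Nat.isCoprime_iff_coprime.2 ((Nat.coprime_primes (Nat.prime_of_mem_primeFactors hp)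
      (Nat.prime_of_mem_primeFactors hp')).2 hne)
  -- The exponents are large enough for the product of these coprime powers to kill both groups,
  -- which are therefore direct sums of their torsion parts.
  have hdvd : (N : ℤ) ∣ ∏ p ∈ N.primeFactors, q p := by
    conv_lhs => rw [← Nat.prod_factorization_pow_eq_self hN]
    rw [Nat.prod_factorization_eq_prod_primeFactors, Nat.cast_prod]
    refine Finset.prod_dvd_prod_of_dvd _ _ fun p hp => ?_
    rw [Nat.cast_pow]
    exact pow_dvd_pow _ (hn p (Nat.prime_of_mem_primeFactors hp))
  have hT : ∀ {M : Type} [AddCommGroup M], (∀ x : M, N • x = 0) →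
      Module.IsTorsionBy ℤ M (∏ p ∈ N.primeFactors, q p) := fun {M} _ hM x => by
    obtain ⟨c, hc⟩ := hdvd
    rw [hc, mul_comm, mul_smul, natCast_zsmul, hM, smul_zero]
  have h1 := Submodule.torsionBy_isInternal hq (hT hA)
  have h2 := Submodule.torsionBy_isInternal hq (hT hA')
  exact ⟨(LinearEquiv.ofBijective (DirectSum.coeLinearMap _) h1).symm.trans
    ((DFinsupp.mapRange.linearEquiv fun p : N.primeFactors =>
      (e p (Nat.prime_of_mem_primeFactors p.2)).some).trans
      (LinearEquiv.ofBijective (DirectSum.coeLinearMap _) h2))⟩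

end FiniteGroups
end

noncomputable section

/-! ### Cokernels are determined by the multiplicities -/

section Cokernel

/-- For a basis of a sublattice of finite index, the quotient has cyclic coordinates, and the common
kernels of the coordinates have the orders given by the indices of spans in their radicals. -/
theorem exists_coord_card_eq_radIndex {X ι : Type} [AddCommGroup X] [Module.IsTorsionFree ℤ X]
    [Finite ι] {w : ι → X} (hw : LinearIndependent ℤ w)
    [Finite (X ⧸ Submodule.span ℤ (Set.range w))] :
    ∃ (n : ℕ) (f : ι → X ⧸ Submodule.span ℤ (Set.range w) →+ ZMod n),
      (∀ z, (∀ b, f b z = 0) → z = 0) ∧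
      ∀ S : Set ι, Nat.card {z // ∀ b ∈ S, f b z = 0} =
        radIndex (Submodule.span ℤ (w '' Sᶜ)) := by
  set M := Submodule.span ℤ (Set.range w) with hM
  have : Finite (X ⧸ LinearMap.range M.subtype) := by rwa [Submodule.range_subtype]
  obtain ⟨n, ρ, hn, hρ, hρ'⟩ := exists_quasi_inverse M.injective_subtype
  let β : Module.Basis ι ℤ M := Module.Basis.span hw
  have hβ : ∀ b, (β b : X) = w b := fun b => congrArg Subtype.val (Module.Basis.span_apply hw b)
  have hnz : (n : ℤ) ≠ 0 := Nat.cast_ne_zero.2 hn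
  -- On `M` the functional `c b` is `n` times the coordinate `b`, so modulo `n` it descends to `X ⧸
  -- M`.
  let c : ι → X →ₗ[ℤ] ℤ := fun b => β.coord b ∘ₗ ρ
  have hcM : ∀ b (m : M), c b m = n * β.coord b m := fun b m => by
    have := hρ' m
    rw [Submodule.subtype_apply] at this
    simp only [c, LinearMap.comp_apply, this, map_nsmul, nsmul_eq_mul]
  have hspan : ∀ (S : Set ι) (m : M),
      (m : X) ∈ Submodule.span ℤ (w '' Sᶜ) ↔ ∀ b ∈ S, β.coord b m = 0 := fun S m => by
    have h1 : Submodule.span ℤ (w '' Sᶜ) = (Submodule.span ℤ (β '' Sᶜ)).map M.subtype := by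
      rw [Submodule.map_span, Set.image_image]
      simp only [Submodule.subtype_apply, hβ]
    rw [h1, ← Submodule.subtype_apply, ← SetLike.mem_coe, Submodule.map_coe,
      M.injective_subtype.mem_set_image, SetLike.mem_coe, β.mem_span_image]
    constructor
    · intro h b hb
      by_contra hne
      exact h (Finsupp.mem_support_iff.2 hne) hb
    · intro h b hb hbS
      exact Finsupp.mem_support_iff.1 hb (h b hbS)
  have hMle : ∀ S : Set ι, Submodule.span ℤ (w '' Sᶜ) ≤ M := fun S =>
    Submodule.span_mono (Set.image_subset_range _ _)
  have hrad : ∀ (S : Set ι) (x : X),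
      x ∈ radical (Submodule.span ℤ (w '' Sᶜ)) ↔ ∀ b ∈ S, c b x = 0 := fun S x => by
    rw [mem_radical]
    constructor
    · rintro ⟨m, hm, h⟩ b hb
      have h1 := (hspan S ⟨_, hMle S h⟩).1 h b hb
      have h2 := hcM b ⟨_, hMle S h⟩
      rw [h1, mul_zero] at h2
      change c b (m • x) = 0 at h2
      rw [map_smul] at h2
      exact (smul_eq_zero.1 h2).resolve_left hm
    · intro h
      refine ⟨n, hnz, ?_⟩
      have := hρ x
      rw [Submodule.subtype_apply] at this
      rw [natCast_zsmul, ← this]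
      exact (hspan S _).2 h
  let f : ι → X ⧸ M →+ ZMod n := fun b =>
    (M.liftQ ((Int.castAddHom (ZMod n)).toIntLinearMap ∘ₗ c b) fun m hm => by
      have := hcM b ⟨m, hm⟩
      change ((c b m : ℤ) : ZMod n) = 0
      rw [this]
      simp).toAddMonoidHom
  have hf : ∀ b x, f b (Submodule.Quotient.mk x) = (c b x : ℤ) := fun b x => rfl
  -- If `n` divides the values `c b x` for `b ∈ S`, subtracting from `x` the element of `M` with
  -- coordinates `c b x / n` lands in the radical.
  have hP : ∀ (S : Set ι) (x : X), (∀ b ∈ S, f b (Submodule.Quotient.mk x) = 0) ↔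
      x ∈ radical (Submodule.span ℤ (w '' Sᶜ)) ⊔ M := fun S x => by
    classical
    constructor
    · intro h
      have hd : ∀ b ∈ S, ∃ k : ℤ, c b x = n * k := fun b hb =>
        (ZMod.intCast_zmod_eq_zero_iff_dvd _ n).1 (h b hb)
      choose! k hk using hd
      have := Fintype.ofFinite ι
      let m : M := ∑ b, k b • β b
      have hm : ∀ b, β.coord b m = k b := fun b => by
        rw [Module.Basis.coord_apply, Module.Basis.repr_sum_self]
      refine Submodule.mem_sup.2 ⟨x - m, (hrad S _).2 fun b hb => ?_, m, m.2, sub_add_cancel _ _⟩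
      rw [map_sub, hcM, hm b, hk b hb, sub_self]
    · intro h b hb
      obtain ⟨r, hr, m, hm, rfl⟩ := Submodule.mem_sup.1 h
      have := hcM b ⟨m, hm⟩
      rw [hf, map_add, (hrad S r).1 hr b hb, zero_add, this]
      simp
  refine ⟨n, f, fun z hz => ?_, fun S => ?_⟩
  · obtain ⟨x, rfl⟩ := Submodule.Quotient.mk_surjective _ z
    have h1 := (hP Set.univ x).1 fun b _ => hz b
    have h0 : radical (Submodule.span ℤ (w '' Set.univᶜ)) = ⊥ := by
      rw [Set.compl_univ, Set.image_empty, Submodule.span_empty, eq_bot_iff]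
      intro y hy
      obtain ⟨m, hm, h⟩ := mem_radical.1 hy
      exact (smul_eq_zero.1 ((Submodule.mem_bot ℤ).1 h)).resolve_left hm
    rw [h0, bot_sup_eq] at h1
    exact (Submodule.Quotient.mk_eq_zero _).2 h1
  · let P : AddSubgroup (X ⧸ M) := ⨅ b ∈ S, (f b).ker
    have hPm : ∀ z, z ∈ P ↔ ∀ b ∈ S, f b z = 0 := fun z => by
      simp [P, AddSubgroup.mem_iInf, AddMonoidHom.mem_ker]
    have h1 : Nat.card {z // ∀ b ∈ S, f b z = 0} = Nat.card P :=
      Nat.card_congr (Equiv.subtypeEquivRight fun z => (hPm z).symm)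
    have h2 : (radical (Submodule.span ℤ (w '' Sᶜ))).toAddSubgroup ⊔ M.toAddSubgroup =
        AddSubgroup.comap M.mkQ.toAddMonoidHom P := by
      rw [← Submodule.sup_toAddSubgroup]
      ext x
      exact ((hP S x).symm.trans (hPm _).symm)
    have h3 : M.toAddSubgroup = AddSubgroup.comap M.mkQ.toAddMonoidHom ⊥ := by
      ext x
      simp
    -- By the second isomorphism theorem, the common kernel `(R + M)/M` has the order of `R/(R ∩
    -- M)`; here `R` is the radical and `R ∩ M` is the span itself.
    have h4 : M.toAddSubgroup ⊓ (radical (Submodule.span ℤ (w '' Sᶜ))).toAddSubgroup =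
        (Submodule.span ℤ (w '' Sᶜ)).toAddSubgroup := by
      ext x
      constructor
      · rintro ⟨hx, hr⟩
        refine (hspan S ⟨x, hx⟩).2 fun b hb => ?_
        have := (hrad S x).1 hr b hb
        rw [show c b x = n * β.coord b ⟨x, hx⟩ from hcM b ⟨x, hx⟩] at this
        exact (mul_eq_zero.1 this).resolve_left hnz
      · exact fun hx => ⟨hMle S hx, le_radical _ hx⟩
    calc Nat.card {z // ∀ b ∈ S, f b z = 0} = (⊥ : AddSubgroup (X ⧸ M)).relIndex P := by
          rw [h1, AddSubgroup.relIndex_bot_left]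
      _ = M.toAddSubgroup.relIndex
          ((radical (Submodule.span ℤ (w '' Sᶜ))).toAddSubgroup ⊔ M.toAddSubgroup) := by
          rw [h2]
          conv_rhs => rw [h3]
          rw [AddSubgroup.relIndex_comap,
            AddSubgroup.map_comap_eq_self_of_surjective M.mkQ_surjective]
      _ = _ := by
          rw [AddSubgroup.relIndex_sup_right, ← AddSubgroup.inf_relIndex_right, h4]
          rfl

/-- A spanning family contains, for every prime `p`, a linearly independent family whose span has
finite index prime to `p`. -/
theorem exists_linearIndepOn_prime_to {Γ E : Type} [AddCommGroup Γ] [Module.IsTorsionFree ℤ Γ]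
    [Finite E] {χ : E → Γ} (hχ : Submodule.span ℤ (Set.range χ) = ⊤) {p : ℕ} (hp : p.Prime) :
    ∃ B : Set E, LinearIndepOn ℤ χ B ∧
      ∀ γ, ∃ m : ℤ, ¬ (p : ℤ) ∣ m ∧ m • γ ∈ Submodule.span ℤ (χ '' B) := by
  have hpZ : Prime (p : ℤ) := Nat.prime_iff_prime_int.1 hp
  -- A minimal set spanning up to multipliers prime to `p` turns out to be independent.
  obtain ⟨B, hB⟩ := exists_minimal_of_wellFoundedLT
    (fun B : Set E => ∀ γ, ∃ m : ℤ, ¬ (p : ℤ) ∣ m ∧ m • γ ∈ Submodule.span ℤ (χ '' B))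
    ⟨Set.univ, fun γ => ⟨1, fun h => hpZ.not_isUnit (isUnit_of_dvd_one h), by
      rw [Set.image_univ, hχ]; trivial⟩⟩
  refine ⟨B, ?_, hB.prop⟩
  by_contra hdep
  have := Fintype.ofFinite B
  obtain ⟨g, hg, b₀, hb₀⟩ := Fintype.not_linearIndependent_iff.1 hdep
  -- Dividing a relation by the gcd of its coefficients leaves one prime to `p`; the corresponding
  -- character is then redundant, against minimality.
  obtain ⟨g', hg', hgcd⟩ := Finset.univ.extract_gcd g ⟨b₀, Finset.mem_univ _⟩
  have hd : Finset.univ.gcd g ≠ 0 := fun h0 => hb₀ (Finset.gcd_eq_zero_iff.1 h0 b₀ (Finset.mem_univ _))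
  have hsum : ∑ b, g' b • χ b = 0 := by
    have : Finset.univ.gcd g • ∑ b, g' b • χ b = 0 := by
      rw [Finset.smul_sum, ← hg]
      exact Finset.sum_congr rfl fun b hb => by rw [hg' b hb, mul_smul]
    exact (smul_eq_zero.1 this).resolve_left hd
  obtain ⟨b, hb⟩ : ∃ b, ¬ (p : ℤ) ∣ g' b := by
    by_contra! h
    exact hpZ.not_isUnit (isUnit_of_dvd_one (hgcd ▸ Finset.dvd_gcd fun b _ => h b))
  have hbmem : g' b • χ b ∈ Submodule.span ℤ (χ '' (B \ {b.1})) := by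
    classical
    rw [← Finset.add_sum_erase _ _ (Finset.mem_univ b), add_eq_zero_iff_eq_neg] at hsum
    rw [hsum]
    refine Submodule.neg_mem _ (Submodule.sum_mem _ fun b' hb' => Submodule.smul_mem _ _
      (Submodule.subset_span ⟨b', ⟨b'.2, fun h => ?_⟩, rfl⟩))
    exact (Finset.mem_erase.1 hb').1 (Subtype.ext h)
  refine (hB.not_prop_of_lt (y := B \ {b.1}) ⟨Set.sdiff_subset, fun h => (h b.2).2 rfl⟩) fun γ => ?_
  obtain ⟨m, hm, h⟩ := hB.prop γ
  refine ⟨g' b * m, fun h => (hpZ.dvd_or_dvd h).elim hb hm, ?_⟩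
  rw [mul_smul]
  have hle : Submodule.span ℤ (χ '' B) ≤
      (Submodule.span ℤ (χ '' (B \ {b.1}))).comap (LinearMap.lsmul ℤ Γ (g' b)) := by
    rw [Submodule.span_le]
    rintro _ ⟨e, he, rfl⟩
    by_cases heb : e = b
    · rw [heb]
      exact hbmem
    · have h' : χ e ∈ Submodule.span ℤ (χ '' (B \ {b.1})) :=
        Submodule.subset_span (Set.mem_image_of_mem χ ⟨he, heb⟩)
      exact Submodule.smul_mem _ (g' b) h'
  exact hle h

/-- Restricting to a sublattice of index prime to `p` does not change the `p`-torsion of the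
cokernel. -/
theorem nonempty_torsionBy_cokernel_equiv {Γ X : Type} [AddCommGroup Γ] [AddCommGroup X]
    (i : Γ →ₗ[ℤ] X) {p : ℕ} (hp : p.Prime) {N : Submodule ℤ Γ}
    (hN : ∀ γ, ∃ m : ℤ, ¬ (p : ℤ) ∣ m ∧ m • γ ∈ N) (n : ℕ) :
    Nonempty (Submodule.torsionBy ℤ (X ⧸ N.map i) ((p : ℤ) ^ n) ≃ₗ[ℤ]
      Submodule.torsionBy ℤ (X ⧸ LinearMap.range i) ((p : ℤ) ^ n)) := by
  have hcop : ∀ m : ℤ, ¬ (p : ℤ) ∣ m → IsCoprime m ((p : ℤ) ^ n) := fun m hm =>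
    (((Nat.prime_iff_prime_int.1 hp).coprime_iff_not_dvd.2 hm).pow_left).symm
  let π : X ⧸ N.map i →ₗ[ℤ] X ⧸ LinearMap.range i :=
    (N.map i).mapQ (LinearMap.range i) LinearMap.id LinearMap.map_le_range
  have hπ : ∀ z ∈ Submodule.torsionBy ℤ (X ⧸ N.map i) ((p : ℤ) ^ n),
      π z ∈ Submodule.torsionBy ℤ (X ⧸ LinearMap.range i) ((p : ℤ) ^ n) := fun z hz => by
    rw [Submodule.mem_torsionBy_iff] at hz ⊢
    rw [← map_smul, hz, map_zero]
  refine ⟨LinearEquiv.ofBijective (π.restrict hπ) ⟨?_, ?_⟩⟩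
  · rw [injective_iff_map_eq_zero]
    rintro ⟨z, hz⟩ h
    obtain ⟨x, rfl⟩ := Submodule.Quotient.mk_surjective _ z
    obtain ⟨γ, rfl⟩ := (Submodule.Quotient.mk_eq_zero _).1 (congrArg Subtype.val h)
    obtain ⟨m, hm, hmγ⟩ := hN γ
    obtain ⟨u, v, huv⟩ := hcop m hm
    refine Subtype.ext ?_
    -- An element of the kernel is killed by `m` and by `p ^ n`, which are coprime.
    have h1 : m • (Submodule.Quotient.mk (i γ) : X ⧸ N.map i) = 0 :=
      (Submodule.Quotient.mk_eq_zero _).2 ⟨m • γ, hmγ, map_smul _ _ _⟩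
    rw [Submodule.mem_torsionBy_iff] at hz
    change (Submodule.Quotient.mk (i γ) : X ⧸ N.map i) = 0
    rw [← one_smul ℤ (Submodule.Quotient.mk (i γ) : X ⧸ N.map i), ← huv, add_smul, mul_smul,
      mul_smul, h1, hz, smul_zero, smul_zero, add_zero]
  · rintro ⟨y, hy⟩
    obtain ⟨x, rfl⟩ := Submodule.Quotient.mk_surjective _ y
    rw [Submodule.mem_torsionBy_iff] at hy
    obtain ⟨γ, hγ⟩ := (Submodule.Quotient.mk_eq_zero (LinearMap.range i)
      (x := ((p : ℤ) ^ n) • x)).1 hy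
    obtain ⟨m, hm, hmγ⟩ := hN γ
    obtain ⟨u, v, huv⟩ := hcop m hm
    -- Modulo `p ^ n` the factor `u * m` is `1`, so the image is unchanged, while `m` moves `p ^ n •
    -- x` into the image of `N`.
    refine ⟨⟨Submodule.Quotient.mk ((u * m) • x), ?_⟩, Subtype.ext ?_⟩
    · rw [Submodule.mem_torsionBy_iff]
      refine (Submodule.Quotient.mk_eq_zero (N.map i)).2 ⟨u • m • γ, N.smul_mem u hmγ, ?_⟩
      rw [map_smul, map_smul, hγ]
      simp only [smul_smul]
      congr 1
      ring
    · change (u * m) • (Submodule.Quotient.mk x : X ⧸ LinearMap.range i) = Submodule.Quotient.mk x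
      rw [eq_sub_of_add_eq huv, sub_smul, one_smul, mul_smul, hy, smul_zero, sub_zero]

/-- Restricting the coordinates to the `p ^ n`-torsion replaces each common kernel by its
`p`-primary part. -/
theorem card_torsionBy_coord {p : ℕ} (hp : p.Prime) {K C ι : Type} [AddCommGroup K] [Finite K]
    [AddCommGroup C] (f : ι → K →+ C) (S : Finset ι) {n : ℕ}
    (hn : (Nat.card K).factorization p ≤ n) :
    Nat.card {x : Submodule.torsionBy ℤ K ((p : ℤ) ^ n) // ∀ b ∈ S, f b x = 0} =
      p ^ (Nat.card {z // ∀ b ∈ S, f b z = 0}).factorization p := by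
  let A : Submodule ℤ K := AddSubgroup.toIntSubmodule (⨅ b ∈ S, (f b).ker)
  have hA : ∀ z, z ∈ A ↔ ∀ b ∈ S, f b z = 0 := fun z => by
    change z ∈ (⨅ b ∈ S, (f b).ker : AddSubgroup K) ↔ _
    simp [AddSubgroup.mem_iInf, AddMonoidHom.mem_ker]
  have h1 : Nat.card {z // ∀ b ∈ S, f b z = 0} = Nat.card A :=
    Nat.card_congr (Equiv.subtypeEquivRight fun z => (hA z).symm)
  have h2 : Nat.card A ∣ Nat.card K := AddSubgroup.card_addSubgroup_dvd_card A.toAddSubgroup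
  have h3 := (Nat.factorization_le_iff_dvd Nat.card_pos.ne' Nat.card_pos.ne').2 h2 p
  rw [h1, ← card_torsionBy_prime_pow hp A (h3.trans hn)]
  exact Nat.card_congr
    { toFun := fun x => ⟨⟨x.1.1, (hA _).2 x.2⟩, Subtype.ext x.1.2⟩
      invFun := fun x => ⟨⟨x.1.1, congrArg Subtype.val x.2⟩, (hA _).1 x.1.2⟩
      left_inv := fun _ => rfl
      right_inv := fun _ => rfl }

theorem finite_quotient_map {Γ X : Type} [AddCommGroup Γ] [AddCommGroup X] [Module.Finite ℤ X]
    (i : Γ →ₗ[ℤ] X) [Finite (X ⧸ LinearMap.range i)] {N : Submodule ℤ Γ}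
    (hN : ∀ γ, ∃ m : ℤ, m ≠ 0 ∧ m • γ ∈ N) : Finite (X ⧸ N.map i) := by
  refine Module.finite_of_fg_torsion _ fun z => ?_
  obtain ⟨x, rfl⟩ := Submodule.Quotient.mk_surjective _ z
  have h1 : Nat.card (X ⧸ LinearMap.range i) •
      (Submodule.Quotient.mk x : X ⧸ LinearMap.range i) = 0 := card_nsmul_eq_zero'
  obtain ⟨γ, hγ⟩ := (Submodule.Quotient.mk_eq_zero (LinearMap.range i)
    (x := Nat.card (X ⧸ LinearMap.range i) • x)).1 h1
  obtain ⟨m, hm, hmγ⟩ := hN γ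
  refine ⟨⟨m * Nat.card (X ⧸ LinearMap.range i), mem_nonZeroDivisors_of_ne_zero
    (mul_ne_zero hm (Nat.cast_ne_zero.2 Nat.card_pos.ne'))⟩, ?_⟩
  refine (Submodule.Quotient.mk_eq_zero (N.map i)).2 ⟨m • γ, hmγ, ?_⟩
  rw [map_smul, hγ, ← natCast_zsmul, ← mul_smul]

/-- Two finite-index extensions of a lattice to torsion-free groups have isomorphic cokernels if
their multiplicities agree on independent sets. -/
theorem nonempty_cokernel_equiv {Γ X X' E : Type} [AddCommGroup Γ] [AddCommGroup X]
    [AddCommGroup X'] [Module.IsTorsionFree ℤ Γ] [Module.IsTorsionFree ℤ X]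
    [Module.IsTorsionFree ℤ X'] [Module.Finite ℤ X] [Module.Finite ℤ X'] [Finite E] {χ : E → Γ}
    (hχ : Submodule.span ℤ (Set.range χ) = ⊤) {i : Γ →ₗ[ℤ] X} {i' : Γ →ₗ[ℤ] X'}
    (hi : Function.Injective i) (hi' : Function.Injective i') [Finite (X ⧸ LinearMap.range i)]
    [Finite (X' ⧸ LinearMap.range i')]
    (h : ∀ S : Set E, LinearIndepOn ℤ χ S → radIndex ((Submodule.span ℤ (χ '' S)).map i) =
      radIndex ((Submodule.span ℤ (χ '' S)).map i')) :
    Nonempty ((X ⧸ LinearMap.range i) ≃ₗ[ℤ] (X' ⧸ LinearMap.range i')) := by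
  refine nonempty_linearEquiv_of_torsionBy
    (N := Nat.card (X ⧸ LinearMap.range i) * Nat.card (X' ⧸ LinearMap.range i'))
    (mul_ne_zero Nat.card_pos.ne' Nat.card_pos.ne')
    (fun x => by rw [mul_comm, mul_smul, card_nsmul_eq_zero', smul_zero])
    (fun x => by rw [mul_smul, card_nsmul_eq_zero', smul_zero]) fun p hp => ?_
  -- For the `p`-part, `Γ` may be replaced by the span of `B`, which has coordinates.
  obtain ⟨B, hB, hBp⟩ := exists_linearIndepOn_prime_to hχ hp
  have hB0 : ∀ γ, ∃ m : ℤ, m ≠ 0 ∧ m • γ ∈ Submodule.span ℤ (χ '' B) := fun γ =>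
    (hBp γ).imp fun m h => ⟨fun h0 => h.1 (h0 ▸ dvd_zero _), h.2⟩
  have hfin := finite_quotient_map i hB0
  have hfin' := finite_quotient_map i' hB0
  have hmap : ∀ {Y : Type} [AddCommGroup Y] (j : Γ →ₗ[ℤ] Y) (S : Set B),
      Submodule.span ℤ ((fun b : B => j (χ b)) '' S) =
        (Submodule.span ℤ (χ '' (Subtype.val '' S))).map j := fun j S => by
    rw [Submodule.map_span, Set.image_image, Set.image_image]
  have hrange : ∀ {Y : Type} [AddCommGroup Y] (j : Γ →ₗ[ℤ] Y),
      (Submodule.span ℤ (χ '' B)).map j = Submodule.span ℤ (Set.range fun b : B => j (χ b)) :=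
    fun j => by
    rw [← Set.image_univ, hmap, Set.image_univ, Subtype.range_coe]
  -- The exponent must capture the whole `p`-part of both cokernels modulo the span of `B`, and be
  -- admissible for gluing the primes.
  let n := max ((Nat.card (X ⧸ LinearMap.range i) *
    Nat.card (X' ⧸ LinearMap.range i')).factorization p)
    (max ((Nat.card (X ⧸ (Submodule.span ℤ (χ '' B)).map i)).factorization p)
      ((Nat.card (X' ⧸ (Submodule.span ℤ (χ '' B)).map i')).factorization p))
  have hn : (Nat.card (X ⧸ (Submodule.span ℤ (χ '' B)).map i)).factorization p ≤ n :=
    (le_max_left _ _).trans (le_max_right _ _)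
  have hn' : (Nat.card (X' ⧸ (Submodule.span ℤ (χ '' B)).map i')).factorization p ≤ n :=
    (le_max_right _ _).trans (le_max_right _ _)
  refine ⟨n, le_max_left _ _, ?_⟩
  obtain ⟨e⟩ := nonempty_torsionBy_cokernel_equiv i hp hBp n
  obtain ⟨e'⟩ := nonempty_torsionBy_cokernel_equiv i' hp hBp n
  clear_value n
  rw [hrange i] at hfin hn e
  rw [hrange i'] at hfin' hn' e'
  have hw : LinearIndependent ℤ fun b : B => i (χ b) :=
    LinearIndependent.map' hB i (LinearMap.ker_eq_bot.2 hi)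
  have hw' : LinearIndependent ℤ fun b : B => i' (χ b) :=
    LinearIndependent.map' hB i' (LinearMap.ker_eq_bot.2 hi')
  obtain ⟨k, f, hf, hcard⟩ := exists_coord_card_eq_radIndex hw
  obtain ⟨k', f', hf', hcard'⟩ := exists_coord_card_eq_radIndex hw'
  have hprim : ∀ {A : Type} [AddCommGroup A] (x : Submodule.torsionBy ℤ A ((p : ℤ) ^ n)),
      ∃ n : ℕ, p ^ n • x = 0 := fun x => ⟨n, Subtype.ext (by
    have := (Submodule.mem_torsionBy_iff _ _).1 x.2
    change p ^ n • x.1 = 0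
    rw [← this, ← natCast_zsmul, Nat.cast_pow])⟩
  have := Fintype.ofFinite B
  obtain ⟨g⟩ := nonempty_addEquiv_of_card_coord_ker hp Finset.univ _ _
    (hprim (A := X ⧸ Submodule.span ℤ (Set.range fun b : B => i (χ b))))
    (hprim (A := X' ⧸ Submodule.span ℤ (Set.range fun b : B => i' (χ b))))
    (fun b => (f b).comp (Submodule.torsionBy ℤ _ ((p : ℤ) ^ n)).subtype.toAddMonoidHom)
    (fun b => (f' b).comp (Submodule.torsionBy ℤ _ ((p : ℤ) ^ n)).subtype.toAddMonoidHom)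
    (fun x hx => Subtype.ext (hf x fun b => hx b (Finset.mem_univ b)))
    (fun x hx => Subtype.ext (hf' x fun b => hx b (Finset.mem_univ b)))
    -- The common kernel of the coordinates in `S` is counted by the multiplicity of the complement
    -- of `S` in `B`, an independent set.
    (fun S _ => by
      refine (card_torsionBy_coord hp f S hn).trans
        (Eq.trans ?_ (card_torsionBy_coord hp f' S hn').symm)
      have h1 := hcard S
      have h2 := hcard' S
      simp only [Finset.mem_coe] at h1 h2
      rw [h1, h2, hmap, hmap, h]
      exact hB.mono (by rintro _ ⟨b, -, rfl⟩; exact b.2))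
  exact ⟨e.symm.trans (g.toIntLinearEquiv.trans e')⟩

end Cokernel
end

noncomputable section

/-! ### Extensions and coverings -/

section Correspondence

variable {Γ G G' Γ' X X' E : Type} [AddCommGroup Γ] [AddCommGroup Γ'] [AddCommGroup G]
  [AddCommGroup G'] [AddCommGroup X] [AddCommGroup X']

theorem exists_cokernel_equiv {i : Γ →ₗ[ℤ] X} {q : X →ₗ[ℤ] G} {i' : Γ' →ₗ[ℤ] X'}
    {q' : X' →ₗ[ℤ] G'} (hiq : Function.Exact i q) (hq : Function.Surjective q)
    (hiq' : Function.Exact i' q') (hq' : Function.Surjective q') {a : Γ ≃ₗ[ℤ] Γ'}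
    {e : X ≃ₗ[ℤ] X'} (h : ∀ γ, e (i γ) = i' (a γ)) :
    ∃ σ : G ≃ₗ[ℤ] G', ∀ x, σ (q x) = q' (e x) := by
  have hmap : (LinearMap.range i).map (e : X →ₗ[ℤ] X') = LinearMap.range i' := by
    ext x
    constructor
    · rintro ⟨_, ⟨γ, rfl⟩, rfl⟩
      exact ⟨a γ, (h γ).symm⟩
    · rintro ⟨γ, rfl⟩
      refine ⟨_, ⟨a.symm γ, rfl⟩, ?_⟩
      rw [LinearEquiv.coe_coe, h, a.apply_symm_apply]
  let k := hiq.linearEquivOfSurjective hq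
  let k' := hiq'.linearEquivOfSurjective hq'
  refine ⟨(k.symm.trans (Submodule.Quotient.equiv _ _ e hmap)).trans k', fun x => ?_⟩
  have hk : k.symm (q x) = Submodule.Quotient.mk x := k.symm_apply_eq.2 rfl
  rw [LinearEquiv.trans_apply, LinearEquiv.trans_apply, hk]
  rfl

/-- Independent characters take arbitrary prescribed values: logarithms of these values extend to a
linear functional once the lattice is embedded in a rational vector space. -/
theorem ToricArrangement.inter_nonempty_of_linearIndepOn [Module.Free ℤ Γ]
    (Δ : ToricArrangement Γ E) {S : Set E}
    (hS : LinearIndepOn ℤ Δ.χ S) : (Δ.inter S).Nonempty := by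
  let b := Module.Free.chooseBasis ℤ Γ
  let c : Γ →ₗ[ℤ] (Module.Free.ChooseBasisIndex ℤ Γ → ℚ) :=
    LinearMap.pi fun k => (Int.castAddHom ℚ).toIntLinearMap ∘ₗ b.coord k
  have hc : LinearMap.ker c = ⊥ := by
    rw [LinearMap.ker_eq_bot']
    refine fun γ h => b.forall_coord_eq_zero_iff.1 fun k => ?_
    have := congrFun h k
    exact Int.cast_eq_zero.1 this
  have hv : LinearIndependent ℚ fun e : S => c (Δ.χ e) :=
    (LinearIndependent.iff_fractionRing ℤ ℚ).1 (LinearIndependent.map' hS c hc)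
  obtain ⟨g, hg⟩ := LinearMap.exists_extend
    ((Module.Basis.span hv).constr ℚ fun e : S => Complex.log ((Δ.a e)⁻¹ : ℂˣ))
  refine ⟨AlgTorus.exp (g.restrictScalars ℤ ∘ₗ c), fun e he => mem_hypertorus.2 (Units.ext ?_)⟩
  rw [AlgTorus.val_torusChar_exp]
  have h1 := LinearMap.congr_fun hg (Module.Basis.span hv ⟨e, he⟩)
  rw [Module.Basis.constr_basis, LinearMap.comp_apply, Module.Basis.span_apply] at h1
  have h2 : (g.restrictScalars ℤ ∘ₗ c) (Δ.χ e) = Complex.log ((Δ.a e)⁻¹ : ℂˣ) := h1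
  rw [h2, Complex.exp_log (Units.ne_zero _)]

theorem isTorsionFree_of_radIndex_bot (h : radIndex (⊥ : Submodule ℤ X) = 1) :
    Module.IsTorsionFree ℤ X := by
  rw [Module.isTorsionFree_iff_smul_eq_zero]
  intro n x hx
  refine or_iff_not_imp_left.2 fun hn => ?_
  have h1 := AddSubgroup.relIndex_eq_one.1 h
  exact (Submodule.mem_bot ℤ).1 (h1 (mem_radical.2 ⟨n, hn, (Submodule.mem_bot ℤ).2 hx⟩))

theorem ToricArrangement.mult_empty [Module.Finite ℤ X] (Δ : ToricArrangement X E) :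
    Δ.mult ∅ = radIndex (⊥ : Submodule ℤ X) := by
  rw [mult_eq_radIndex ⟨1, fun e he => he.elim⟩, subSpan, Set.image_empty, Submodule.span_empty]

/-- The value at `∅` shows whether the torus is connected, hence whether its character group is
torsion-free. -/
theorem ToricArrangement.mult_empty_of_connectedSpace [ConnectedSpace (AlgTorus X)]
    (Δ : ToricArrangement X E) : Δ.mult ∅ = 1 := by
  have h : Δ.inter ∅ = Set.univ := Set.eq_univ_of_forall fun t e he => he.elim
  have : ConnectedSpace (Δ.inter ∅) := by
    rw [h]
    exact Subtype.connectedSpace isConnected_univ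
  rw [mult, Nat.card_eq_one_iff_unique]
  exact ⟨inferInstance, inferInstance⟩

/-- The kernel is dual to the cokernel, and a finite abelian group is (noncanonically) isomorphic to
its dual. -/
theorem nonempty_equiv_of_ker_equiv {i : Γ →ₗ[ℤ] X} [Finite G]
    [Finite (X ⧸ LinearMap.range i)]
    (h : Nonempty ((dualHom i).ker ≃* AlgTorus G)) :
    Nonempty ((X ⧸ LinearMap.range i) ≃ₗ[ℤ] G) := by
  obtain ⟨e⟩ := h
  obtain ⟨e₁⟩ := CommGroup.monoidHom_mulEquiv_of_hasEnoughRootsOfUnity (Multiplicative G) ℂ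
  obtain ⟨e₂⟩ := CommGroup.monoidHom_mulEquiv_of_hasEnoughRootsOfUnity
    (Multiplicative (X ⧸ LinearMap.range i)) ℂ
  have f : AlgTorus (X ⧸ LinearMap.range i) ≃* AlgTorus G :=
    (AlgTorus.kerDualHom i).symm.trans e
  have g : Multiplicative (X ⧸ LinearMap.range i) ≃* Multiplicative G :=
    e₂.symm.trans (f.trans e₁)
  exact ⟨(MulEquiv.toAdditive g : _ ≃+ _).toIntLinearEquiv⟩

/-- The covering `Hom(X, ℂ*) → Hom(Γ, ℂ*)` of an extension `X` of a finite group. -/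
def extensionCovering [Module.Free ℤ Γ] [Module.Finite ℤ Γ] [Finite G] {i : Γ →ₗ[ℤ] X}
    {q : X →ₗ[ℤ] G} (hi : Function.Injective i) (hiq : Function.Exact i q)
    (hq : Function.Surjective q) : TorusCovering Γ where
  Λ := X
  fg := ToricArrangement.finite_of_exact hiq
  proj := dualHom i
  isAlgHom := dualHom_isAlgHom i
  isCovering :=
    have := ToricArrangement.finite_quotient_of_exact hiq hq
    AlgTorus.isCoveringMap_dualHom hi

variable [Module.Free ℤ Γ] [Module.Finite ℤ Γ] [Finite G]

theorem liftMult_extensionCovering (Δ : ToricArrangement Γ E) {i : Γ →ₗ[ℤ] X} {q : X →ₗ[ℤ] G}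
    (hi : Function.Injective i) (hiq : Function.Exact i q) (hq : Function.Surjective q) :
    Δ.liftMult (extensionCovering hi hiq hq) = fun S =>
      Nat.card (maxSplit (extPush (radical (Δ.subSpan S)).mkQ (extensionClass i q hi hiq hq))) *
        Δ.mult S := by
  rw [Δ.liftMult_eq (c := extensionCovering hi hiq hq) rfl]
  exact funext fun S => (Δ.card_maxSplit_mul_mult hi hiq hq S).symm

/-- Coverings of extensions are isomorphic if and only if the classes agree up to `Aut(G)`. -/
theorem extensionCovering_iso_iff {i : Γ →ₗ[ℤ] X} {q : X →ₗ[ℤ] G} {i' : Γ →ₗ[ℤ] X'}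
    {q' : X' →ₗ[ℤ] G} (hi : Function.Injective i) (hiq : Function.Exact i q)
    (hq : Function.Surjective q) (hi' : Function.Injective i') (hiq' : Function.Exact i' q')
    (hq' : Function.Surjective q') :
    (extensionCovering hi hiq hq).Iso (extensionCovering hi' hiq' hq') ↔
      ∃ σ : G ≃ₗ[ℤ] G, extPull σ.toLinearMap (extensionClass i q hi hiq hq) =
        extensionClass i' q' hi' hiq' hq' := by
  constructor
  · rintro ⟨f, hf, h⟩
    change AlgTorus X ≃* AlgTorus X' at f
    -- Duality reverses arrows: `e` goes from `X'` to `X` and is the identity on `Γ`.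
    obtain ⟨e, rfl⟩ := AlgTorus.exists_eq_dualEquiv hf
    have he : ∀ γ, e (i' γ) = i γ := fun γ =>
      AlgTorus.torusChar_injective fun t => congrArg (torusChar γ) (h t)
    obtain ⟨σ, hσ⟩ := exists_cokernel_equiv hiq' hq' hiq hq (a := LinearEquiv.refl ℤ Γ) he
    refine ⟨σ, ?_⟩
    rw [← extensionClass_naturality hi' hiq' hq' hi hiq hq (a := LinearMap.id)
      (h := e.toLinearMap) (LinearMap.ext he) (LinearMap.ext fun x => (hσ x).symm), extPush_id]
  · rintro ⟨σ, hσ⟩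
    obtain ⟨e, he, -⟩ := exists_equiv_of_extPush_eq_extPull hi' hiq' hq' hi hiq hq
      (a := LinearEquiv.refl ℤ Γ) (c := σ) (by rw [hσ]; exact extPush_id _)
    refine ⟨AlgTorus.dualEquiv e, AlgTorus.isAlgIso_dualEquiv e, fun t => ?_⟩
    exact AlgTorus.ext fun γ => congrArg (fun x => torusChar x t) (he γ)

/-- Coverings with the same multiplicity function as a connected covering have the same Galois
group. -/
theorem nonempty_cokernel_equiv_of_mult_eq [Finite E] {Δ : ToricArrangement Γ E}
    (hΔ : Δ.IsSurjective) [Module.Finite ℤ X] [Module.Finite ℤ X'] {i : Γ →ₗ[ℤ] X}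
    {i' : Γ →ₗ[ℤ] X'} (hi : Function.Injective i) (hi' : Function.Injective i')
    [Finite (X ⧸ LinearMap.range i)] [Finite (X' ⧸ LinearMap.range i')]
    (hc : ConnectedSpace (AlgTorus X)) (h : (Δ.map i).mult = (Δ.map i').mult) :
    Nonempty ((X ⧸ LinearMap.range i) ≃ₗ[ℤ] (X' ⧸ LinearMap.range i')) := by
  have h0 := (Δ.map i).mult_empty_of_connectedSpace
  have h0' : (Δ.map i').mult ∅ = 1 := by rw [← h, h0]
  rw [ToricArrangement.mult_empty] at h0 h0'
  have := isTorsionFree_of_radIndex_bot h0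
  have := isTorsionFree_of_radIndex_bot h0'
  refine nonempty_cokernel_equiv hΔ hi hi' fun S hS => ?_
  have hne := Δ.inter_nonempty_of_linearIndepOn hS
  have h1 := congrFun h S
  rwa [ToricArrangement.mult_eq_radIndex ((Δ.inter_map_nonempty_iff hi S).2 hne),
    ToricArrangement.mult_eq_radIndex ((Δ.inter_map_nonempty_iff hi' S).2 hne),
    ToricArrangement.subSpan_map, ToricArrangement.subSpan_map] at h1

/-- Injectivity is the isomorphism criterion for coverings of extensions. For surjectivity, equal
multiplicities identify the cokernel with `G`, and the counting formula makes the resulting class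
coherent. -/
theorem exists_correspondence [Finite E] (ΔU : ToricArrangement Γ E) (T : TorusCovering Γ)
    (hΔ : ΔU.IsSurjective) (hT : ConnectedSpace (AlgTorus T.Λ))
    (hker : Nonempty (T.proj.ker ≃* AlgTorus G)) :
    ∃ Φ : CoherentClasses G ΔU (ΔU.liftMult T) → CoveringClasses ΔU (ΔU.liftMult T),
      Function.Bijective Φ ∧
      ∀ (x : ExtOne G Γ) (hx : IsCoherent ΔU (ΔU.liftMult T) x)
        (X : Type) [AddCommGroup X] (i : Γ →ₗ[ℤ] X) (q : X →ₗ[ℤ] G)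
        (hi : Function.Injective i) (hiq : Function.Exact i q) (hq : Function.Surjective q),
        extensionClass i q hi hiq hq = x →
        ∃ (_ : Module.Finite ℤ X) (hcov : IsCoveringMap (dualHom i))
          (hm : ΔU.liftMult ⟨X, dualHom i, dualHom_isAlgHom i, hcov⟩ = ΔU.liftMult T),
          Φ (Quotient.mk _ ⟨x, hx⟩) =
            Quotient.mk _ ⟨⟨X, dualHom i, dualHom_isAlgHom i, hcov⟩, hm⟩ := by
  choose X grp i q hi hiq hq hcl using fun x : ExtOne G Γ => exists_extensionClass_eq x
  let c : ExtOne G Γ → TorusCovering Γ := fun x => extensionCovering (hi x) (hiq x) (hq x)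
  have hc : ∀ x, IsCoherent ΔU (ΔU.liftMult T) x → ΔU.liftMult (c x) = ΔU.liftMult T :=
    fun x hx => by
      rw [liftMult_extensionCovering, hcl]
      exact funext hx
  have hiso : ∀ x y, (c x).Iso (c y) ↔ ∃ σ : G ≃ₗ[ℤ] G, extPull σ.toLinearMap x = y :=
    fun x y => by rw [extensionCovering_iso_iff, hcl, hcl]
  let Φ : CoherentClasses G ΔU (ΔU.liftMult T) → CoveringClasses ΔU (ΔU.liftMult T) :=
    Quotient.lift (fun x => Quotient.mk _ ⟨c x.1, hc x.1 x.2⟩)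
      fun x y h => Quotient.sound ((hiso x.1 y.1).2 h)
  have hΦ : ∀ (x : ExtOne G Γ) (hx : IsCoherent ΔU (ΔU.liftMult T) x)
      (X : Type) [AddCommGroup X] (i : Γ →ₗ[ℤ] X) (q : X →ₗ[ℤ] G)
      (hi : Function.Injective i) (hiq : Function.Exact i q) (hq : Function.Surjective q),
      extensionClass i q hi hiq hq = x →
      ∃ (_ : Module.Finite ℤ X) (hcov : IsCoveringMap (dualHom i))
        (hm : ΔU.liftMult ⟨X, dualHom i, dualHom_isAlgHom i, hcov⟩ = ΔU.liftMult T),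
        Φ (Quotient.mk _ ⟨x, hx⟩) =
          Quotient.mk _ ⟨⟨X, dualHom i, dualHom_isAlgHom i, hcov⟩, hm⟩ := by
    intro x hx X' _ i' q' hi' hiq' hq' hcl'
    refine ⟨ToricArrangement.finite_of_exact hiq', (extensionCovering hi' hiq' hq').isCovering,
      ?_, ?_⟩
    · have := liftMult_extensionCovering ΔU hi' hiq' hq'
      rw [hcl'] at this
      exact this.trans (funext hx)
    · refine Quotient.sound ((extensionCovering_iso_iff (hi x) (hiq x) (hq x) hi' hiq' hq').2
        ⟨LinearEquiv.refl ℤ G, ?_⟩)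
      rw [hcl, hcl']
      exact extPull_id x
  refine ⟨Φ, ⟨fun a b => ?_, fun d => ?_⟩, hΦ⟩
  · induction a using Quotient.inductionOn
    induction b using Quotient.inductionOn
    intro h
    exact Quotient.sound ((hiso _ _).1 (Quotient.exact h))
  · induction d using Quotient.inductionOn with
    | h d =>
    obtain ⟨⟨Λ, p, hp, hpc⟩, hd⟩ := d
    obtain ⟨ΛT, pT, hpT, hpcT⟩ := T
    dsimp only at hT hker
    obtain ⟨j, rfl⟩ := AlgTorus.exists_eq_dualHom hp
    obtain ⟨jT, rfl⟩ := AlgTorus.exists_eq_dualHom hpT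
    have hj := AlgTorus.injective_of_isCoveringMap hpc
    have hjT := AlgTorus.injective_of_isCoveringMap hpcT
    have := AlgTorus.finite_of_isCoveringMap hpc
    have := AlgTorus.finite_of_isCoveringMap hpcT
    obtain ⟨e₁⟩ := nonempty_cokernel_equiv_of_mult_eq hΔ hjT hj hT hd.symm
    obtain ⟨e₂⟩ := nonempty_equiv_of_ker_equiv hker
    let e := e₁.symm.trans e₂
    have hex : Function.Exact j (e.toLinearMap ∘ₗ (LinearMap.range j).mkQ) := fun x => by
      rw [LinearMap.comp_apply, LinearEquiv.coe_coe, LinearEquiv.map_eq_zero_iff,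
        Submodule.mkQ_apply, Submodule.Quotient.mk_eq_zero]
      rfl
    have hsurj : Function.Surjective (e.toLinearMap ∘ₗ (LinearMap.range j).mkQ) :=
      e.surjective.comp (Submodule.mkQ_surjective _)
    have hcoh : IsCoherent ΔU _ (extensionClass j _ hj hex hsurj) := fun S =>
      (ΔU.card_maxSplit_mul_mult hj hex hsurj S).trans (congrFun hd S)
    obtain ⟨_, _, _, h⟩ := hΦ _ hcoh _ j _ hj hex hsurj rfl
    exact ⟨_, h⟩

end Correspondence
end

noncomputable section

/-! ### Signs on graphs -/

section Signs

theorem Int.units_eq_or_eq_neg (a b : ℤˣ) : a = b ∨ a = -b := by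
  revert a b
  decide

variable {V : Type*}

/-- The double cover of a graph with signs on its edges. -/
def SimpleGraph.signCover (G : SimpleGraph V) (s : V → V → ℤˣ) (hs : ∀ u v, s u v = s v u) :
    SimpleGraph (V × ℤˣ) where
  Adj y z := G.Adj y.1 z.1 ∧ z.2 = y.2 * s y.1 z.1
  symm := ⟨fun y z h => ⟨h.1.symm, by
    rw [h.2, hs z.1, mul_assoc, Int.units_mul_self, mul_one]⟩⟩
  loopless := ⟨fun y h => h.1.ne rfl⟩

/-- Signs on the edges of a graph are differences of signs on the vertices, unless the graph has an
induced cycle with negative product. -/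
theorem SimpleGraph.exists_vertex_signs_or_induced_cycle (G : SimpleGraph V) (s : V → V → ℤˣ)
    (hs : ∀ u v, s u v = s v u) {Q : V → Prop} (hQ : ∀ u v, G.Adj u v → Q u ∨ Q v) :
    (∃ ε : V → ℤˣ, ∀ u v, G.Adj u v → s u v = ε u * ε v) ∨
    ∃ (n : ℕ) (x : ℕ → V), Q (x 0) ∧ x n = x 0 ∧ (∀ i < n, G.Adj (x i) (x (i + 1))) ∧
      ∏ i ∈ Finset.range n, s (x i) (x (i + 1)) = -1 ∧
      (∀ i j, i < j → j < n → x i ≠ x j) ∧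
      ∀ i j, i < j → j < n → G.Adj (x i) (x j) → j = i + 1 ∨ (i = 0 ∧ j + 1 = n) := by
  classical
  let D := G.signCover s hs
  let W : ℕ → V × ℤˣ → V × ℤˣ → Prop := fun k y z => ∃ p : D.Walk y z, p.length = k
  have Wcomp : ∀ {k l y z w}, W k y z → W l z w → W (k + l) y w := by
    rintro k l y z w ⟨p, rfl⟩ ⟨q, rfl⟩
    exact ⟨p.append q, p.length_append q⟩
  have Wadj : ∀ {y z}, D.Adj y z → W 1 y z := fun h => ⟨h.toWalk, rfl⟩
  have Wnil : ∀ {y}, W 0 y y := ⟨.nil, rfl⟩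
  let neg : V × ℤˣ → V × ℤˣ := fun y => (y.1, -y.2)
  have negneg : ∀ y, neg (neg y) = y := fun y => by simp [neg]
  have negadj : ∀ {y z}, D.Adj y z → D.Adj (neg y) (neg z) := fun {y z} h =>
    ⟨h.1, by change -z.2 = -y.2 * _; rw [neg_mul, h.2]⟩
  have Wneg : ∀ {k y z}, W k y z → W k (neg y) (neg z) := by
    rintro k y z ⟨p, rfl⟩
    induction p with
    | nil => exact Wnil
    | cons h p ih =>
      have := Wcomp (Wadj (negadj h)) ih
      rwa [add_comm] at this
  -- A walk from a vertex of the double cover to its antipode projects to a closed walk with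
  -- negative product. A shortest one projects to an induced cycle; if there is none, the signs come
  -- from vertices.
  by_cases hP : ∃ n, ∃ y, W n y (neg y)
  · right
    classical
    have hmin : ∀ k y, W k y (neg y) → Nat.find hP ≤ k := fun k y h => Nat.find_min' hP ⟨y, h⟩
    obtain ⟨y₀, hy₀⟩ := Nat.find_spec hP
    set n := Nat.find hP with hn
    have hne : ∀ y, y ≠ neg y := fun y h => by
      have := congrArg Prod.snd h
      exact units_ne_neg_self y.2 this
    have hn0 : n ≠ 0 := by
      intro h0
      obtain ⟨p, hp⟩ := hy₀
      exact hne _ (p.eq_of_length_eq_zero (hp.trans h0))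
    have hfun : ∀ {y}, W n y (neg y) → ∃ f : ℕ → V × ℤˣ, f 0 = y ∧ f n = neg y ∧
        ∀ i < n, D.Adj (f i) (f (i + 1)) := by
      rintro y ⟨p, hp⟩
      exact ⟨p.getVert, p.getVert_zero, by rw [← hp, p.getVert_length],
        fun i hi => p.adj_getVert_succ (hp ▸ hi)⟩
    have Wfun : ∀ {f : ℕ → V × ℤˣ}, (∀ i < n, D.Adj (f i) (f (i + 1))) → ∀ i j, i ≤ j → j ≤ n →
        W (j - i) (f i) (f j) := by
      intro f hf i j hij
      induction j, hij using Nat.le_induction with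
      | base => intro _; rw [Nat.sub_self]; exact Wnil
      | succ j hij ih =>
        intro hj
        have := Wcomp (ih (by omega)) (Wadj (hf j (by omega)))
        rwa [show j + 1 - i = j - i + 1 by omega]
    -- Removing the first edge and appending its antipodal copy moves the starting point one step,
    -- so it can be put in `Q`.
    obtain ⟨y, hyQ, hy⟩ : ∃ y, Q y.1 ∧ W n y (neg y) := by
      obtain ⟨f, hf0, hfn, hf⟩ := hfun hy₀
      have h01 := hf 0 (by omega)
      rcases hQ _ _ h01.1 with h | h
      · exact ⟨y₀, hf0 ▸ h, hy₀⟩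
      · refine ⟨f 1, h, ?_⟩
        have h1 := Wfun hf 1 n (by omega) le_rfl
        have h2 := Wadj (negadj h01)
        rw [hf0, ← hfn] at h2
        have h3 := Wcomp h1 h2
        rwa [show n - 1 + 1 = n by omega] at h3
    obtain ⟨f, hf0, hfn, hf⟩ := hfun hy
    have hcase : ∀ {u v : V × ℤˣ}, u.1 = v.1 → u = v ∨ u = neg v := fun {u v} h =>
      (Int.units_eq_or_eq_neg u.2 v.2).imp (fun h2 => Prod.ext h h2) (fun h2 => Prod.ext h h2)
    -- A shortcut between two points of the walk keeps it antipodal, so it cannot make it shorter.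
    have hshort : ∀ i j k, i ≤ n → j ≤ n → W k (f i) (f j) → n ≤ i + k + (n - j) := by
      intro i j k hi hj h
      refine hmin _ y ?_
      have := Wcomp (Wcomp (Wfun hf 0 i (by omega) hi) h) (Wfun hf j n hj le_rfl)
      rwa [hf0, hfn, Nat.sub_zero] at this
    refine ⟨n, fun i => (f i).1, by simpa only [hf0] using hyQ, ?_, fun i hi => (hf i hi).1, ?_,
      fun i j hij hj hx => ?_, fun i j hij hj hadj => ?_⟩
    · change (f n).1 = (f 0).1
      rw [hfn, hf0]
    · have hprod : ∀ m ≤ n, (f m).2 = (f 0).2 * ∏ i ∈ Finset.range m, s (f i).1 (f (i + 1)).1 := by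
        intro m
        induction m with
        | zero => intro _; simp
        | succ m ih =>
          intro hm
          rw [Finset.prod_range_succ, ← mul_assoc, ← ih (by omega)]
          exact (hf m (by omega)).2
      have := hprod n le_rfl
      rw [hfn, hf0] at this
      change -y.2 = _ at this
      exact mul_left_cancel (a := y.2) (by rw [← this, mul_neg_one])
    -- A repeated vertex gives either the same lift, hence a shortcut, or antipodal lifts, hence a
    -- shorter antipodal walk.
    · rcases hcase hx with h | h
      · have := hshort i j 0 (by omega) (by omega) (h ▸ Wnil)
        omega
      · have h1 := Wfun hf i j hij.le hj.le
        rw [h] at h1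
        have h2 := hmin _ (neg (f j)) (by rwa [negneg])
        omega
    -- Lifted at `f i`, the chord ends at `f j`, a shortcut unless `j = i + 1`, or at its antipode.
    -- In the latter case it closes up the stretch from `i` to `j`, which must then be all but one
    -- edge of the walk.
    · have hz : D.Adj (f i) ((f j).1, (f i).2 * s (f i).1 (f j).1) := ⟨hadj, rfl⟩
      rcases hcase (u := ((f j).1, (f i).2 * s (f i).1 (f j).1)) (v := f j) rfl with h | h
      · rw [h] at hz
        have := hshort i j 1 (by omega) (by omega) (Wadj hz)
        omega
      · rw [h] at hz
        have h1 := Wcomp (Wadj hz.symm) (Wfun hf i j hij.le hj.le)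
        have h2 := hmin _ (neg (f j)) (by rwa [negneg])
        omega
  · left
    have hlift : ∀ {u v}, G.Reachable u v → ∀ a, ∃ b, D.Reachable (u, a) (v, b) := by
      rintro u v ⟨p⟩
      induction p with
      | nil => exact fun a => ⟨a, .rfl⟩
      | @cons u v w h p ih =>
        intro a
        obtain ⟨b, hb⟩ := ih (a * s u v)
        exact ⟨b, (SimpleGraph.Adj.reachable (G := D) ⟨h, rfl⟩).trans hb⟩
    -- The sign of `v` names a sheet reachable from `1` over the chosen root of its component; an
    -- inconsistent edge would yield an antipodal walk.
    let r : V → V := fun v => (G.connectedComponentMk v).out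
    have hr : ∀ v, G.Reachable (r v) v := fun v =>
      SimpleGraph.ConnectedComponent.exact (Quot.out_eq _)
    choose ε hε using fun v => hlift (hr v) 1
    refine ⟨ε, fun u v h => ?_⟩
    have hruv : r u = r v := congrArg Quot.out (SimpleGraph.ConnectedComponent.sound h.reachable)
    have h1 := hε u
    rw [hruv] at h1
    have h2 : D.Reachable (u, ε u) (v, ε u * s u v) := SimpleGraph.Adj.reachable ⟨h, rfl⟩
    obtain ⟨p⟩ := (hε v).symm.trans (h1.trans h2)
    rcases Int.units_eq_or_eq_neg (ε u * s u v) (ε v) with h3 | h3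
    · rw [← h3, ← mul_assoc, Int.units_mul_self, one_mul]
    · rw [h3] at p
      exact absurd ⟨_, _, p, rfl⟩ hP

end Signs

/-! ### Matrices whose minors agree up to signs -/

section Minors

variable {K ι E : Type*} [Field K] [Fintype ι] [DecidableEq ι]

/-- The determinant of a matrix supported on the diagonal and on a cycle. -/
theorem det_eq_of_isCycle {M : Matrix ι ι K} {c : Equiv.Perm ι} (hc : c.IsCycle)
    (h0 : ∀ i j, c j = j → M i j ≠ 0 → i = j)
    (h1 : ∀ i j, c i ≠ i → c j ≠ j → M i j ≠ 0 → i = j ∨ i = c j) :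
    M.det = ∏ i, M i i + (Equiv.Perm.sign c : ℤ) * ∏ i, M (c i) i := by
  -- Only the identity and `c` contribute to the determinant.
  have key : ∀ σ : Equiv.Perm ι, (∀ i, M (σ i) i ≠ 0) → σ = 1 ∨ σ = c := by
    intro σ hσ
    have hfix : ∀ j, c j = j → σ j = j := fun j hj => h0 _ _ hj (hσ j)
    have hmov : ∀ j, c j ≠ j → σ j = j ∨ σ j = c j := fun j hj =>
      h1 _ _ (fun h => hj (by rwa [σ.injective (hfix _ h)] at h)) hj (hσ j)
    by_cases hall : ∀ j, σ j = j
    · exact Or.inl (Equiv.ext hall)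
    obtain ⟨x, hx⟩ := not_forall.1 hall
    have hcx : c x ≠ x := fun h => hx (hfix x h)
    -- Once `σ` agrees with `c` at a point, injectivity forbids it to fix the next one, so it
    -- follows `c` around the whole cycle.
    have hpow : ∀ n : ℕ, σ ((c ^ n) x) = c ((c ^ n) x) ∧ c ((c ^ n) x) ≠ (c ^ n) x := by
      intro n
      induction n with
      | zero => exact ⟨(hmov x hcx).resolve_left hx, hcx⟩
      | succ n ih =>
        have h2 : c ((c ^ (n + 1)) x) ≠ (c ^ (n + 1)) x := by
          rw [pow_succ', Equiv.Perm.mul_apply]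
          exact fun h => ih.2 (c.injective h)
        refine ⟨(hmov _ h2).resolve_left fun h => ?_, h2⟩
        rw [pow_succ', Equiv.Perm.mul_apply, ← ih.1] at h
        exact ih.2 (ih.1 ▸ σ.injective h)
    refine Or.inr (Equiv.ext fun j => ?_)
    by_cases hj : c j = j
    · rw [hj, hfix j hj]
    · obtain ⟨n, rfl⟩ := hc.exists_pow_eq hcx hj
      exact (hpow n).1
  rw [Matrix.det_apply, ← Finset.sum_subset (Finset.subset_univ {1, c}),
    Finset.sum_pair hc.ne_one.symm]
  · simp [Units.smul_def, zsmul_eq_mul]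
  · intro σ _ hσ
    by_contra hne
    have : ∀ i, M (σ i) i ≠ 0 := fun i h => hne (by
      have h' : ∏ i, M (σ i) i = 0 := Finset.prod_eq_zero (Finset.mem_univ i) h
      rw [h', smul_zero])
    rcases key σ this with rfl | rfl <;> simp at hσ

/-- Both determinants have the form `P ± Q` with the same sign, and `P²` and `Q²` agree entrywise;
comparing the squares leaves the cross terms `2PQ`. -/
theorem prod_mul_prod_eq_of_sq_det_eq [CharZero K] {M M' : Matrix ι ι K} {c : Equiv.Perm ι}
    (hc : c.IsCycle) (h0 : ∀ i j, c j = j → M i j ≠ 0 → i = j)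
    (h1 : ∀ i j, c i ≠ i → c j ≠ j → M i j ≠ 0 → i = j ∨ i = c j)
    (hM : ∀ i j, M' i j ^ 2 = M i j ^ 2) (hdet : M'.det ^ 2 = M.det ^ 2) :
    (∏ i, M' i i) * ∏ i, M' (c i) i = (∏ i, M i i) * ∏ i, M (c i) i := by
  have hne : ∀ i j, M' i j ≠ 0 → M i j ≠ 0 := fun i j h h' => h (by
    have := hM i j
    rw [h', zero_pow two_ne_zero] at this
    exact pow_eq_zero_iff two_ne_zero |>.1 this)
  rw [det_eq_of_isCycle hc h0 h1, det_eq_of_isCycle hc (fun i j h h' => h0 i j h (hne _ _ h'))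
    (fun i j h h' h'' => h1 i j h h' (hne _ _ h''))] at hdet
  have hP : (∏ i, M' i i) ^ 2 = (∏ i, M i i) ^ 2 := by
    simp only [← Finset.prod_pow, hM]
  have hQ : (∏ i, M' (c i) i) ^ 2 = (∏ i, M (c i) i) ^ 2 := by
    simp only [← Finset.prod_pow, hM]
  have h2 : (2 : K) ≠ 0 := two_ne_zero
  rcases Int.units_eq_one_or (Equiv.Perm.sign c) with hs | hs <;> rw [hs] at hdet
  · simp only [Units.val_one, Int.cast_one, one_mul] at hdet
    refine mul_left_cancel₀ h2 ?_
    linear_combination hdet - hP - hQ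
  · simp only [Units.val_neg, Units.val_one, Int.cast_neg, Int.cast_one, neg_mul, one_mul] at hdet
    refine mul_left_cancel₀ h2 ?_
    linear_combination -hdet + hP + hQ

end Minors
end

noncomputable section

/-! ### Sign rigidity -/

section Rigidity

variable {K ι E : Type*} [Field K]

/-- The cyclic permutation `r 0 ↦ r 1 ↦ ⋯ ↦ r (k - 1) ↦ r 0 = r k`. -/
theorem exists_isCycle_of_sequence [DecidableEq ι] {r : ℕ → ι} {k : ℕ} (hk : 2 ≤ k) (hrk : r k = r 0)
    (hr : ∀ l m, l < m → m < k → r l ≠ r m) :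
    ∃ c : Equiv.Perm ι, c.IsCycle ∧ (∀ l < k, c (r l) = r (l + 1)) ∧
      (∀ i, c i ≠ i ↔ ∃ l < k, r l = i) := by
  let L := (List.range k).map r
  have hL : L.Nodup := List.Nodup.map_on (fun a ha b hb hab => by
    rw [List.mem_range] at ha hb
    rcases lt_trichotomy a b with h | h | h
    · exact absurd hab (hr a b h hb)
    · exact h
    · exact absurd hab.symm (hr b a h ha)) List.nodup_range
  have hlen : L.length = k := by simp [L]
  have hc : ∀ l < k, L.formPerm (r l) = r (l + 1) := by
    intro l hl
    have h := List.formPerm_apply_getElem L hL l (by omega)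
    simp only [L, List.getElem_map, List.getElem_range, List.length_map, List.length_range] at h
    rw [h]
    rcases Nat.lt_or_ge (l + 1) k with h1 | h1
    · rw [Nat.mod_eq_of_lt h1]
    · rw [show l + 1 = k by omega, Nat.mod_self, hrk]
  refine ⟨L.formPerm, List.isCycle_formPerm hL (by omega), hc, fun i => ⟨fun h => ?_, ?_⟩⟩
  · have := List.mem_of_formPerm_apply_ne h
    simpa [L] using this
  · rintro ⟨l, hl, rfl⟩
    rw [hc l hl]
    rcases Nat.lt_or_ge (l + 1) k with h1 | h1
    · exact (hr l (l + 1) (by omega) h1).symm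
    · rw [show l + 1 = k by omega, hrk]
      exact hr 0 l (by omega) hl

/-- The bipartite graph of the support of a matrix. -/
def supportGraph (A : ι → E → K) : SimpleGraph (ι ⊕ E) where
  Adj u v := (∃ i e, A i e ≠ 0 ∧ u = .inl i ∧ v = .inr e) ∨
    ∃ i e, A i e ≠ 0 ∧ v = .inl i ∧ u = .inr e
  symm := ⟨fun _ _ h => h.symm⟩
  loopless := ⟨by rintro u (⟨i, e, -, rfl, h⟩ | ⟨i, e, -, rfl, h⟩) <;> simp at h⟩

@[simp] theorem supportGraph_adj_inl_inr {A : ι → E → K} {i : ι} {e : E} :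
    (supportGraph A).Adj (.inl i) (.inr e) ↔ A i e ≠ 0 := by
  simp [supportGraph]

@[simp] theorem supportGraph_adj_inr_inl {A : ι → E → K} {i : ι} {e : E} :
    (supportGraph A).Adj (.inr e) (.inl i) ↔ A i e ≠ 0 := by
  simp [supportGraph]

@[simp] theorem not_supportGraph_adj_inl_inl {A : ι → E → K} {i j : ι} :
    ¬ (supportGraph A).Adj (.inl i) (.inl j) := by
  simp [supportGraph]

@[simp] theorem not_supportGraph_adj_inr_inr {A : ι → E → K} {e f : E} :
    ¬ (supportGraph A).Adj (.inr e) (.inr f) := by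
  simp [supportGraph]

/-- Each entry is itself a maximal minor: one column of the identity block is replaced by the column
`e`. -/
theorem sq_eq_sq_of_sq_det_eq [Fintype ι] [DecidableEq ι] {A A' : ι → E → K} {g₀ : ι → E}
    (hA : ∀ i j, A i (g₀ j) = if i = j then 1 else 0)
    (hA' : ∀ i j, A' i (g₀ j) = if i = j then 1 else 0)
    (hdet : ∀ g : ι → E, (Matrix.of fun i j => A' i (g j)).det ^ 2 =
      (Matrix.of fun i j => A i (g j)).det ^ 2) (i : ι) (e : E) : A' i e ^ 2 = A i e ^ 2 := by
  have key : ∀ {A : ι → E → K}, (∀ i j, A i (g₀ j) = if i = j then 1 else 0) →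
      (Matrix.of fun k j => A k (Function.update g₀ i e j)).det = A i e := by
    intro A hA
    have : (Matrix.of fun k j => A k (Function.update g₀ i e j)) =
        (1 : Matrix ι ι K).updateCol i (fun k => A k e) := by
      ext k j
      by_cases hj : j = i
      · subst hj; simp
      · simp [Function.update_of_ne hj, Matrix.updateCol_ne hj, hA, Matrix.one_apply]
    rw [this, ← Matrix.cramer_apply, Matrix.cramer_one]
    rfl
  rw [← key hA, ← key hA', hdet]

variable [CharZero K] [Fintype ι] [DecidableEq ι]

/-- Two matrices with the same normalisation, all of whose maximal minors agree up to signs, differ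
by signs of the rows and the columns. -/
theorem exists_signs_of_sq_det_eq {A A' : ι → E → K} {g₀ : ι → E}
    (hA : ∀ i j, A i (g₀ j) = if i = j then 1 else 0)
    (hA' : ∀ i j, A' i (g₀ j) = if i = j then 1 else 0)
    (hdet : ∀ g : ι → E, (Matrix.of fun i j => A' i (g j)).det ^ 2 =
      (Matrix.of fun i j => A i (g j)).det ^ 2) :
    ∃ (δ : ι → ℤˣ) (ε : E → ℤˣ), ∀ i e, A' i e = ((δ i : ℤ) : K) * ((ε e : ℤ) : K) * A i e := by
  classical
  have hsq := sq_eq_sq_of_sq_det_eq hA hA' hdet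
  -- The sign of the edge `{i, e}`; at zero entries it is `1`.
  let t : ι → E → ℤˣ := fun i e => if A' i e = A i e then 1 else -1
  have ht : ∀ i e, A' i e = ((t i e : ℤ) : K) * A i e := by
    intro i e
    by_cases h : A' i e = A i e
    · simp [t, h]
    · have := (sq_eq_sq_iff_eq_or_eq_neg.1 (hsq i e)).resolve_left h
      simp only [t, if_neg h]
      simp [this]
  let s : ι ⊕ E → ι ⊕ E → ℤˣ := fun u v =>
    match u, v with
    | .inl i, .inr e => t i e
    | .inr e, .inl i => t i e
    | _, _ => 1
  have hs : ∀ u v, s u v = s v u := by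
    rintro (u | u) (v | v) <;> rfl
  rcases (supportGraph A).exists_vertex_signs_or_induced_cycle s hs
    (Q := fun v => ∃ i, v = .inl i) (by
      rintro u v (⟨i, e, -, rfl, rfl⟩ | ⟨i, e, -, rfl, rfl⟩)
      · exact Or.inl ⟨i, rfl⟩
      · exact Or.inr ⟨i, rfl⟩) with ⟨ε, hε⟩ | ⟨n, x, hx0, hxn, hadj, hprod, hinj, hind⟩
  · refine ⟨fun i => ε (.inl i), fun e => ε (.inr e), fun i e => ?_⟩
    rw [ht]
    by_cases h : A i e = 0
    · simp [h]
    · have := hε (.inl i) (.inr e) (by simpa using h)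
      change t i e = _ at this
      rw [this]
      push_cast
      ring
  -- The bad cycle alternates between rows `r l` and columns `w l`. The minor on these, completed by
  -- identity columns, will contradict the equality of squares.
  exfalso
  have hleft : ∀ m ≤ n, ((∃ i, x m = .inl i) ∧ Even m) ∨ ((∃ e, x m = .inr e) ∧ ¬ Even m) := by
    intro m
    induction m with
    | zero => exact fun _ => Or.inl ⟨hx0, Even.zero⟩
    | succ m ih =>
      intro hm
      have h1 := hadj m (by omega)
      rw [Nat.even_add_one]
      rcases ih (by omega) with ⟨⟨i, hi⟩, h⟩ | ⟨⟨i, hi⟩, h⟩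
      · rw [hi] at h1
        rcases hx : x (m + 1) with j | j
        · simp [hx] at h1
        · exact Or.inr ⟨⟨j, rfl⟩, not_not.2 h⟩
      · rw [hi] at h1
        rcases hx : x (m + 1) with j | j
        · exact Or.inl ⟨⟨j, rfl⟩, h⟩
        · simp [hx] at h1
  obtain ⟨k, rfl⟩ : ∃ k, n = 2 * k := by
    obtain ⟨i, hi⟩ := hx0
    rcases hleft n le_rfl with ⟨-, h⟩ | ⟨⟨e, he⟩, -⟩
    · exact even_iff_exists_two_mul.1 h
    · rw [hxn, hi] at he
      cases he
  -- Outside the cycle the chosen indices are arbitrary.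
  have hrex : ∀ l, ∃ i, l ≤ k → x (2 * l) = .inl i := by
    intro l
    by_cases hl : l ≤ k
    · rcases hleft (2 * l) (by omega) with ⟨⟨i, hi⟩, -⟩ | ⟨-, h⟩
      · exact ⟨i, fun _ => hi⟩
      · exact absurd (even_two_mul l) h
    · obtain ⟨i, -⟩ := hx0
      exact ⟨i, fun h => absurd h hl⟩
  choose r hr using hrex
  have hcex : ∀ l, ∃ e, l < k → x (2 * l + 1) = .inr e := by
    intro l
    by_cases hl : l < k
    · rcases hleft (2 * l + 1) (by omega) with ⟨-, h⟩ | ⟨⟨i, hi⟩, -⟩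
      · exact absurd h (by simp)
      · exact ⟨i, fun _ => hi⟩
    · obtain ⟨i, -⟩ := hx0
      exact ⟨g₀ i, fun h => absurd h hl⟩
  choose w hw using hcex
  have hA1 : ∀ l < k, A (r l) (w l) ≠ 0 := fun l hl => by
    have := hadj (2 * l) (by omega)
    rwa [hr l hl.le, hw l hl, supportGraph_adj_inl_inr] at this
  have hA2 : ∀ l < k, A (r (l + 1)) (w l) ≠ 0 := fun l hl => by
    have := hadj (2 * l + 1) (by omega)
    rwa [hw l hl, show 2 * l + 1 + 1 = 2 * (l + 1) by ring, hr (l + 1) hl,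
      supportGraph_adj_inr_inl] at this
  have hprod' : ∏ l ∈ Finset.range k, (t (r l) (w l) * t (r (l + 1)) (w l)) = -1 := by
    have : ∀ m ≤ k, ∏ l ∈ Finset.range m, (t (r l) (w l) * t (r (l + 1)) (w l)) =
        ∏ i ∈ Finset.range (2 * m), s (x i) (x (i + 1)) := by
      intro m
      induction m with
      | zero => intro _; simp
      | succ m ih =>
        intro hm
        rw [Finset.prod_range_succ, ih (by omega), show 2 * (m + 1) = 2 * m + 1 + 1 by ring,
          Finset.prod_range_succ, Finset.prod_range_succ, mul_assoc, hr m (by omega), hw m hm,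
          show 2 * m + 1 + 1 = 2 * (m + 1) by ring, hr (m + 1) hm]
    rw [this k le_rfl, hprod]
  have hrk : r k = r 0 := by
    have := hr k le_rfl
    rw [hxn, show 0 = 2 * 0 from rfl, hr 0 (Nat.zero_le k)] at this
    exact (Sum.inl.inj this).symm
  -- For `k = 1` the cycle runs back along its own edge, with product a square.
  have hk : 2 ≤ k := by
    by_contra h
    have : k = 0 ∨ k = 1 := by omega
    rcases this with rfl | rfl
    · simp at hprod'
    · simp only [Finset.prod_range_one, zero_add, hrk, Int.units_mul_self] at hprod'
      exact absurd hprod' (by decide)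
  have hrinj : ∀ l m, l < m → m < k → r l ≠ r m := fun l m hlm hm h =>
    hinj (2 * l) (2 * m) (by omega) (by omega) (by rw [hr l (by omega), hr m hm.le, h])
  obtain ⟨c, hc, hcr, hcs⟩ := exists_isCycle_of_sequence hk hrk hrinj
  have hrinj' : ∀ l m, l < k → m < k → r l = r m → l = m := fun l m hl hm h => by
    rcases lt_trichotomy l m with h1 | h1 | h1
    · exact absurd h (hrinj l m h1 hm)
    · exact h1
    · exact absurd h.symm (hrinj m l h1 hl)
  -- Row `r l` is paired with the column `w l`, and every row off the cycle with its own identity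
  -- column.
  let g : ι → E := fun i => if h : ∃ l < k, r l = i then w h.choose else g₀ i
  have hgr : ∀ l < k, g (r l) = w l := by
    intro l hl
    have h : ∃ m < k, r m = r l := ⟨l, hl, rfl⟩
    simp only [g, dif_pos h]
    rw [hrinj' _ _ h.choose_spec.1 hl h.choose_spec.2]
  have hg0 : ∀ i, c i = i → g i = g₀ i := fun i hi =>
    dif_neg fun h => (hcs i).2 h hi
  have hPQ := prod_mul_prod_eq_of_sq_det_eq (M := Matrix.of fun i j => A i (g j))
    (M' := Matrix.of fun i j => A' i (g j)) hc
    (fun i j hj h => by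
      rw [Matrix.of_apply, hg0 j hj, hA] at h
      by_contra hij
      exact h (if_neg hij))
    -- There are no chords: a nonzero entry in row `r l` and column `w m` forces `l = m` or `l = m +
    -- 1` modulo `k`.
    (fun i j hi hj h => by
      obtain ⟨l, hl, rfl⟩ := (hcs i).1 hi
      obtain ⟨m, hm, rfl⟩ := (hcs j).1 hj
      rw [Matrix.of_apply, hgr m hm, ← supportGraph_adj_inl_inr, ← hr l hl.le, ← hw m hm] at h
      rw [hcr m hm]
      rcases Nat.lt_or_ge (2 * l) (2 * m + 1) with h1 | h1
      · rcases hind _ _ h1 (by omega) h with h2 | h2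
        · left
          congr 1
          omega
        · right
          rw [show m + 1 = k by omega, show l = 0 by omega, hrk]
      · rcases hind _ _ (show 2 * m + 1 < 2 * l by omega) (by omega) h.symm with h2 | h2
        · right
          congr 1
          omega
        · omega)
    (fun i j => hsq i (g j)) (hdet g)
  simp only [Matrix.of_apply, ht] at hPQ
  have hne1 : ∀ i, A i (g i) ≠ 0 := by
    intro i
    by_cases hi : c i = i
    · simp [hg0 i hi, hA]
    · obtain ⟨l, hl, rfl⟩ := (hcs i).1 hi
      rw [hgr l hl]
      exact hA1 l hl
  have hne2 : ∀ i, A (c i) (g i) ≠ 0 := by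
    intro i
    by_cases hi : c i = i
    · rw [hi]
      exact hne1 i
    · obtain ⟨l, hl, rfl⟩ := (hcs i).1 hi
      rw [hgr l hl, hcr l hl]
      exact hA2 l hl
  have hne : (∏ i, A i (g i)) * ∏ i, A (c i) (g i) ≠ 0 :=
    mul_ne_zero (Finset.prod_ne_zero_iff.2 fun i _ => hne1 i)
      (Finset.prod_ne_zero_iff.2 fun i _ => hne2 i)
  -- Rows off the cycle contribute squares, so the total sign is that of the cycle; the products
  -- `PQ` and `P'Q'` are opposite as well as equal, and nonzero.
  have hone : ∏ i, (t i (g i) * t (c i) (g i)) = -1 := by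
    have hcongr : ∏ l ∈ Finset.range k, (t (r l) (w l) * t (r (l + 1)) (w l)) =
        ∏ l ∈ Finset.range k, (t (r l) (g (r l)) * t (c (r l)) (g (r l))) :=
      Finset.prod_congr rfl fun l hl => by
        rw [Finset.mem_range] at hl
        rw [hgr l hl, hcr l hl]
    rw [← hprod', hcongr, ← Finset.prod_image (s := Finset.range k) (g := r)
      (f := fun i => t i (g i) * t (c i) (g i))]
    · refine (Finset.prod_subset (Finset.subset_univ _) fun i _ hi => ?_).symm
      have : c i = i := by
        by_contra h
        obtain ⟨l, hl, rfl⟩ := (hcs i).1 h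
        exact hi (Finset.mem_image_of_mem r (Finset.mem_range.2 hl))
      rw [this, Int.units_mul_self]
    · intro a ha b hb hab
      exact hrinj' a b (by simpa using ha) (by simpa using hb) hab
  have hone' := congrArg (fun u : ℤˣ => ((u : ℤ) : K)) hone
  simp only [Units.coe_prod, Units.val_mul, Int.cast_prod, Int.cast_mul, Units.val_neg,
    Units.val_one, Int.cast_neg, Int.cast_one, Finset.prod_mul_distrib] at hone'
  rw [Finset.prod_mul_distrib, Finset.prod_mul_distrib] at hPQ
  have h2 : (2 : K) * ((∏ i, A i (g i)) * ∏ i, A (c i) (g i)) = 0 := by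
    linear_combination (∏ i, A i (g i)) * (∏ i, A (c i) (g i)) * hone' - hPQ
  exact hne ((mul_eq_zero.1 h2).resolve_left two_ne_zero)

/-- Families of vectors all of whose maximal minors agree up to signs have the same linear
relations after a change of signs. -/
theorem exists_signs_relations {W W' : E → ι → K} {g₀ : ι → E}
    (h₀ : (Matrix.of fun i j => W (g₀ j) i).det ≠ 0)
    (hdet : ∀ g : ι → E, (Matrix.of fun i j => W' (g j) i).det ^ 2 =
      (Matrix.of fun i j => W (g j) i).det ^ 2) :
    ∃ ε : E → ℤˣ, ∀ n : E →₀ ℤ,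
      (n.sum fun e m => (m : K) • W e) = 0 ↔
        (n.sum fun e m => (m : K) • (((ε e : ℤ) : K) • W' e)) = 0 := by
  set M := Matrix.of fun i j => W (g₀ j) i with hM
  set M' := Matrix.of fun i j => W' (g₀ j) i with hM'
  have h₀' : M'.det ≠ 0 := fun h => h₀ (by
    have := hdet g₀
    rw [← hM, ← hM', h, zero_pow two_ne_zero] at this
    exact pow_eq_zero_iff two_ne_zero |>.1 this.symm)
  -- Multiplying by the inverse of the `g₀` block normalises the family and divides all maximal
  -- minors by one determinant, whose square is the same on both sides.
  have key : ∀ {M : Matrix ι ι K} {W : E → ι → K}, M = Matrix.of (fun i j => W (g₀ j) i) →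
      M.det ≠ 0 → (∀ i j, (M⁻¹.mulVec (W (g₀ j))) i = if i = j then 1 else 0) ∧
      ∀ g : ι → E, (Matrix.of fun i j => (M⁻¹.mulVec (W (g j))) i).det =
        M.det⁻¹ * (Matrix.of fun i j => W (g j) i).det := by
    intro M W hM h
    have hmul : ∀ g : ι → E, (Matrix.of fun i j => (M⁻¹.mulVec (W (g j))) i) =
        M⁻¹ * Matrix.of fun i j => W (g j) i := fun g => by
      ext i j
      rfl
    refine ⟨fun i j => ?_, fun g => ?_⟩
    · have := congrFun (congrFun (hmul g₀) i) j
      rw [← hM, Matrix.nonsing_inv_mul _ (isUnit_iff_ne_zero.2 h), Matrix.one_apply] at this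
      exact this
    · rw [hmul, Matrix.det_mul, Matrix.det_nonsing_inv, Ring.inverse_eq_inv]
  obtain ⟨hA, hAd⟩ := key hM h₀
  obtain ⟨hA', hAd'⟩ := key hM' h₀'
  obtain ⟨δ, ε, hδε⟩ := exists_signs_of_sq_det_eq (A := fun i e => (M⁻¹.mulVec (W e)) i)
    (A' := fun i e => (M'⁻¹.mulVec (W' e)) i) (g₀ := g₀) hA hA' fun g => by
      rw [hAd, hAd', mul_pow, mul_pow, hdet, inv_pow, inv_pow, hdet g₀]
  refine ⟨ε, fun n => ?_⟩
  have hinj : ∀ {M : Matrix ι ι K}, M.det ≠ 0 → ∀ v, v = 0 ↔ M⁻¹.mulVec v = 0 := by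
    intro M h v
    refine ⟨fun h => by rw [h, Matrix.mulVec_zero], fun h' => ?_⟩
    have := congrArg M.mulVec h'
    rwa [Matrix.mulVec_mulVec, Matrix.mul_nonsing_inv _ (isUnit_iff_ne_zero.2 h),
      Matrix.one_mulVec, Matrix.mulVec_zero] at this
  rw [hinj h₀ (n.sum fun e m => (m : K) • W e),
    hinj h₀' (n.sum fun e m => (m : K) • (((ε e : ℤ) : K) • W' e)), funext_iff, funext_iff]
  refine forall_congr' fun i => ?_
  have hsum : ∀ {M : Matrix ι ι K} (f : E → ι → K),
      M⁻¹.mulVec (n.sum fun e m => (m : K) • f e) i =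
        n.sum fun e m => (m : K) * (M⁻¹.mulVec (f e)) i := by
    intro M f
    have h1 := map_finsuppSum (M⁻¹.mulVecLin) n (fun e m => (m : K) • f e)
    rw [Matrix.mulVecLin_apply] at h1
    rw [h1, Finsupp.sum, Finsupp.sum, Finset.sum_apply]
    refine Finset.sum_congr rfl fun e _ => ?_
    rw [map_smul, Matrix.mulVecLin_apply, Pi.smul_apply, smul_eq_mul]
  rw [hsum, hsum (M := M')]
  have hδ : ((δ i : ℤ) : K) ≠ 0 := Int.cast_ne_zero.2 (Units.ne_zero _)
  -- The column signs cancel in pairs, and the row sign is a common factor that does not affect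
  -- vanishing.
  have : (n.sum fun e m => (m : K) * (M'⁻¹.mulVec (((ε e : ℤ) : K) • W' e)) i) =
      ((δ i : ℤ) : K) * n.sum fun e m => (m : K) * (M⁻¹.mulVec (W e)) i := by
    rw [Finsupp.sum, Finsupp.sum, Finset.mul_sum]
    refine Finset.sum_congr rfl fun e _ => ?_
    have h1 := hδε i e
    have h2 : ((ε e : ℤ) : K) * ((ε e : ℤ) : K) = 1 := by
      rw [← Int.cast_mul, ← Units.val_mul, Int.units_mul_self, Units.val_one, Int.cast_one]
    rw [Matrix.mulVec_smul, Pi.smul_apply, smul_eq_mul, h1]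
    linear_combination (n e : K) * (δ i : ℤ) * (M⁻¹.mulVec (W e)) i * h2
  rw [this]
  simp [hδ]

end Rigidity
end

noncomputable section

/-! ### The data determined by the poset of layers -/

namespace ToricArrangement

variable {Λ Λ' E : Type} [AddCommGroup Λ] [AddCommGroup Λ'] {Δ : ToricArrangement Λ E}
  {Δ' : ToricArrangement Λ' E} {S : Set E}

/-- The layer of `Δ.inter S` through one of its points. -/
def layerAt (Δ : ToricArrangement Λ E) (S : Set E) (t : Δ.inter S) : Δ.Layer :=
  ⟨connectedComponentIn (Δ.inter S) t, S, t, t.2, rfl⟩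

theorem layerAt_eq_layerAt_iff {t u : Δ.inter S} :
    Δ.layerAt S t = Δ.layerAt S u ↔ (t : ConnectedComponents (Δ.inter S)) = u := by
  rw [ConnectedComponents.coe_eq_coe, ← (Set.image_injective.2 Subtype.val_injective).eq_iff,
    ← connectedComponentIn_eq_image t.2, ← connectedComponentIn_eq_image u.2]
  exact Subtype.ext_iff

/-- A layer is contained in the hypertori indexed by `S`. -/
def Layer.Inside (S : Set E) (W : Δ.Layer) : Prop := ∀ e ∈ S, W.1 ⊆ Δ.hypertorus e

theorem Layer.le_iff {W W' : Δ.Layer} : W ≤ W' ↔ W'.1 ⊆ W.1 := Iff.rfl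

theorem Layer.isPreconnected (W : Δ.Layer) : IsPreconnected W.1 := by
  obtain ⟨_, S, t, ht, rfl⟩ := W
  exact isPreconnected_connectedComponentIn

theorem Layer.nonempty (W : Δ.Layer) : W.1.Nonempty := by
  obtain ⟨_, S, t, ht, rfl⟩ := W
  exact ⟨t, mem_connectedComponentIn ht⟩

theorem Layer.Inside.subset_inter {W : Δ.Layer} (h : W.Inside S) : W.1 ⊆ Δ.inter S :=
  fun _ ht e he => h e he ht

theorem layerAt_inside (t : Δ.inter S) : (Δ.layerAt S t).Inside S := fun e he _ hu =>
  connectedComponentIn_subset _ _ hu e he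

theorem layerAt_le {W : Δ.Layer} (h : W.Inside S) {t : Δ.inter S} (ht : t.1 ∈ W.1) :
    Δ.layerAt S t ≤ W :=
  Layer.le_iff.2 (W.isPreconnected.subset_connectedComponentIn ht h.subset_inter)

/-- The components of `Δ.inter S` are the minimal layers inside the hypertori indexed by `S`. -/
theorem minimal_inside_iff {W : Δ.Layer} :
    Minimal (Layer.Inside S) W ↔ ∃ t : Δ.inter S, Δ.layerAt S t = W := by
  constructor
  · intro h
    obtain ⟨t, ht⟩ := W.nonempty
    refine ⟨⟨t, h.prop.subset_inter ht⟩, ?_⟩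
    have hle := layerAt_le (t := ⟨t, h.prop.subset_inter ht⟩) h.prop ht
    exact le_antisymm hle (h.le_of_le (layerAt_inside _) hle)
  · rintro ⟨t, rfl⟩
    exact ⟨layerAt_inside t, fun W hW hle =>
      layerAt_le hW (Layer.le_iff.1 hle (mem_connectedComponentIn t.2))⟩

/-- This expresses the multiplicity by the order and the incidence with the hypertori alone. -/
theorem mult_eq_card_minimal (Δ : ToricArrangement Λ E) (S : Set E) :
    Δ.mult S = Nat.card {W : Δ.Layer // Minimal (Layer.Inside S) W} := by
  have hout : ∀ c : ConnectedComponents (Δ.inter S), ∃ t : Δ.inter S,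
      (t : ConnectedComponents (Δ.inter S)) = c := ConnectedComponents.surjective_coe
  choose out hout using hout
  refine Nat.card_eq_of_bijective
    (fun c => ⟨Δ.layerAt S (out c), minimal_inside_iff.2 ⟨_, rfl⟩⟩) ⟨fun c d h => ?_, ?_⟩
  · rw [← hout c, ← hout d, layerAt_eq_layerAt_iff.1 (congrArg Subtype.val h)]
  · rintro ⟨W, hW⟩
    obtain ⟨t, rfl⟩ := minimal_inside_iff.1 hW
    exact ⟨t, Subtype.ext (layerAt_eq_layerAt_iff.2 (hout _))⟩

theorem IsCentred.mem_hypertorus (h : Δ.IsCentred) {e : E} {t : AlgTorus Λ} :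
    t ∈ Δ.hypertorus e ↔ torusChar (Δ.χ e) t = 1 := by
  rw [ToricArrangement.mem_hypertorus, h, inv_one]

theorem IsCentred.one_mem_inter (h : Δ.IsCentred) : 1 ∈ Δ.inter S := fun _ _ =>
  h.mem_hypertorus.2 (map_one _)

theorem IsCentred.mult_eq [Module.Finite ℤ Λ] (h : Δ.IsCentred) (S : Set E) :
    Δ.mult S = radIndex (Δ.subSpan S) := mult_eq_radIndex ⟨1, h.one_mem_inter⟩

theorem mem_layerAt [Module.Finite ℤ Λ] {t : Δ.inter S} {u : AlgTorus Λ} :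
    u ∈ (Δ.layerAt S t).1 ↔ ∀ x ∈ radical (Δ.subSpan S), torusChar x u = torusChar x t.1 := by
  change u ∈ connectedComponentIn (Δ.inter S) t ↔ _
  rw [AlgTorus.connectedComponentIn_eq (mem_inter_iff t.2), Set.mem_ofPred_eq]

/-- Rational dependence is visible in the poset. If `χ_e` is `1` on one component, it is trivial on
the annihilator of which that component is a coset; conversely the component through `1` serves. -/
theorem IsCentred.mem_radical_subSpan_iff [Module.Finite ℤ Λ] (h : Δ.IsCentred) {e : E} :
    Δ.χ e ∈ radical (Δ.subSpan S) ↔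
      ∃ W : Δ.Layer, Minimal (Layer.Inside S) W ∧ W.1 ⊆ Δ.hypertorus e := by
  constructor
  · intro he
    refine ⟨_, minimal_inside_iff.2 ⟨⟨1, h.one_mem_inter⟩, rfl⟩, fun u hu => ?_⟩
    rw [h.mem_hypertorus, mem_layerAt.1 hu _ he, map_one]
  · rintro ⟨W, hW, hWe⟩
    obtain ⟨t, rfl⟩ := minimal_inside_iff.1 hW
    refine AlgTorus.mem_of_forall_torusChar_eq_one fun u hu => ?_
    have h1 := h.mem_hypertorus.1 (hWe (mem_layerAt.2 fun _ _ => rfl))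
    have h2 := h.mem_hypertorus.1 (hWe (mem_layerAt.2 fun x hx =>
      show torusChar x (u * t.1) = _ by rw [map_mul, hu x hx, one_mul]))
    rwa [map_mul, h1, mul_one] at h2

theorem minimal_inside_apply_iff {f : Δ.Layer ≃o Δ'.Layer}
    (hf : ∀ (e : E) (W : Δ.Layer), W.1 ⊆ Δ.hypertorus e ↔ (f W).1 ⊆ Δ'.hypertorus e)
    {W : Δ.Layer} : Minimal (Layer.Inside S) (f W) ↔ Minimal (Layer.Inside S) W := by
  have hin : ∀ W, Layer.Inside S W ↔ Layer.Inside S (f W) := fun W =>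
    forall₂_congr fun e _ => hf e W
  rw [Minimal, Minimal, ← hin]
  refine and_congr_right fun _ => ⟨fun h V hV hle => ?_, fun h V hV hle => ?_⟩
  · exact f.le_iff_le.1 (h ((hin V).1 hV) (f.le_iff_le.2 hle))
  · obtain ⟨V, rfl⟩ := f.surjective V
    exact f.le_iff_le.2 (h ((hin V).2 hV) (f.le_iff_le.1 hle))

theorem SameLayerPoset.mult_eq (h : Δ.SameLayerPoset Δ') (S : Set E) :
    Δ.mult S = Δ'.mult S := by
  obtain ⟨f, hf⟩ := h
  rw [mult_eq_card_minimal, mult_eq_card_minimal]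
  exact Nat.card_congr (f.toEquiv.subtypeEquiv fun W => (minimal_inside_apply_iff hf).symm)

theorem SameLayerPoset.mem_radical_subSpan_iff [Module.Finite ℤ Λ] [Module.Finite ℤ Λ']
    (h : Δ.SameLayerPoset Δ') (hΔ : Δ.IsCentred) (hΔ' : Δ'.IsCentred) {e : E} :
    Δ.χ e ∈ radical (Δ.subSpan S) ↔ Δ'.χ e ∈ radical (Δ'.subSpan S) := by
  rw [hΔ.mem_radical_subSpan_iff, hΔ'.mem_radical_subSpan_iff]
  obtain ⟨f, hf⟩ := h
  exact f.toEquiv.exists_congr fun W =>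
    and_congr (minimal_inside_apply_iff hf).symm (hf e W)

theorem SameLayerPoset.radIndex_eq [Module.Finite ℤ Λ] [Module.Finite ℤ Λ']
    (h : Δ.SameLayerPoset Δ') (hΔ : Δ.IsCentred) (hΔ' : Δ'.IsCentred) (S : Set E) :
    radIndex (Δ.subSpan S) = radIndex (Δ'.subSpan S) := by
  rw [← hΔ.mult_eq, ← hΔ'.mult_eq, h.mult_eq]

end ToricArrangement
end

noncomputable section

/-! ### The characters up to signs -/

theorem finrank_radical {Λ : Type} [AddCommGroup Λ] [Module.Free ℤ Λ] [Module.Finite ℤ Λ]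
    (N : Submodule ℤ Λ) : Module.finrank ℤ (radical N) = Module.finrank ℤ N := by
  rw [← (Submodule.submoduleOfEquivOfLe (le_radical N)).finrank_eq]
  have h : Nat.card (radical N ⧸ N.submoduleOf (radical N)) = radIndex N := rfl
  have : Finite (radical N ⧸ N.submoduleOf (radical N)) :=
    Nat.finite_of_card_ne_zero (h ▸ radIndex_ne_zero N)
  exact ((Submodule.finiteQuotient_iff _).1 this).symm

namespace ToricArrangement

variable {Λ Λ' E : Type} [AddCommGroup Λ] [AddCommGroup Λ'] {Δ : ToricArrangement Λ E}
  {Δ' : ToricArrangement Λ' E}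

theorem χ_mem_radical (Δ : ToricArrangement Λ E) (e : E) : Δ.χ e ∈ radical Δ.charSpan :=
  le_radical _ (Submodule.subset_span ⟨e, rfl⟩)

/-- Every character has a multiple in the lattice generated by the characters indexed by `S`. -/
def Spans (Δ : ToricArrangement Λ E) (S : Set E) : Prop := ∀ e, Δ.χ e ∈ radical (Δ.subSpan S)

theorem subSpan_le_charSpan (S : Set E) : Δ.subSpan S ≤ Δ.charSpan :=
  Submodule.span_mono (Set.image_subset_range _ _)

theorem Spans.radical_eq {S : Set E} (h : Δ.Spans S) :
    radical (Δ.subSpan S) = radical Δ.charSpan := by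
  refine le_antisymm (radical_mono (subSpan_le_charSpan S)) ?_
  rw [← radical_radical (Δ.subSpan S)]
  refine radical_mono (Submodule.span_le.2 ?_)
  rintro _ ⟨e, rfl⟩
  exact h e

theorem subSpan_range {ι : Type} (g : ι → E) :
    Δ.subSpan (Set.range g) = Submodule.span ℤ (Set.range (Δ.χ ∘ g)) := by
  rw [subSpan, Set.range_comp]

theorem SameLayerPoset.spans_iff [Module.Finite ℤ Λ] [Module.Finite ℤ Λ']
    (h : Δ.SameLayerPoset Δ') (hΔ : Δ.IsCentred) (hΔ' : Δ'.IsCentred) {S : Set E} :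
    Δ.Spans S ↔ Δ'.Spans S :=
  forall_congr' fun _ => h.mem_radical_subSpan_iff hΔ hΔ'

section

variable [Module.Free ℤ Λ] [Module.Finite ℤ Λ] [Module.Free ℤ Λ'] [Module.Finite ℤ Λ']

theorem Spans.finrank_eq {S : Set E} (h : Δ.Spans S) :
    Module.finrank ℤ (Δ.subSpan S) = Module.finrank ℤ (radical Δ.charSpan) := by
  rw [← finrank_radical, h.radical_eq]

theorem Spans.finrank_le {ι : Type} [Fintype ι] {g : ι → E} (h : Δ.Spans (Set.range g)) :
    Module.finrank ℤ (radical Δ.charSpan) ≤ Fintype.card ι := by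
  rw [← h.finrank_eq, subSpan_range]
  exact finrank_range_le_card _

/-- A maximal independent set of characters, enumerated; its size is the rank. -/
theorem exists_spans [Finite E] (Δ : ToricArrangement Λ E) :
    ∃ g : Fin (Module.finrank ℤ (radical Δ.charSpan)) → E, Δ.Spans (Set.range g) := by
  obtain ⟨S, hS, hmax⟩ := exists_maximal_linearIndepOn ℤ Δ.χ
  have hspan : Δ.Spans S := by
    intro e
    by_cases he : e ∈ S
    · exact le_radical _ (Submodule.subset_span ⟨e, he, rfl⟩)
    · obtain ⟨a, ha, h⟩ := hmax e he
      exact mem_radical.2 ⟨a, ha, h⟩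
  have := Fintype.ofFinite S
  have hcard : Fintype.card S = Module.finrank ℤ (radical Δ.charSpan) := by
    rw [← hspan.finrank_eq, subSpan, Set.image_eq_range]
    exact (finrank_span_eq_card hS).symm
  let f := (Fintype.equivFinOfCardEq hcard).symm
  refine ⟨fun i => f i, ?_⟩
  have hr : Set.range (fun i => (f i : E)) = S := by
    rw [Set.range_comp' (fun x : S => (x : E)) f, f.surjective.range_eq, Set.image_univ,
      Subtype.range_coe]
  rwa [hr]



theorem SameLayerPoset.finrank_eq [Finite E] (h : Δ.SameLayerPoset Δ') (hΔ : Δ.IsCentred)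
    (hΔ' : Δ'.IsCentred) :
    Module.finrank ℤ (radical Δ.charSpan) = Module.finrank ℤ (radical Δ'.charSpan) := by
  obtain ⟨g, hg⟩ := Δ.exists_spans
  obtain ⟨g', hg'⟩ := Δ'.exists_spans
  have h1 := ((h.spans_iff hΔ hΔ').1 hg).finrank_le
  have h2 := ((h.spans_iff hΔ hΔ').2 hg').finrank_le
  rw [Fintype.card_fin] at h1 h2
  exact le_antisymm h2 h1

end

section

variable {ι : Type} [Fintype ι] (b : Module.Basis ι ℤ (radical Δ.charSpan))

/-- The coordinates of the characters. -/
def coord (e : E) (i : ι) : ℤ := b.repr ⟨Δ.χ e, Δ.χ_mem_radical e⟩ i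

theorem sum_coord_smul (e : E) : ∑ i, coord b e i • (b i : Λ) = Δ.χ e := by
  refine Eq.trans ?_ (congrArg Subtype.val (b.sum_repr ⟨Δ.χ e, Δ.χ_mem_radical e⟩))
  rw [Submodule.coe_sum]
  rfl

/-- The adjugate writes `det` times each basis vector as an integral combination of the selected
characters. -/
theorem spans_of_det_ne_zero [DecidableEq ι] {g : ι → E} (h : (Matrix.of fun i j => coord b (g j) i).det ≠ 0) :
    Δ.Spans (Set.range g) := by
  set M := Matrix.of fun i j => coord b (g j) i with hM
  have hb : ∀ k, M.det • (b k : Λ) ∈ Δ.subSpan (Set.range g) := by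
    intro k
    have h1 : ∑ j, M.adjugate j k • Δ.χ (g j) = M.det • (b k : Λ) := by
      simp_rw [← sum_coord_smul b, Finset.smul_sum, smul_smul]
      rw [Finset.sum_comm]
      simp_rw [← Finset.sum_smul]
      have h2 : ∀ i, ∑ j, M.adjugate j k * coord b (g j) i = if i = k then M.det else 0 := by
        intro i
        have := congrFun (congrFun (Matrix.mul_adjugate M) i) k
        rw [Matrix.mul_apply, Matrix.smul_apply, Matrix.one_apply, smul_eq_mul, mul_ite, mul_one,
          mul_zero] at this
        rw [← this]
        exact Finset.sum_congr rfl fun j _ => mul_comm _ _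
      simp_rw [h2]
      simp
    rw [← h1]
    exact Submodule.sum_mem _ fun j _ => Submodule.smul_mem _ _
      (Submodule.subset_span ⟨g j, ⟨j, rfl⟩, rfl⟩)
  intro e
  refine mem_radical.2 ⟨M.det, h, ?_⟩
  rw [← sum_coord_smul b, Finset.smul_sum]
  refine Submodule.sum_mem _ fun i _ => ?_
  rw [smul_comm]
  exact Submodule.smul_mem _ _ (hb i)

/-- The absolute value of the minor is the index of the selected sublattice in its saturation, which
for a centred arrangement is a multiplicity. -/
theorem Spans.natAbs_det [DecidableEq ι] [Module.Free ℤ Λ] [Module.Finite ℤ Λ] {g : ι → E}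
    (h : Δ.Spans (Set.range g)) :
    (Matrix.of fun i j => coord b (g j) i).det.natAbs = radIndex (Δ.subSpan (Set.range g)) := by
  have hli : LinearIndependent ℤ (Δ.χ ∘ g) := by
    rw [linearIndependent_iff_card_eq_finrank_span, Set.finrank, ← subSpan_range, h.finrank_eq,
      Module.finrank_eq_card_basis b]
  have hle : (Submodule.span ℤ (Set.range (Δ.χ ∘ g))).toAddSubgroup ≤
      (radical Δ.charSpan).toAddSubgroup := by
    rw [← h.radical_eq, subSpan_range]
    exact le_radical _
  have := AddSubgroup.relIndex_eq_natAbs_det _ _ hle (Module.Basis.span hli) b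
  rw [radIndex, h.radical_eq, subSpan_range, this]
  change _ = (b.det fun j => (⟨(Module.Basis.span hli j : Λ),
    hle (Module.Basis.span hli j).2⟩ : radical Δ.charSpan)).natAbs
  rw [Module.Basis.det_apply]
  congr 2
  ext i j
  rw [Module.Basis.toMatrix_apply, Matrix.of_apply, coord]
  congr 3
  exact (congrArg Subtype.val (Module.Basis.span_apply hli j)).symm

end

theorem SameLayerPoset.sq_det_eq [Module.Free ℤ Λ] [Module.Finite ℤ Λ] [Module.Free ℤ Λ']
    [Module.Finite ℤ Λ'] {ι : Type} [Fintype ι] [DecidableEq ι] (h : Δ.SameLayerPoset Δ')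
    (hΔ : Δ.IsCentred) (hΔ' : Δ'.IsCentred) (b : Module.Basis ι ℤ (radical Δ.charSpan))
    (b' : Module.Basis ι ℤ (radical Δ'.charSpan)) (g : ι → E) :
    (Matrix.of fun i j => coord b' (g j) i).det ^ 2 =
      (Matrix.of fun i j => coord b (g j) i).det ^ 2 := by
  by_cases hg : Δ.Spans (Set.range g)
  · rw [← Int.natAbs_sq, ← Int.natAbs_sq (Matrix.det _), hg.natAbs_det,
      ((h.spans_iff hΔ hΔ').1 hg).natAbs_det, h.radIndex_eq hΔ hΔ']
  · have h1 := not_imp_comm.1 (spans_of_det_ne_zero b) hg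
    have h2 := not_imp_comm.1 (spans_of_det_ne_zero b') (mt (h.spans_iff hΔ hΔ').2 hg)
    rw [h1, h2]

/-- Passes between integral relations of signed characters and relations of their rational
coordinate vectors, to which `exists_signs_relations` applies. -/
theorem sum_coord_eq_zero_iff {ι : Type} [Fintype ι] (b : Module.Basis ι ℤ (radical Δ.charSpan))
    (ε : E → ℤˣ) (n : E →₀ ℤ) :
    (n.sum fun e m => (m : ℚ) • (((ε e : ℤ) : ℚ) • fun i => (coord b e i : ℚ))) = 0 ↔
      Finsupp.linearCombination ℤ (fun e => (ε e : ℤ) • Δ.χ e) n = 0 := by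
  have h1 : Finsupp.linearCombination ℤ (fun e => (ε e : ℤ) • Δ.χ e) n =
      (n.sum fun e m => m • (ε e : ℤ) • (⟨Δ.χ e, Δ.χ_mem_radical e⟩ : radical Δ.charSpan) :
        radical Δ.charSpan) := by
    rw [Finsupp.linearCombination_apply, Finsupp.sum, Finsupp.sum, Submodule.coe_sum]
    rfl
  rw [h1, Submodule.coe_eq_zero, ← b.forall_coord_eq_zero_iff, funext_iff]
  refine forall_congr' fun i => ?_
  rw [Module.Basis.coord_apply, ← Module.Basis.coord_apply, map_finsuppSum, Finsupp.sum,
    Finsupp.sum, Finset.sum_apply, ← Int.cast_eq_zero (α := ℚ), Int.cast_sum]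
  refine iff_of_eq (congrArg (· = 0) (Finset.sum_congr rfl fun e _ => ?_))
  rw [map_smul, map_smul]
  change (n e : ℚ) * ((ε e : ℤ) * (coord b e i : ℚ)) = ((n e * (ε e * coord b e i) : ℤ) : ℚ)
  push_cast
  rfl

/-- Families with the same relations span isomorphic submodules. -/
theorem exists_equiv_of_relations {M M' : Type} [AddCommGroup M] [AddCommGroup M'] {v : E → M}
    {v' : E → M'} (h : ∀ n : E →₀ ℤ,
      Finsupp.linearCombination ℤ v n = 0 ↔ Finsupp.linearCombination ℤ v' n = 0) :
    ∃ φ : Submodule.span ℤ (Set.range v) ≃ₗ[ℤ] Submodule.span ℤ (Set.range v'),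
      ∀ e (he : v e ∈ Submodule.span ℤ (Set.range v)), (φ ⟨v e, he⟩ : M') = v' e := by
  have hker : LinearMap.ker (Finsupp.linearCombination ℤ v) =
      LinearMap.ker (Finsupp.linearCombination ℤ v') := Submodule.ext h
  let e₁ := (LinearEquiv.ofEq _ _ (Finsupp.range_linearCombination ℤ (v := v))).symm.trans
    (Finsupp.linearCombination ℤ v).quotKerEquivRange.symm
  let e₂ := (Finsupp.linearCombination ℤ v').quotKerEquivRange.trans
    (LinearEquiv.ofEq _ _ (Finsupp.range_linearCombination ℤ (v := v')))
  refine ⟨(e₁.trans (Submodule.quotEquivOfEq _ _ hker)).trans e₂, fun e he => ?_⟩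
  have : e₁ ⟨v e, he⟩ = Submodule.Quotient.mk (Finsupp.single e 1) := by
    rw [← LinearEquiv.eq_symm_apply]
    refine Subtype.ext ?_
    change v e = Finsupp.linearCombination ℤ v (Finsupp.single e 1)
    simp
  change ((e₂ (Submodule.quotEquivOfEq _ _ hker (e₁ ⟨v e, he⟩)) :
    Submodule.span ℤ (Set.range v')) : M') = v' e
  rw [this]
  change Finsupp.linearCombination ℤ v' (Finsupp.single e 1) = v' e
  simp

theorem exists_equiv_of_sign_relations {ε : E → ℤˣ} (h : ∀ n : E →₀ ℤ,
    Finsupp.linearCombination ℤ Δ.χ n = 0 ↔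
      Finsupp.linearCombination ℤ (fun e => (ε e : ℤ) • Δ'.χ e) n = 0) :
    ∃ φ : Δ.charSpan ≃ₗ[ℤ] Δ'.charSpan, ∀ e, φ (Δ.toU.χ e) = (ε e : ℤ) • Δ'.toU.χ e := by
  obtain ⟨φ, hφ⟩ := exists_equiv_of_relations h
  have hspan : Submodule.span ℤ (Set.range fun e => (ε e : ℤ) • Δ'.χ e) = Δ'.charSpan := by
    refine le_antisymm (Submodule.span_le.2 ?_) (Submodule.span_le.2 ?_)
    · rintro _ ⟨e, rfl⟩
      exact Submodule.smul_mem _ _ (Submodule.subset_span ⟨e, rfl⟩)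
    · rintro _ ⟨e, rfl⟩
      have h1 : Δ'.χ e = (ε e : ℤ) • (ε e : ℤ) • Δ'.χ e := by
        rw [smul_smul, ← Units.val_mul, Int.units_mul_self, Units.val_one, one_smul]
      rw [h1]
      exact Submodule.smul_mem _ _ (Submodule.subset_span ⟨e, rfl⟩)
  exact ⟨φ.trans (LinearEquiv.ofEq _ _ hspan), fun e => Subtype.ext (hφ e _)⟩

variable [Module.Free ℤ Λ] [Module.Finite ℤ Λ] [Module.Free ℤ Λ'] [Module.Finite ℤ Λ'] [Finite E]

/-- The poset of layers determines the relations of the characters up to signs. -/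
theorem SameLayerPoset.exists_signs (h : Δ.SameLayerPoset Δ') (hΔ : Δ.IsCentred)
    (hΔ' : Δ'.IsCentred) :
    ∃ ε : E → ℤˣ, ∀ n : E →₀ ℤ, Finsupp.linearCombination ℤ Δ.χ n = 0 ↔
      Finsupp.linearCombination ℤ (fun e => (ε e : ℤ) • Δ'.χ e) n = 0 := by
  obtain ⟨g, hg⟩ := Δ.exists_spans
  let b := Module.finBasis ℤ (radical Δ.charSpan)
  let b' := Module.finBasisOfFinrankEq ℤ (radical Δ'.charSpan) (h.finrank_eq hΔ hΔ').symm
  have hcast : ∀ {Λ : Type} [AddCommGroup Λ] {Δ : ToricArrangement Λ E} {n : ℕ}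
      (b : Module.Basis (Fin n) ℤ (radical Δ.charSpan)) (g : Fin n → E),
      (Matrix.of fun i j => (coord b (g j) i : ℚ)).det =
        ((Matrix.of fun i j => coord b (g j) i).det : ℤ) := fun b g =>
    ((Int.castRingHom ℚ).map_det _).symm
  obtain ⟨ε, hε⟩ := exists_signs_relations (K := ℚ) (W := fun e i => (coord b e i : ℚ))
    (W' := fun e i => (coord b' e i : ℚ)) (g₀ := g) (by
      rw [hcast, Int.cast_ne_zero, ← Int.natAbs_ne_zero, hg.natAbs_det]
      exact radIndex_ne_zero _) (fun f => by
      rw [hcast, hcast, ← Int.cast_pow, h.sq_det_eq hΔ hΔ', Int.cast_pow])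
  refine ⟨ε, fun n => ?_⟩
  rw [← sum_coord_eq_zero_iff b' ε, ← hε]
  have := sum_coord_eq_zero_iff b 1 n
  simpa using this.symm

theorem SameLayerPoset.exists_equiv (h : Δ.SameLayerPoset Δ') (hΔ : Δ.IsCentred)
    (hΔ' : Δ'.IsCentred) : ∃ (ε : E → ℤˣ) (φ : Δ.charSpan ≃ₗ[ℤ] Δ'.charSpan),
      ∀ e, φ (Δ.toU.χ e) = (ε e : ℤ) • Δ'.toU.χ e :=
  let ⟨ε, hε⟩ := h.exists_signs hΔ hΔ'
  ⟨ε, exists_equiv_of_sign_relations hε⟩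

end ToricArrangement
end

noncomputable section

/-! ### Isomorphisms of tori and arrangements -/

namespace ToricArrangement

variable {Λ Λ' E : Type} [AddCommGroup Λ] [AddCommGroup Λ'] {Δ : ToricArrangement Λ E}
  {Δ' : ToricArrangement Λ' E}

/-- The arrangement is the lift of `Δ.toU` along the inclusion of `charSpan`; being essential makes
the cokernel finite, so the counting formula applies. -/
theorem isCoherent_invClass [Module.Free ℤ Λ] [Module.Finite ℤ Λ] (h : Δ.IsEssential) :
    IsCoherent Δ.toU Δ.mult Δ.invClass := by
  have : Finite (Λ ⧸ Δ.charSpan) := (Submodule.finiteQuotient_iff _).2 h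
  exact fun S => card_maxSplit_mul_mult Δ.toU _ _ _ S

section

variable {g : AlgTorus Λ ≃ₜ AlgTorus Λ'}

theorem image_inter (hg : ∀ e, g '' Δ.hypertorus e = Δ'.hypertorus e) (S : Set E) :
    g '' Δ.inter S = Δ'.inter S := by
  ext t
  rw [← g.coe_toEquiv, Equiv.image_eq_preimage_symm]
  refine forall₂_congr fun e _ => ?_
  rw [← hg e, ← g.coe_toEquiv, Equiv.image_eq_preimage_symm]
  rfl

theorem symm_image_hypertorus (hg : ∀ e, g '' Δ.hypertorus e = Δ'.hypertorus e) (e : E) :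
    g.symm '' Δ'.hypertorus e = Δ.hypertorus e := by
  rw [← hg e, Set.image_image]
  simp

/-- The image of a layer under a homeomorphism that respects the hypertori. -/
def Layer.map (g : AlgTorus Λ ≃ₜ AlgTorus Λ')
    (hg : ∀ e, g '' Δ.hypertorus e = Δ'.hypertorus e) (W : Δ.Layer) : Δ'.Layer :=
  ⟨g '' W.1, by
    obtain ⟨_, S, t, ht, rfl⟩ := W
    refine ⟨S, g t, image_inter hg S ▸ ⟨t, ht, rfl⟩, ?_⟩
    rw [← image_inter hg S]
    exact g.image_connectedComponentIn ht⟩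

theorem sameLayerPoset_of_homeomorph (hg : ∀ e, g '' Δ.hypertorus e = Δ'.hypertorus e) :
    Δ.SameLayerPoset Δ' := by
  refine ⟨⟨⟨Layer.map g hg, Layer.map g.symm (symm_image_hypertorus hg), fun W => ?_,
    fun W => ?_⟩, fun {W W'} => ?_⟩, fun e W => ?_⟩
  · refine Subtype.ext ?_
    change g.symm '' (g '' W.1) = W.1
    rw [Set.image_image]
    simp
  · refine Subtype.ext ?_
    change g '' (g.symm '' W.1) = W.1
    rw [Set.image_image]
    simp
  · exact Set.image_subset_image_iff g.injective
  · rw [← hg e]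
    exact (Set.image_subset_image_iff g.injective).symm

end

/-- An isomorphism of algebraic groups as a homeomorphism. -/
def _root_.AlgTorus.homeomorph {f : AlgTorus Λ ≃* AlgTorus Λ'} (hf : IsAlgIso f) :
    AlgTorus Λ ≃ₜ AlgTorus Λ' where
  toEquiv := f.toEquiv
  continuous_toFun := AlgTorus.continuous_of_isAlgHom hf.1
  continuous_invFun := AlgTorus.continuous_of_isAlgHom hf.2

theorem sameLayerPoset_of_isAlgIso {g : AlgTorus Λ ≃* AlgTorus Λ'} (hg : IsAlgIso g)
    (h : ∀ e, g '' Δ.hypertorus e = Δ'.hypertorus e) : Δ.SameLayerPoset Δ' :=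
  sameLayerPoset_of_homeomorph (g := AlgTorus.homeomorph hg) h

theorem image_hypertorus_eq_iff (hΔ : Δ.IsCentred) (hΔ' : Δ'.IsCentred)
    {g : AlgTorus Λ ≃* AlgTorus Λ'} {e : E} : g '' Δ.hypertorus e = Δ'.hypertorus e ↔
      ∀ t, torusChar (Δ.χ e) t = 1 ↔ torusChar (Δ'.χ e) (g t) = 1 := by
  simp only [← hΔ.mem_hypertorus, ← hΔ'.mem_hypertorus]
  constructor
  · intro h t
    rw [← h]
    exact (g.injective.mem_set_image).symm
  · intro h
    ext u
    obtain ⟨t, rfl⟩ := g.surjective u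
    rw [← h, g.injective.mem_set_image]

/-- The characters trivial on `{b = 1}` are the multiples of `b`, so the locus determines the cyclic
group `ℤb`, whose generators differ by a sign. -/
theorem _root_.torusChar_eq_one_iff_exists_unit [Module.IsTorsionFree ℤ Λ] {a b : Λ} :
    (∀ t, torusChar a t = 1 ↔ torusChar b t = 1) ↔ ∃ u : ℤˣ, a = (u : ℤ) • b := by
  constructor
  · intro h
    have key : ∀ {a b : Λ}, (∀ t, torusChar a t = 1 → torusChar b t = 1) →
        b ∈ Submodule.span ℤ {a} := fun h =>
      AlgTorus.mem_of_forall_torusChar_eq_one fun t ht =>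
        h t (ht _ (Submodule.mem_span_singleton_self _))
    have hspan : Submodule.span ℤ {b} = Submodule.span ℤ {a} :=
      le_antisymm ((Submodule.span_singleton_le_iff_mem _ _).2 (key fun t => (h t).1))
        ((Submodule.span_singleton_le_iff_mem _ _).2 (key fun t => (h t).2))
    obtain ⟨u, hu⟩ := Submodule.span_singleton_eq_span_singleton.1 hspan
    exact ⟨u, hu.symm⟩
  · rintro ⟨u, rfl⟩ t
    rcases Int.units_eq_one_or u with rfl | rfl <;> simp

/-- Isomorphisms of the character groups induce the isomorphisms of the lattices that match the
classes. -/
theorem exists_sameClass_iff {ε : E → ℤˣ} :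
    (∃ h : Λ ≃ₗ[ℤ] Λ', ∀ e, h (Δ.χ e) = (ε e : ℤ) • Δ'.χ e) ↔
      ∃ φ : Δ.charSpan ≃ₗ[ℤ] Δ'.charSpan,
        (∀ e, φ (Δ.toU.χ e) = (ε e : ℤ) • Δ'.toU.χ e) ∧ Δ.SameClass Δ' φ := by
  constructor
  · rintro ⟨h, hh⟩
    have hmap : Δ.charSpan.map (h : Λ →ₗ[ℤ] Λ') = Δ'.charSpan := by
      rw [charSpan, Submodule.map_span]
      refine le_antisymm (Submodule.span_le.2 ?_) (Submodule.span_le.2 ?_)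
      · rintro _ ⟨_, ⟨e, rfl⟩, rfl⟩
        change h (Δ.χ e) ∈ _
        rw [hh]
        exact Submodule.smul_mem _ _ (Submodule.subset_span ⟨e, rfl⟩)
      · rintro _ ⟨e, rfl⟩
        have h1 : Δ'.χ e = (ε e : ℤ) • h (Δ.χ e) := by
          rw [hh, smul_smul, ← Units.val_mul, Int.units_mul_self, Units.val_one, one_smul]
        rw [h1]
        exact Submodule.smul_mem _ _ (Submodule.subset_span ⟨_, ⟨e, rfl⟩, rfl⟩)
    let φ : Δ.charSpan ≃ₗ[ℤ] Δ'.charSpan :=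
      (h.submoduleMap Δ.charSpan).trans (LinearEquiv.ofEq _ _ hmap)
    obtain ⟨σ, hσ⟩ := exists_cokernel_equiv (LinearMap.exact_subtype_mkQ Δ.charSpan)
      (Submodule.mkQ_surjective _) (LinearMap.exact_subtype_mkQ Δ'.charSpan)
      (Submodule.mkQ_surjective _) (a := φ) (e := h) fun _ => rfl
    exact ⟨φ, fun e => Subtype.ext (hh e), σ, extensionClass_naturality _ _ _ _ _ _
      (h := h.toLinearMap) rfl (LinearMap.ext fun x => (hσ x).symm)⟩
  · rintro ⟨φ, hφ, σ, hσ⟩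
    obtain ⟨h, hh, -⟩ := exists_equiv_of_extPush_eq_extPull _ _ _ _ _ _ hσ
    exact ⟨h, fun e => (hh (Δ.toU.χ e)).trans (congrArg Subtype.val (hφ e))⟩

/-- The poset of layers and the class of the extension determine the hypertori up to
automorphisms. -/
theorem exists_isAlgIso_image_iff [Module.IsTorsionFree ℤ Λ'] (hΔ : Δ.IsCentred)
    (hΔ' : Δ'.IsCentred) :
    (∃ g : AlgTorus Λ ≃* AlgTorus Λ', IsAlgIso g ∧
        ∀ e, g '' Δ.hypertorus e = Δ'.hypertorus e) ↔
      Δ.SameLayerPoset Δ' ∧ ∃ (ε : E → ℤˣ) (φ : Δ.charSpan ≃ₗ[ℤ] Δ'.charSpan),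
        (∀ e, φ (Δ.toU.χ e) = (ε e : ℤ) • Δ'.toU.χ e) ∧ Δ.SameClass Δ' φ := by
  simp only [← exists_sameClass_iff]
  -- The torus map covariant with `h` is dual to `h.symm`; it carries one hypertorus to the other
  -- exactly when `h` carries one character to the other up to sign.
  have key : ∀ (h : Λ ≃ₗ[ℤ] Λ') (e : E),
      AlgTorus.dualEquiv h.symm '' Δ.hypertorus e = Δ'.hypertorus e ↔
        ∃ u : ℤˣ, h (Δ.χ e) = (u : ℤ) • Δ'.χ e := by
    intro h e
    rw [image_hypertorus_eq_iff hΔ hΔ', ← torusChar_eq_one_iff_exists_unit]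
    refine (AlgTorus.dualEquiv h.symm).toEquiv.forall_congr fun t => ?_
    change _ ↔ (torusChar _ (AlgTorus.dualEquiv h.symm t) = 1 ↔
      torusChar _ (AlgTorus.dualEquiv h.symm t) = 1)
    rw [AlgTorus.torusChar_dualEquiv, AlgTorus.torusChar_dualEquiv, h.symm_apply_apply]
  constructor
  · rintro ⟨g, hg, h⟩
    refine ⟨sameLayerPoset_of_isAlgIso hg h, ?_⟩
    obtain ⟨ψ, rfl⟩ := AlgTorus.exists_eq_dualEquiv hg
    choose ε hε using fun e => (key ψ.symm e).1 (h e)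
    exact ⟨ε, ψ.symm, hε⟩
  · rintro ⟨-, ε, h, hh⟩
    exact ⟨_, AlgTorus.isAlgIso_dualEquiv h.symm, fun e => (key h e).2 ⟨ε e, hh e⟩⟩

theorem exists_isAlgIso_torusChar_iff (hΔ : Δ.IsCentred) (hΔ' : Δ'.IsCentred) :
    (∃ g : AlgTorus Λ ≃* AlgTorus Λ', IsAlgIso g ∧
        ∀ e t, torusChar (Δ'.χ e) (g t) = torusChar (Δ.χ e) t) ↔
      Δ.SameLayerPoset Δ' ∧ ∃ φ : Δ.charSpan ≃ₗ[ℤ] Δ'.charSpan,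
        (∀ e, φ (Δ.toU.χ e) = Δ'.toU.χ e) ∧ Δ.SameClass Δ' φ := by
  have hiff := exists_sameClass_iff (Δ := Δ) (Δ' := Δ') (ε := 1)
  simp only [Pi.one_apply, Units.val_one, one_smul] at hiff
  rw [← hiff]
  constructor
  · rintro ⟨g, hg, h⟩
    refine ⟨sameLayerPoset_of_isAlgIso hg fun e =>
      (image_hypertorus_eq_iff hΔ hΔ').2 fun t => by rw [h], ?_⟩
    obtain ⟨ψ, rfl⟩ := AlgTorus.exists_eq_dualEquiv hg
    refine ⟨ψ.symm, fun e => ?_⟩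
    rw [LinearEquiv.symm_apply_eq]
    exact (AlgTorus.torusChar_injective fun t => h e t).symm
  · rintro ⟨-, h, hh⟩
    refine ⟨_, AlgTorus.isAlgIso_dualEquiv h.symm, fun e t => ?_⟩
    rw [AlgTorus.torusChar_dualEquiv, ← hh, h.symm_apply_apply]

/-! ### Arrangements in normal form -/

theorem one_tmul_eq_zero_iff [Module.Free ℤ Λ] {x : Λ} : (1 : ℚ) ⊗ₜ[ℤ] x = 0 ↔ x = 0 := by
  refine ⟨fun h => ?_, fun h => by rw [h, TensorProduct.tmul_zero]⟩
  let b := Module.Free.chooseBasis ℤ Λ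
  refine b.forall_coord_eq_zero_iff.1 fun i => ?_
  have := congrArg (fun y => (Algebra.TensorProduct.basis ℚ b).repr y i) h
  simpa using this

theorem coordGraph_adj_iff {B : Set E} {b : Module.Basis B ℚ (ℚ ⊗[ℤ] Λ)} {i : B} {j : E}
    (hj : j ∉ B) : (Δ.coordGraph b).Adj i j ↔ b.repr (1 ⊗ₜ[ℤ] Δ.χ j) i ≠ 0 := by
  rw [coordGraph, SimpleGraph.fromRel_adj]
  constructor
  · rintro ⟨-, ⟨_, -, h⟩ | ⟨h, -⟩⟩
    · exact h
    · exact absurd h hj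
  · intro h
    exact ⟨fun hij => hj (hij ▸ i.2), Or.inl ⟨i.2, hj, h⟩⟩

theorem coordGraph_adj_cases {B : Set E} {b : Module.Basis B ℚ (ℚ ⊗[ℤ] Λ)} {u v : E}
    (h : (Δ.coordGraph b).Adj u v) : (u ∈ B ∧ v ∉ B) ∨ (v ∈ B ∧ u ∉ B) := by
  rw [coordGraph, SimpleGraph.fromRel_adj] at h
  rcases h with ⟨-, ⟨h, h', -⟩ | ⟨h, h', -⟩⟩
  · exact Or.inl ⟨h, h'⟩
  · exact Or.inr ⟨h, h'⟩

/-- The coordinates of the characters transform by the signs. -/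
theorem repr_eq_of_signs [Finite E] [Module.Free ℤ Λ] {ε : E → ℤˣ} (hε : ∀ n : E →₀ ℤ,
      Finsupp.linearCombination ℤ Δ.χ n = 0 →
        Finsupp.linearCombination ℤ (fun e => (ε e : ℤ) • Δ'.χ e) n = 0) {B : Set E}
    {b : Module.Basis B ℚ (ℚ ⊗[ℤ] Λ)} (hb : ∀ i : B, b i = 1 ⊗ₜ[ℤ] Δ.χ i)
    {b' : Module.Basis B ℚ (ℚ ⊗[ℤ] Λ')} (hb' : ∀ i : B, b' i = 1 ⊗ₜ[ℤ] Δ'.χ i) (j : E) (i : B) :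
    ((ε j : ℤ) : ℚ) * b'.repr (1 ⊗ₜ[ℤ] Δ'.χ j) i =
      ((ε i : ℤ) : ℚ) * b.repr (1 ⊗ₜ[ℤ] Δ.χ j) i := by
  have := Fintype.ofFinite B
  -- Clearing denominators turns the expansion of `χ_j` in the basis into an integral relation,
  -- which `hε` transports to `Δ'`.
  obtain ⟨N, hN⟩ := IsLocalization.exist_integer_multiples_of_finite (nonZeroDivisors ℤ)
    fun i => b.repr (1 ⊗ₜ[ℤ] Δ.χ j) i
  choose n hn using hN
  replace hn : ∀ i, (n i : ℚ) = (N : ℤ) * b.repr (1 ⊗ₜ[ℤ] Δ.χ j) i := fun i => by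
    simpa [Algebra.smul_def] using hn i
  have hN0 : ((N : ℤ) : ℚ) ≠ 0 := Int.cast_ne_zero.2 (nonZeroDivisors.coe_ne_zero N)
  have h1 : (N : ℤ) • Δ.χ j = ∑ i : B, n i • Δ.χ i := by
    rw [← sub_eq_zero, ← one_tmul_eq_zero_iff, TensorProduct.tmul_sub, sub_eq_zero,
      TensorProduct.tmul_sum]
    have h2 := congrArg (fun y => ((N : ℤ) : ℚ) • y) (b.sum_repr (1 ⊗ₜ[ℤ] Δ.χ j))
    simp only [Finset.smul_sum, smul_smul, ← hn, hb] at h2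
    simp only [TensorProduct.tmul_smul, ← Int.cast_smul_eq_zsmul ℚ]
    exact h2.symm
  have h3 := hε (Finsupp.single j (N : ℤ) - ∑ i : B, Finsupp.single (i : E) (n i)) (by
    simp [h1])
  have h4 : (N : ℤ) • (ε j : ℤ) • Δ'.χ j = ∑ i : B, n i • (ε i : ℤ) • Δ'.χ i := by
    rw [← sub_eq_zero]
    simpa using h3
  have h5 := congrArg (fun y => b'.repr (1 ⊗ₜ[ℤ] y) i) h4
  simp only [TensorProduct.tmul_sum, TensorProduct.tmul_smul, ← Int.cast_smul_eq_zsmul ℚ, ← hb',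
    map_smul, map_sum, Finsupp.smul_apply, Finsupp.finsetSum_apply, Module.Basis.repr_self,
    smul_eq_mul] at h5
  rw [Finset.sum_eq_single i (fun k _ hk => by rw [Finsupp.single_eq_of_ne hk.symm]; simp)
    (by simp), Finsupp.single_eq_same, mul_one, hn] at h5
  refine mul_left_cancel₀ hN0 ?_
  rw [h5]
  ring

theorem linearCombination_eq_zero_iff [Module.Free ℤ Λ] {B : Set E}
    (b : Module.Basis B ℚ (ℚ ⊗[ℤ] Λ)) (n : E →₀ ℤ) :
    Finsupp.linearCombination ℤ Δ.χ n = 0 ↔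
      ∀ i, ∑ e ∈ n.support, (n e : ℚ) * b.repr (1 ⊗ₜ[ℤ] Δ.χ e) i = 0 := by
  rw [← one_tmul_eq_zero_iff, ← b.forall_coord_eq_zero_iff]
  refine forall_congr' fun i => ?_
  rw [Finsupp.linearCombination_apply, Finsupp.sum, TensorProduct.tmul_sum, map_sum]
  refine iff_of_eq (congrArg (· = 0) (Finset.sum_congr rfl fun e _ => ?_))
  rw [TensorProduct.tmul_smul, ← Int.cast_smul_eq_zsmul ℚ, map_smul]
  rfl

/-- Positivity on both sides makes the signs constant along `F`. A maximal forest connects the ends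
of every nonzero entry, so the signs cancel in all coordinates. -/
theorem relations_of_isNormalForm [Finite E] [Module.Free ℤ Λ] [Module.Free ℤ Λ'] {ε : E → ℤˣ}
    (hε : ∀ n : E →₀ ℤ, Finsupp.linearCombination ℤ Δ.χ n = 0 →
        Finsupp.linearCombination ℤ (fun e => (ε e : ℤ) • Δ'.χ e) n = 0) {B : Set E}
    {F : SimpleGraph E} (h : Δ.IsNormalForm B F) (h' : Δ'.IsNormalForm B F) (n : E →₀ ℤ) :
    Finsupp.linearCombination ℤ Δ.χ n = 0 ↔ Finsupp.linearCombination ℤ Δ'.χ n = 0 := by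
  obtain ⟨b, hb, hF, hpos⟩ := h
  obtain ⟨b', hb', -, hpos'⟩ := h'
  have hrepr := repr_eq_of_signs hε hb hb'
  have hadj : ∀ (i : B) (j : E), j ∉ B → F.Adj i j → ε i = ε j := by
    intro i j hj hij
    have h1 := hrepr j i
    have h2 := hpos i j hj hij
    have h3 := hpos' i j hj hij
    rcases Int.units_eq_or_eq_neg (ε i) (ε j) with h4 | h4
    · exact h4
    · exfalso
      rcases Int.units_eq_one_or (ε j) with h5 | h5 <;> rw [h4, h5] at h1 <;>
        simp at h1 <;> linarith
  have hF' : ∀ u v, F.Adj u v → ε u = ε v := by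
    intro u v huv
    rcases coordGraph_adj_cases (hF.prop.1 huv) with ⟨hu, hv⟩ | ⟨hv, hu⟩
    · exact hadj ⟨u, hu⟩ v hv huv
    · exact (hadj ⟨v, hv⟩ u hu huv.symm).symm
  have hreach : ∀ u v, F.Reachable u v → ε u = ε v := by
    rintro u v ⟨p⟩
    induction p with
    | nil => rfl
    | cons h _ ih => exact (hF' _ _ h).trans ih
  have heq : ∀ e i, b'.repr (1 ⊗ₜ[ℤ] Δ'.χ e) i = b.repr (1 ⊗ₜ[ℤ] Δ.χ e) i := by
    intro e i
    by_cases he : e ∈ B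
    · rw [← hb ⟨e, he⟩, ← hb' ⟨e, he⟩, b.repr_self, b'.repr_self]
    · have h1 := hrepr e i
      have hu : ((ε e : ℤ) : ℚ) ≠ 0 := Int.cast_ne_zero.2 (Units.ne_zero _)
      by_cases h0 : b.repr (1 ⊗ₜ[ℤ] Δ.χ e) i = 0
      · rw [h0, mul_zero] at h1
        rw [h0]
        exact (mul_eq_zero.1 h1).resolve_left hu
      · have h2 : F.Reachable i e := by
          rw [SimpleGraph.reachable_eq_of_maximal_isAcyclic F hF]
          exact ((coordGraph_adj_iff he).2 h0).reachable
        rw [hreach _ _ h2] at h1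
        exact mul_left_cancel₀ hu h1
  simp only [linearCombination_eq_zero_iff b, linearCombination_eq_zero_iff b', heq]

theorem SameLayerPoset.existsUnique_equiv [Module.Free ℤ Λ] [Module.Finite ℤ Λ]
    [Module.Free ℤ Λ'] [Module.Finite ℤ Λ'] [Finite E] (h : Δ.SameLayerPoset Δ')
    (hΔ : Δ.IsCentred) (hΔ' : Δ'.IsCentred) {B : Set E} {F : SimpleGraph E}
    (hn : Δ.IsNormalForm B F) (hn' : Δ'.IsNormalForm B F) :
    ∃! φ : Δ.charSpan ≃ₗ[ℤ] Δ'.charSpan, ∀ e, φ (Δ.toU.χ e) = Δ'.toU.χ e := by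
  obtain ⟨ε, hε⟩ := h.exists_signs hΔ hΔ'
  have hrel := relations_of_isNormalForm (fun n => (hε n).1) hn hn'
  obtain ⟨φ, hφ⟩ := exists_equiv_of_sign_relations (Δ := Δ) (Δ' := Δ') (ε := 1) (by simpa using hrel)
  simp only [Pi.one_apply, Units.val_one, one_smul] at hφ
  refine ⟨φ, hφ, fun ψ hψ => LinearEquiv.ext fun x => ?_⟩
  obtain ⟨x, hx⟩ := x
  induction hx using Submodule.span_induction with
  | mem x hx =>
    obtain ⟨e, rfl⟩ := hx
    exact (hψ e).trans (hφ e).symm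
  | zero => exact (map_zero ψ).trans (map_zero φ).symm
  | add x y hx hy h₁ h₂ =>
    have : (⟨x + y, Submodule.add_mem _ hx hy⟩ : Δ.charSpan) = ⟨x, hx⟩ + ⟨y, hy⟩ := rfl
    exact (congrArg ψ this).trans (((map_add ψ _ _).trans (by rw [h₁, h₂])).trans
      ((congrArg φ this).trans (map_add φ _ _)).symm)
  | smul a x hx h₁ =>
    have : (⟨a • x, Submodule.smul_mem _ a hx⟩ : Δ.charSpan) = a • ⟨x, hx⟩ := rfl
    exact (congrArg ψ this).trans (((map_smul ψ _ _).trans (by rw [h₁])).trans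
      ((congrArg φ this).trans (map_smul φ _ _)).symm)

end ToricArrangement
end

/-! ### The theorem and its corollary -/

theorem mainTheorem6 :
    -- the correspondence between coherent elements and coverings
    (∀ (Γ G E : Type) [AddCommGroup Γ] [Module.Free ℤ Γ] [Module.Finite ℤ Γ]
        [AddCommGroup G] [Finite G] [Finite E]
        (ΔU : ToricArrangement Γ E) (T : TorusCovering Γ),
        ΔU.IsSurjective → ConnectedSpace (AlgTorus T.Λ) →
        Nonempty (T.proj.ker ≃* AlgTorus G) →
      ∃ Φ : CoherentClasses G ΔU (ΔU.liftMult T) → CoveringClasses ΔU (ΔU.liftMult T),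
        Function.Bijective Φ ∧
        ∀ (x : ExtOne G Γ) (hx : IsCoherent ΔU (ΔU.liftMult T) x)
          (X : Type) [AddCommGroup X] (i : Γ →ₗ[ℤ] X) (q : X →ₗ[ℤ] G)
          (hi : Function.Injective i) (hiq : Function.Exact i q) (hq : Function.Surjective q),
          extensionClass i q hi hiq hq = x →
          ∃ (_ : Module.Finite ℤ X) (hcov : IsCoveringMap (dualHom i))
            (hm : ΔU.liftMult ⟨X, dualHom i, dualHom_isAlgHom i, hcov⟩ = ΔU.liftMult T),
            Φ (Quotient.mk _ ⟨x, hx⟩) =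
              Quotient.mk _ ⟨⟨X, dualHom i, dualHom_isAlgHom i, hcov⟩, hm⟩) ∧
    -- the complete invariant of centred arrangements
    (∀ (Λ E : Type) [AddCommGroup Λ] [Module.Free ℤ Λ] [Module.Finite ℤ Λ] [Finite E]
        (Δ Δ' : ToricArrangement Λ E),
        Δ.IsCentred → Δ'.IsCentred →
      -- the class of an essential arrangement is coherent
      (Δ.IsEssential → IsCoherent Δ.toU Δ.mult Δ.invClass) ∧
      -- the poset determines the lattice and the characters up to signs
      (Δ.SameLayerPoset Δ' →
        ∃ (ε : E → ℤˣ) (φ : Δ.charSpan ≃ₗ[ℤ] Δ'.charSpan),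
          ∀ e, φ (Δ.toU.χ e) = (ε e : ℤ) • Δ'.toU.χ e) ∧
      -- the poset and the class determine the collection of hypertori
      ((∃ g : AlgTorus Λ ≃* AlgTorus Λ, IsAlgIso g ∧
          ∀ e, g '' Δ.hypertorus e = Δ'.hypertorus e) ↔
        Δ.SameLayerPoset Δ' ∧
          ∃ (ε : E → ℤˣ) (φ : Δ.charSpan ≃ₗ[ℤ] Δ'.charSpan),
            (∀ e, φ (Δ.toU.χ e) = (ε e : ℤ) • Δ'.toU.χ e) ∧ Δ.SameClass Δ' φ) ∧
      -- the poset and the class determine the characters of arrangements in normal form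
      (∀ (B : Set E) (F : SimpleGraph E), Δ.IsNormalForm B F → Δ'.IsNormalForm B F →
        (Δ.SameLayerPoset Δ' →
          ∃! φ : Δ.charSpan ≃ₗ[ℤ] Δ'.charSpan, ∀ e, φ (Δ.toU.χ e) = Δ'.toU.χ e) ∧
        ((∃ g : AlgTorus Λ ≃* AlgTorus Λ, IsAlgIso g ∧
            ∀ e t, torusChar (Δ'.χ e) (g t) = torusChar (Δ.χ e) t) ↔
          Δ.SameLayerPoset Δ' ∧
            ∃ φ : Δ.charSpan ≃ₗ[ℤ] Δ'.charSpan,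
              (∀ e, φ (Δ.toU.χ e) = Δ'.toU.χ e) ∧ Δ.SameClass Δ' φ))) := by
  refine ⟨fun Γ G E _ _ _ _ _ _ ΔU T hΔ hT hker => exists_correspondence ΔU T hΔ hT hker,
    fun Λ E _ _ _ _ Δ Δ' hΔ hΔ' => ⟨ToricArrangement.isCoherent_invClass,
      fun h => h.exists_equiv hΔ hΔ', ToricArrangement.exists_isAlgIso_image_iff hΔ hΔ',
      fun B F hn hn' => ⟨fun h => h.existsUnique_equiv hΔ hΔ' hn hn',
        ToricArrangement.exists_isAlgIso_torusChar_iff hΔ hΔ'⟩⟩⟩
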